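/- **Conventions.** $M_1,M_2,M_3,M_4$ are smooth real supermanifolds with local coordinates $x^a,y^i,z^\mu,w^\kappa$ (parities $\tilde a,\tilde\imath,\tilde\mu,\tilde\kappa$) and conjugate momenta $p_a,q_i,r_\mu,s_\kappa$; all derivatives are left derivatives. Fix finitely many formal parameters, even or odd, on which all objects may depend (as formal power series). A *thick morphism* $\Phi\colon M_1\Rrightarrow M_2$ consists of a continuous map $\varphi$ of the underlying spaces and, for each pair of charts, an even generating function $$S(x,q)=S_0(x)+S^i(x)q_i+\tfrac12 S^{ij}(x)q_jq_i+\cdots,$$ a formal power series in the momenta $q$ of $M_2$ with smooth coefficients (defined where $x$ lies in the first chart and $\varphi(x)$ in the second), such that $S^i(x)$ reduces to the coordinate expression of $\varphi$ when parameters and odd coordinates are set to $0$, and such that a change of coordinates $x\to x'$, $y\to y'$ acts by $S'(x',q')=S(x,q)-y^iq_i+y^{i'}q_{i'}$, where $q_i=\frac{\partial y^{i'}}{\partial y^i}(y)\,q_{i'}$, $y^i=(-1)^{\tilde\imath}\frac{\partial S}{\partial q_i}(x,q)$. Its formal canonical relation in $T^*M_2\times T^*M_1$, with $q$ in the formal neighbourhood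 of $0$, is given by $y^i=(-1)^{\tilde\imath}\frac{\partial S}{\partial q_i}(x,q)$, $p_a=\frac{\partial S}{\partial x^a}(x,q)$; relations are composed set-theoretically on points with values in an arbitrary finite-dimensional supercommutative real algebra with nilpotent augmentation ideal and residue field $\mathbb R$ (the parameters taking nilpotent values). $\Phi$ is called *formal* if $S_0$ lies in the ideal generated by the parameters, and an even function is called formal if it lies in that ideal. Formality expresses that power series in $S_0$ (or in the function) are formal: given an even parameter $\varepsilon$, an arbitrary parameter-free $\Phi$ or function $g$ is replaced by the formal one with $\varepsilon S_0$ in place of $S_0$, respectively by $\varepsilon g$. **Theorem (composition law for thick morphisms).** 1. Let $\Phi_{21}\colon M_1\Rrightarrow M_2$ and $\Phi_{32}\colon M_2\Rrightarrow M_3$ be thick morphisms with generating functions $S_{21}(x,q)$, $S_{32}(y,r)$, with $\Phi_{32}$ formal. In all charts the system $$q_i=\frac{\partial S_{32}}{\partial y^i}(y,r),\qquad y^i=(-1)^{\tilde\imath}\,\frac{\partial S_{21}}{\partial q_i}(x,q)$$ has a unique solution $y=y(x,r)$, $q=q(x,r)$ as formal power series in $r$ (and in the parameters), and at each point with values in an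 algebra as above it has a unique solution with $y$ lying over $\varphi_{21}(x)$ and $q$ nilpotent. There is a unique thick morphism $\Phi_{31}\colon M_1\Rrightarrow M_3$ with underlying map $\varphi_{32}\circ\varphi_{21}$ and generating function $$S_{31}(x,r)=S_{32}(y,r)+S_{21}(x,q)-y^iq_i,$$ and its formal canonical relation is the set-theoretic composition of those of $\Phi_{21}$ and $\Phi_{32}$. Write $\Phi_{31}=\Phi_{32}\circ\Phi_{21}$. If $\Phi_{21}$ is formal, so is $\Phi_{31}$. To first order (whenever all products of two elements among the values of the parameters and of the $r_\mu$ vanish), $S_{31}(x,r)=f_1(x)+f_2(\varphi_{21}(x))+\varphi_{32}^\mu(\varphi_{21}(x))\,r_\mu$, where $f_1=(S_{21})_0$, $f_2=(S_{32})_0$ and $\varphi_{21}^i,\varphi_{32}^\mu$ here denote the coefficients $S_{21}^i,S_{32}^\mu$ of the terms linear in the momenta. 2. Composition is associative: $(\Phi_{43}\circ\Phi_{32})\circ\Phi_{21}=\Phi_{43}\circ(\Phi_{32}\circ\Phi_{21})$ for $\Phi_{32}$ and $\Phi_{43}\colon M_3\Rrightarrow M_4$ formal. 3. Each $M$ has a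 unique identity thick morphism $I_M$, with $S(x,q)=x^aq_a$ in each chart (the same chart being used for source and target); it is formal, $I_{M_2}\circ\Phi=\Phi$ for every $\Phi\colon M_1\Rrightarrow M_2$, and $\Phi\circ I_{M_1}=\Phi$ for every formal $\Phi$. Hence formal thick morphisms form a category. 4. For a thick morphism $\Phi\colon M_1\Rrightarrow M_2$ and a formal even function $g$ on $M_2$ there is a unique even function $\Phi^*[g]$ on $M_1$ with $\Phi^*[g](x)=g(y)+S(x,q)-y^iq_i$, where $(y,q)$ is the solution, unique at each point, of $q_i=\frac{\partial g}{\partial y^i}(y)$, $y^i=(-1)^{\tilde\imath}\frac{\partial S}{\partial q_i}(x,q)$; it is formal if $\Phi$ is. For $\Phi_{32}$ and a function on $M_3$ formal, $(\Phi_{32}\circ\Phi_{21})^*=\Phi_{21}^*\circ\Phi_{32}^*$. 5. Every parameter-free thick morphism extends uniquely to one with parameters and the same generating functions; for each even parameter $\varepsilon$ and each $\Phi$, replacing $S_0$ by $\varepsilon S_0$ (and keeping all the other terms) defines a unique thick morphism, which is formal; and for each parameter-free even function $g$, $\varepsilon g$ is a unique, formal, even function. So 1–4 apply to all thick morphisms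 and even functions. -/

import Mathlib

universe u

open scoped ContDiff

namespace Microformal

noncomputable section

/-! ## Index types with parity -/

/-- Parity (`0` even, `1` odd) of the variables indexed by `σ`. -/
class Parity (σ : Type) where
  par : σ → ZMod 2

/-- Index set of the coordinates (or of the conjugate momenta) of superdimension `n|m`. -/
inductive Ix (n m : ℕ) : Type
  | even (a : Fin n) : Ix n m
  | odd (b : Fin m) : Ix n m

/-- Even indices come before odd ones. -/
def Ix.toSum {n m : ℕ} : Ix n m → Fin n ⊕ₗ Fin m
  | .even a => Sum.inlₗ a
  | .odd b => Sum.inrₗ b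

theorem Ix.toSum_bijective {n m : ℕ} : Function.Bijective (Ix.toSum (n := n) (m := m)) := by
  constructor
  · rintro (a | a) (b | b) h
    · exact congrArg _ (Sum.inl.inj h)
    · exact absurd h (by intro h; cases h)
    · exact absurd h (by intro h; cases h)
    · exact congrArg _ (Sum.inr.inj h)
  · intro s
    rcases s with (a | b)
    · exact ⟨.even a, rfl⟩
    · exact ⟨.odd b, rfl⟩

instance (n m : ℕ) : LinearOrder (Ix n m) := LinearOrder.lift' Ix.toSum Ix.toSum_bijective.1

instance (n m : ℕ) : Fintype (Ix n m) :=
  Fintype.ofEquiv _ (Equiv.ofBijective _ Ix.toSum_bijective).symm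

instance (n m : ℕ) : Parity (Ix n m) where
  par
    | .even _ => 0
    | .odd _ => 1

instance {σ τ : Type} [Parity σ] [Parity τ] : Parity (σ ⊕ₗ τ) where
  par s := Sum.elim Parity.par Parity.par (ofLex s)

/-! ## Test algebras -/

/-- A super Weil algebra: a finite-dimensional real supercommutative algebra, with an augmentation
to `ℝ` whose kernel is nilpotent. -/
structure SuperWeil where
  carrier : Type
  [ring : Ring carrier]
  [algebra : Algebra ℝ carrier]
  gr : ZMod 2 → Submodule ℝ carrier
  [graded : GradedAlgebra gr]
  supercomm : ∀ (i j : ZMod 2) (a b : carrier), a ∈ gr i → b ∈ gr j →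
    a * b = (-1) ^ (i.val * j.val) * (b * a)
  finite : Module.Finite ℝ carrier
  aug : carrier →ₐ[ℝ] ℝ
  /-- every product of at least `order` elements of the augmentation ideal vanishes -/
  order : ℕ
  nilp : ∀ l : List carrier, order ≤ l.length → (∀ b ∈ l, aug b = 0) → l.prod = 0

instance : CoeSort SuperWeil Type := ⟨SuperWeil.carrier⟩

attribute [instance] SuperWeil.ring SuperWeil.algebra SuperWeil.graded

/-- Admissible values of formal variables: of the right parity, and nilpotent. -/
def SuperWeil.IsFormal (B : SuperWeil) {σ : Type} [Parity σ] (v : σ → B) : Prop :=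
  ∀ s, v s ∈ B.gr (Parity.par s) ∧ B.aug (v s) = 0

/-- The sign `(-1)^{ĩ}`. -/
def sgn (B : SuperWeil) {σ : Type} [Parity σ] (s : σ) : B := (-1) ^ (Parity.par s : ZMod 2).val

/-! ## Formal superfunctions -/

/-- The formal variables of a superfunction: parameters (indexed by `P`), odd coordinates
(`m` of them), and momenta (indexed by `Q`), in this order. -/
abbrev Vars (P : Type) (m : ℕ) (Q : Type) : Type := P ⊕ₗ (Ix 0 m ⊕ₗ Q)

/-- Coefficient families of formal power series in the variables `Vars P m Q` whose coefficients
are functions of `n` real variables: `F α` is the coefficient of the ordered monomial with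
exponents `α`. -/
abbrev Coef (n : ℕ) (P : Type) (m : ℕ) (Q : Type) : Type :=
  (Vars P m Q → ℕ) → (Fin n → ℝ) → ℝ

section Superfunctions

variable {n m : ℕ} {P Q : Type} [Fintype P] [LinearOrder P] [Parity P]
  [Fintype Q] [LinearOrder Q] [Parity Q]

/-- `F` is a superfunction over the open set `U`: the coefficients are smooth on `U` (and, to make
`F` unique, set to zero off `U`) and no monomial contains the square of an odd variable. -/
def IsSmoothOn (U : Set (Fin n → ℝ)) (F : Coef n P m Q) : Prop :=
  (∀ α, ContDiffOn ℝ ∞ (F α) U) ∧ (∀ α x, x ∉ U → F α x = 0) ∧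
    ∀ α s, Parity.par s = (1 : ZMod 2) → 2 ≤ α s → F α = 0

/-- `F` is homogeneous of parity `p`. -/
def IsHomog (p : ZMod 2) (F : Coef n P m Q) : Prop :=
  ∀ α x, F α x ≠ 0 → ∑ s, (α s : ZMod 2) * Parity.par s = p

/-- Left partial derivative with respect to a formal variable. -/
def dVar (s : Vars P m Q) (F : Coef n P m Q) : Coef n P m Q := fun α x =>
  (-1) ^ ((Parity.par s : ZMod 2).val *
      ∑ t ∈ Finset.univ.filter (· < s), (Parity.par t : ZMod 2).val * α t) *
    ((α s : ℝ) + 1) * F (α + Pi.single s 1) x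

/-- Left partial derivative with respect to a coordinate. -/
def dCoord (k : Ix n m) (F : Coef n P m Q) : Coef n P m Q :=
  match k with
  | .even a => fun α x => fderiv ℝ (F α) x (Pi.single a 1)
  | .odd b => dVar (Sum.inrₗ (Sum.inlₗ (Ix.odd b))) F

/-- Left partial derivative with respect to a momentum. -/
def dMom (k : Q) (F : Coef n P m Q) : Coef n P m Q := dVar (Sum.inrₗ (Sum.inrₗ k)) F

/-- Value of a smooth function at a point with coordinates in the even part of `B`, by the Taylor
expansion at the underlying real point. -/
def evalSmooth (B : SuperWeil) (f : (Fin n → ℝ) → ℝ) (x : Fin n → B) : B :=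
  ∑ k ∈ Finset.range B.order, ∑ t : Fin k → Fin n,
    ((k.factorial : ℝ)⁻¹ *
        iteratedFDeriv ℝ k f (fun a => B.aug (x a)) (fun j => Pi.single (t j) 1)) •
      (List.ofFn fun j => x (t j) - algebraMap ℝ B (B.aug (x (t j)))).prod

/-- Values of all formal variables, given the parameters `c`, the coordinates `x` and the
momenta `q`. -/
def varVal {B : SuperWeil} (c : P → B) (x : Ix n m → B) (q : Q → B) : Vars P m Q → B := fun s =>
  Sum.elim c (fun t => Sum.elim
    (fun k : Ix 0 m => match k with
      | .even a => a.elim0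
      | .odd b => x (.odd b)) q (ofLex t)) (ofLex s)

/-- Value of a superfunction at the parameters `c`, coordinates `x`, momenta `q` in `B`. The values
of the formal variables are nilpotent, so higher exponents do not contribute. -/
def evalAt {B : SuperWeil} (F : Coef n P m Q) (c : P → B) (x : Ix n m → B) (q : Q → B) : B :=
  ∑ α ∈ Fintype.piFinset (fun _ : Vars P m Q => Finset.range B.order),
    evalSmooth B (F α) (fun a => x (.even a)) *
      ((Finset.univ.sort (· ≤ ·)).map fun s => varVal c x q s ^ α s).prod

end Superfunctions

/-! ## Supermanifolds -/

/-- A supermanifold of dimension `n|m`, given by an atlas: charts of the underlying space together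
with superdomain coordinate changes. -/
structure SuperManifold (n m : ℕ) where
  carrier : Type u
  [top : TopologicalSpace carrier]
  [t2 : T2Space carrier]
  [sc : SecondCountableTopology carrier]
  ι : Type u
  chart : ι → OpenPartialHomeomorph carrier (Fin n → ℝ)
  cover : ∀ b, ∃ i, b ∈ (chart i).source
  /-- the coordinates of chart `j` as superfunctions of the coordinates of chart `i` -/
  trans : ι → ι → Ix n m → Coef n (Ix 0 0) m (Ix 0 0)
  trans_smooth : ∀ i j k, IsSmoothOn ((chart i).symm.trans (chart j)).source (trans i j k)
  trans_par : ∀ i j k, IsHomog (Parity.par k) (trans i j k)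
  trans_body : ∀ i j b, b ∈ (chart i).source → b ∈ (chart j).source → ∀ a,
    trans i j (.even a) 0 (chart i b) = chart j b a
  trans_refl : ∀ (i : ι) (b : carrier), b ∈ (chart i).source →
    ∀ (B : SuperWeil) (x : Ix n m → B), (∀ k, x k ∈ B.gr (Parity.par k)) →
      (∀ a, B.aug (x (.even a)) = chart i b a) →
      ∀ k, evalAt (trans i i k) 0 x 0 = x k
  trans_cocycle : ∀ (i j l : ι) (b : carrier), b ∈ (chart i).source → b ∈ (chart j).source →
    b ∈ (chart l).source →
    ∀ (B : SuperWeil) (x : Ix n m → B), (∀ k, x k ∈ B.gr (Parity.par k)) →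
      (∀ a, B.aug (x (.even a)) = chart i b a) →
      ∀ k, evalAt (trans j l k) 0 (fun k' => evalAt (trans i j k') 0 x 0) 0 =
        evalAt (trans i l k) 0 x 0

attribute [instance] SuperManifold.top SuperManifold.t2 SuperManifold.sc

section Manifolds

variable {n m : ℕ}

/-- `x` are the coordinates in chart `i` of a `B`-point with underlying point `b`. -/
def SuperManifold.IsPoint (M : SuperManifold.{u} n m) (B : SuperWeil) (i : M.ι) (b : M.carrier)
    (x : Ix n m → B) : Prop :=
  b ∈ (M.chart i).source ∧ (∀ k, x k ∈ B.gr (Parity.par k)) ∧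
    ∀ a, B.aug (x (.even a)) = M.chart i b a

/-- Coordinate change on `B`-points. -/
def SuperManifold.tr (M : SuperManifold.{u} n m) {B : SuperWeil} (i j : M.ι) (x : Ix n m → B) :
    Ix n m → B := fun k => evalAt (M.trans i j k) 0 x 0

/-- A `B`-point of the cotangent bundle: coordinates and momenta in all charts around the
underlying point, subject to `p_a = (∂x^{a'}/∂x^a) p_{a'}`. -/
structure CotangentPoint (M : SuperManifold.{u} n m) (B : SuperWeil) where
  base : M.carrier
  coord : ∀ i, base ∈ (M.chart i).source → Ix n m → B
  mom : ∀ i, base ∈ (M.chart i).source → Ix n m → B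
  isPoint : ∀ i h, M.IsPoint B i base (coord i h)
  mom_par : ∀ i h k, mom i h k ∈ B.gr (Parity.par k)
  coord_compat : ∀ i j hi hj, coord j hj = M.tr i j (coord i hi)
  mom_compat : ∀ i j hi hj k, mom i hi k =
    ∑ k', evalAt (dCoord k (M.trans i j k')) 0 (coord i hi) 0 * mom j hj k'

end Manifolds

/-! ## Thick morphisms -/

section Thick

variable {n₁ m₁ n₂ m₂ n₃ m₃ : ℕ}

/-- A thick morphism `M₁ ⇛ M₂`, depending on formal parameters indexed by `P`: a map of the
underlying spaces and generating functions `S(x, q)`, formal power series in the momenta `q` of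
`M₂`, in all pairs of charts, related by the transformation law of generating functions. -/
structure ThickMorphism (P : Type) [Fintype P] [LinearOrder P] [Parity P]
    (M₁ : SuperManifold.{u} n₁ m₁) (M₂ : SuperManifold.{u} n₂ m₂) where
  base : M₁.carrier → M₂.carrier
  base_continuous : Continuous base
  gen : M₁.ι → M₂.ι → Coef n₁ P m₁ (Ix n₂ m₂)
  gen_smooth : ∀ i j, IsSmoothOn
    {x | x ∈ (M₁.chart i).target ∧ base ((M₁.chart i).symm x) ∈ (M₂.chart j).source} (gen i j)
  gen_even : ∀ i j, IsHomog 0 (gen i j)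
  /-- the linear term `φ^i(x) q_i` of `S` is a deformation of the underlying map -/
  gen_base : ∀ i j b, b ∈ (M₁.chart i).source → base b ∈ (M₂.chart j).source → ∀ a,
    gen i j (Pi.single (Sum.inrₗ (Sum.inrₗ (Ix.even a))) 1) (M₁.chart i b) = M₂.chart j (base b) a
  /-- `S'(x', q') = S(x, q) - y^i q_i + y^{i'} q_{i'}`, where `q_i = (∂y^{i'}/∂y^i)(y) q_{i'}` and
  `y^i = (-1)^ĩ (∂S/∂q_i)(x, q)` -/
  gen_law : ∀ (i i' : M₁.ι) (j j' : M₂.ι) (b : M₁.carrier) (B : SuperWeil) (c : P → B)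
    (x' : Ix n₁ m₁ → B) (y q q' : Ix n₂ m₂ → B),
    b ∈ (M₁.chart i).source → M₁.IsPoint B i' b x' →
    M₂.IsPoint B j (base b) y → base b ∈ (M₂.chart j').source →
    B.IsFormal c → B.IsFormal q → B.IsFormal q' →
    (∀ k, q k = ∑ k', evalAt (dCoord k (M₂.trans j j' k')) 0 y 0 * q' k') →
    (∀ k, y k = sgn B k * evalAt (dMom k (gen i j)) c (M₁.tr i' i x') q) →
    evalAt (gen i' j') c x' q' = evalAt (gen i j) c (M₁.tr i' i x') q
      - ∑ k, y k * q k + ∑ k', M₂.tr j j' y k' * q' k'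

variable {P : Type} [Fintype P] [LinearOrder P] [Parity P]
variable {M₁ : SuperManifold.{u} n₁ m₁} {M₂ : SuperManifold.{u} n₂ m₂}
  {M₃ : SuperManifold.{u} n₃ m₃}

/-- `S₀(x) = S(x, 0)` lies in the ideal generated by the parameters. -/
def ThickMorphism.IsFormal (Φ : ThickMorphism P M₁ M₂) : Prop :=
  ∀ i j α, (∀ s, α (Sum.inlₗ s) = 0) → (∀ k, α (Sum.inrₗ (Sum.inrₗ k)) = 0) → Φ.gen i j α = 0

/-- The formal canonical relation defined by `Φ`, on `B`-points `u` of `T*M₁` and `v` of `T*M₂`: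
`v` is in the formal neighbourhood of the zero section, `y^i = (-1)^ĩ ∂S/∂q_i (x, q)` and
`p_a = ∂S/∂x^a (x, q)`. -/
def ThickMorphism.Rel (Φ : ThickMorphism P M₁ M₂) {B : SuperWeil} (c : P → B)
    (u : CotangentPoint M₁ B) (v : CotangentPoint M₂ B) : Prop :=
  v.base = Φ.base u.base ∧
  (∀ j hj k, B.aug (v.mom j hj k) = 0) ∧
  ∀ i hi j hj,
    (∀ k, v.coord j hj k = sgn B k * evalAt (dMom k (Φ.gen i j)) c (u.coord i hi) (v.mom j hj)) ∧
    ∀ k, u.mom i hi k = evalAt (dCoord k (Φ.gen i j)) c (u.coord i hi) (v.mom j hj)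

/-- The pair `(y, q)` solves `q_i = ∂S₃₂/∂y^i (y, r)`, `y^i = (-1)^ĩ ∂S₂₁/∂q_i (x, q)` in the charts
`i`, `j`, `l`; here `b` is the underlying point of `x`. -/
def Solves (Φ₃₂ : ThickMorphism P M₂ M₃) (Φ₂₁ : ThickMorphism P M₁ M₂) {B : SuperWeil} (c : P → B)
    (i : M₁.ι) (j : M₂.ι) (l : M₃.ι) (b : M₁.carrier) (x : Ix n₁ m₁ → B) (r : Ix n₃ m₃ → B)
    (y q : Ix n₂ m₂ → B) : Prop :=
  M₂.IsPoint B j (Φ₂₁.base b) y ∧ B.IsFormal q ∧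
  (∀ k, q k = evalAt (dCoord k (Φ₃₂.gen j l)) c y r) ∧
  ∀ k, y k = sgn B k * evalAt (dMom k (Φ₂₁.gen i j)) c x q

/-- `(i, j, l, b, c, x, r)` are data at which the system for the composition can be considered. -/
def Admissible (Φ₃₂ : ThickMorphism P M₂ M₃) (Φ₂₁ : ThickMorphism P M₁ M₂) {B : SuperWeil}
    (c : P → B) (i : M₁.ι) (j : M₂.ι) (l : M₃.ι) (b : M₁.carrier) (x : Ix n₁ m₁ → B)
    (r : Ix n₃ m₃ → B) : Prop :=
  B.IsFormal c ∧ M₁.IsPoint B i b x ∧ Φ₂₁.base b ∈ (M₂.chart j).source ∧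
    Φ₃₂.base (Φ₂₁.base b) ∈ (M₃.chart l).source ∧ B.IsFormal r

/-- `Y(x, r)` and `Q(x, r)` are formal power series in `r` (and in the parameters and odd
coordinates) solving the system for the composition. -/
def IsSeriesSolution (Φ₃₂ : ThickMorphism P M₂ M₃) (Φ₂₁ : ThickMorphism P M₁ M₂)
    (i : M₁.ι) (j : M₂.ι) (l : M₃.ι) (Y Q : Ix n₂ m₂ → Coef n₁ P m₁ (Ix n₃ m₃)) : Prop :=
  (∀ k, IsSmoothOn {x | x ∈ (M₁.chart i).target ∧
      Φ₂₁.base ((M₁.chart i).symm x) ∈ (M₂.chart j).source ∧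
      Φ₃₂.base (Φ₂₁.base ((M₁.chart i).symm x)) ∈ (M₃.chart l).source} (Y k)) ∧
  (∀ k, IsSmoothOn {x | x ∈ (M₁.chart i).target ∧
      Φ₂₁.base ((M₁.chart i).symm x) ∈ (M₂.chart j).source ∧
      Φ₃₂.base (Φ₂₁.base ((M₁.chart i).symm x)) ∈ (M₃.chart l).source} (Q k)) ∧
  ∀ (B : SuperWeil) (c : P → B) (b : M₁.carrier) (x : Ix n₁ m₁ → B) (r : Ix n₃ m₃ → B),
    Admissible Φ₃₂ Φ₂₁ c i j l b x r →
    Solves Φ₃₂ Φ₂₁ c i j l b x r (fun k => evalAt (Y k) c x r) (fun k => evalAt (Q k) c x r)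

/-- `Φ₃₁` has the generating function `S₃₁(x, r) = S₃₂(y, r) + S₂₁(x, q) - y^i q_i`. -/
def HasCompositeGen (Φ₃₂ : ThickMorphism P M₂ M₃) (Φ₂₁ : ThickMorphism P M₁ M₂)
    (Φ₃₁ : ThickMorphism P M₁ M₃) : Prop :=
  Φ₃₁.base = Φ₃₂.base ∘ Φ₂₁.base ∧
  ∀ (B : SuperWeil) (c : P → B) (i : M₁.ι) (j : M₂.ι) (l : M₃.ι) (b : M₁.carrier)
    (x : Ix n₁ m₁ → B) (r : Ix n₃ m₃ → B) (y q : Ix n₂ m₂ → B),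
    Admissible Φ₃₂ Φ₂₁ c i j l b x r → Solves Φ₃₂ Φ₂₁ c i j l b x r y q →
    evalAt (Φ₃₁.gen i l) c x r =
      evalAt (Φ₃₂.gen j l) c y r + evalAt (Φ₂₁.gen i j) c x q - ∑ k, y k * q k

/-- `Φ₃₁` is, as a formal canonical relation, the set-theoretic composition of `Φ₂₁` and `Φ₃₂`. -/
def IsRelComposite (Φ₃₂ : ThickMorphism P M₂ M₃) (Φ₂₁ : ThickMorphism P M₁ M₂)
    (Φ₃₁ : ThickMorphism P M₁ M₃) : Prop :=
  ∀ (B : SuperWeil) (c : P → B), B.IsFormal c →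
    ∀ (u : CotangentPoint M₁ B) (w : CotangentPoint M₃ B),
      Φ₃₁.Rel c u w ↔ ∃ v : CotangentPoint M₂ B, Φ₂₁.Rel c u v ∧ Φ₃₂.Rel c v w

/-- The composition law: composition of relations, with the generating function `S₃₁`. -/
def IsComposite (Φ₃₂ : ThickMorphism P M₂ M₃) (Φ₂₁ : ThickMorphism P M₁ M₂)
    (Φ₃₁ : ThickMorphism P M₁ M₃) : Prop :=
  IsRelComposite Φ₃₂ Φ₂₁ Φ₃₁ ∧ HasCompositeGen Φ₃₂ Φ₂₁ Φ₃₁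

/-- The first-order part of the composition: modulo products of two elements among parameters and
momenta, `S₃₁(x, r) = f₁(x) + f₂(φ₂₁(x)) + φ₃₂(φ₂₁(x)) r`, where `f₁ = S₂₁(x, 0)`,
`f₂ = S₃₂(y, 0)`, and `φ₂₁`, `φ₃₂` are given by the terms linear in the momenta. -/
def HasFirstOrderPart (Φ₃₂ : ThickMorphism P M₂ M₃) (Φ₂₁ : ThickMorphism P M₁ M₂)
    (Φ₃₁ : ThickMorphism P M₁ M₃) : Prop :=
  ∀ (B : SuperWeil) (c : P → B) (i : M₁.ι) (j : M₂.ι) (l : M₃.ι) (b : M₁.carrier)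
    (x : Ix n₁ m₁ → B) (r : Ix n₃ m₃ → B) (y : Ix n₂ m₂ → B) (z : Ix n₃ m₃ → B),
    Admissible Φ₃₂ Φ₂₁ c i j l b x r →
    (∀ s t, c s * c t = 0) → (∀ s k, c s * r k = 0) → (∀ k k', r k * r k' = 0) →
    (∀ k, y k = sgn B k * evalAt (dMom k (Φ₂₁.gen i j)) c x 0) →
    (∀ k, z k = sgn B k * evalAt (dMom k (Φ₃₂.gen j l)) c y 0) →
    evalAt (Φ₃₁.gen i l) c x r =
      evalAt (Φ₂₁.gen i j) c x 0 + evalAt (Φ₃₂.gen j l) c y 0 + ∑ k, z k * r k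

/-- `I` is the identity thick morphism, with generating function `x^a q_a`. -/
def IsIdentity (I : ThickMorphism P M₁ M₁) : Prop :=
  I.base = id ∧
  ∀ (B : SuperWeil) (c : P → B) (i : M₁.ι) (b : M₁.carrier) (x q : Ix n₁ m₁ → B),
    B.IsFormal c → M₁.IsPoint B i b x → B.IsFormal q →
    evalAt (I.gen i i) c x q = ∑ k, x k * q k

/-- `Φ'` is the parameter-free thick morphism `Φ`, regarded as one with parameters. -/
def IsConstantExtension (Φ : ThickMorphism (Ix 0 0) M₁ M₂) (Φ' : ThickMorphism P M₁ M₂) : Prop :=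
  Φ'.base = Φ.base ∧
  ∀ (B : SuperWeil) (c : P → B) (i : M₁.ι) (j : M₂.ι) (b : M₁.carrier) (x : Ix n₁ m₁ → B)
    (q : Ix n₂ m₂ → B),
    B.IsFormal c → M₁.IsPoint B i b x → Φ.base b ∈ (M₂.chart j).source → B.IsFormal q →
    evalAt (Φ'.gen i j) c x q = evalAt (Φ.gen i j) 0 x q

/-- `Φ'` is obtained from `Φ` by replacing the term `S₀(x)` by `ε S₀(x)`. -/
def IsScaling (ε : P) (Φ Φ' : ThickMorphism P M₁ M₂) : Prop :=
  Φ'.base = Φ.base ∧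
  ∀ (B : SuperWeil) (c : P → B) (i : M₁.ι) (j : M₂.ι) (b : M₁.carrier) (x : Ix n₁ m₁ → B)
    (q : Ix n₂ m₂ → B),
    B.IsFormal c → M₁.IsPoint B i b x → Φ.base b ∈ (M₂.chart j).source → B.IsFormal q →
    evalAt (Φ'.gen i j) c x q =
      evalAt (Φ.gen i j) c x q - evalAt (Φ.gen i j) c x 0 + c ε * evalAt (Φ.gen i j) c x 0

end Thick

/-! ## Functions and pullbacks -/

/-- An even function on `M` depending on parameters. -/
structure EvenFunction (P : Type) [Fintype P] [LinearOrder P] [Parity P] {n m : ℕ}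
    (M : SuperManifold.{u} n m) where
  val : M.ι → Coef n P m (Ix 0 0)
  smooth : ∀ i, IsSmoothOn (M.chart i).target (val i)
  even : ∀ i, IsHomog 0 (val i)
  compat : ∀ (i j : M.ι) (b : M.carrier) (B : SuperWeil) (c : P → B) (x : Ix n m → B),
    B.IsFormal c → M.IsPoint B i b x → b ∈ (M.chart j).source →
    evalAt (val j) c (M.tr i j x) 0 = evalAt (val i) c x 0

section Pullback

variable {n₁ m₁ n₂ m₂ : ℕ} {P : Type} [Fintype P] [LinearOrder P] [Parity P]
  {M₁ : SuperManifold.{u} n₁ m₁} {M₂ : SuperManifold.{u} n₂ m₂}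

/-- `g` lies in the ideal generated by the parameters. -/
def EvenFunction.IsFormal (g : EvenFunction P M₁) : Prop :=
  ∀ i α, (∀ s, α (Sum.inlₗ s) = 0) → g.val i α = 0

/-- `h = ε g`, for a function `g` without parameters. -/
def EvenFunction.IsMultiple (ε : P) (g : EvenFunction (Ix 0 0) M₁) (h : EvenFunction P M₁) : Prop :=
  ∀ (B : SuperWeil) (c : P → B) (i : M₁.ι) (b : M₁.carrier) (x : Ix n₁ m₁ → B),
    B.IsFormal c → M₁.IsPoint B i b x → evalAt (h.val i) c x 0 = c ε * evalAt (g.val i) 0 x 0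

/-- The pair `(y, q)` solves `q_i = ∂g/∂y^i (y)`, `y^i = (-1)^ĩ ∂S/∂q_i (x, q)`. -/
def PullbackSolves (Φ : ThickMorphism P M₁ M₂) (g : EvenFunction P M₂) {B : SuperWeil} (c : P → B)
    (i : M₁.ι) (j : M₂.ι) (b : M₁.carrier) (x : Ix n₁ m₁ → B) (y q : Ix n₂ m₂ → B) : Prop :=
  M₂.IsPoint B j (Φ.base b) y ∧ B.IsFormal q ∧
  (∀ k, q k = evalAt (dCoord k (g.val j)) c y 0) ∧
  ∀ k, y k = sgn B k * evalAt (dMom k (Φ.gen i j)) c x q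

/-- `f = Φ^*[g]`: the system for `(y, q)` has a unique solution at every point, and
`f(x) = g(y) + S(x, q) - y^i q_i`. -/
def IsPullback (Φ : ThickMorphism P M₁ M₂) (g : EvenFunction P M₂) (f : EvenFunction P M₁) : Prop :=
  ∀ (B : SuperWeil) (c : P → B) (i : M₁.ι) (j : M₂.ι) (b : M₁.carrier) (x : Ix n₁ m₁ → B),
    B.IsFormal c → M₁.IsPoint B i b x → Φ.base b ∈ (M₂.chart j).source →
    (∃! yq : (Ix n₂ m₂ → B) × (Ix n₂ m₂ → B), PullbackSolves Φ g c i j b x yq.1 yq.2) ∧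
    ∀ y q, PullbackSolves Φ g c i j b x y q →
      evalAt (f.val i) c x 0 =
        evalAt (g.val j) c y 0 + evalAt (Φ.gen i j) c x q - ∑ k, y k * q k

end Pullback

end

end Microformal

open Microformal

set_option linter.unusedSectionVars false

namespace Microformal

noncomputable section

open Filter Topology Asymptotics

/-! ## Elementary properties of super Weil algebras -/

/-! A superfunction, that is, a power series in parameters, odd coordinates and momenta with smooth
coefficients, is handled here through its values at points in super Weil algebras. Two facts make
this sufficient. Values determine coefficients (`coef_ext`): over the dual numbers B[ε], with ε even
or odd, the values of F contain those of its left derivatives, and an induction on the degree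
reaches every coefficient. Conversely (`exists_superfunction`), a function of points that, on
algebras of each bounded order, is a polynomial in the formal variables with smooth coefficients
comes from a superfunction. Most constructions are therefore carried out pointwise.

The system for (y, q) is a fixed-point problem for q once y is eliminated. Formality of S₃₂ makes it
a contraction: every monomial of ∂S₃₂/∂y contains a parameter or a momentum r, whose value is
nilpotent, so changing q by an element of the k-th power of the augmentation ideal changes the next
approximation by an element of the (k+1)-st power. Iteration from q = 0 is stationary after
`B.order` steps and the solution is unique (`LocalPair.qIter_sub_mem`, `LSol.sub_mem`). The number
of steps is uniform on algebras of bounded order, so the solution and S₃₁ are given by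
superfunctions (`LocalPair.exists_series`, `LocalPair.exists_gen`).

S₃₁ is the critical value of S₃₂(y, r) + S₂₁(x, q) - y^i q_i in the variables (y, q). The implicit
variation of y and q therefore does not contribute to first order (`LocalPair.stationary`), whence
∂S₃₁/∂r = ∂S₃₂/∂r and ∂S₃₁/∂x = ∂S₂₁/∂x at the solution (`LocalPair.envelope`). These two identities
yield the underlying map and the transformation law of the composite as well as the composition of
canonical relations (`isRelComposite_of_gen`). A change of coordinates on the target of a thick
morphism is itself a local composition, with the generating function x^{k'}(x) q_{k'}, so the same
identities control derivatives in different charts (`ThickMorphism.gen_mtr`). It follows that the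
local composites do not depend on the chart of the middle manifold, and they glue
(`exists_compGen`).

The rest is formal. Both bracketings of a triple composition evaluate S₄₃ + S₃₂ + S₂₁ - zr - yq at a
solution of one joint system (`hasCompositeGen_assoc`). Composition with an identity reduces to the
transformation law. An even function is a thick morphism to a point, its pullback is a composition,
and contravariance is an instance of associativity (`isPullback_comp`). -/

theorem SuperWeil.aug_odd (B : SuperWeil) {b : B} (hb : b ∈ B.gr 1) : B.aug b = 0 := by
  have h := B.supercomm 1 1 b b hb hb
  have h2 : ((1 : ZMod 2).val * (1 : ZMod 2).val) = 1 := by decide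
  rw [h2, pow_one, neg_one_mul] at h
  have h3 := congrArg B.aug h
  rw [map_neg, map_mul] at h3
  have : B.aug b * B.aug b = 0 := by linarith
  exact mul_self_eq_zero.1 this

theorem SuperWeil.odd_sq (B : SuperWeil) {b : B} (hb : b ∈ B.gr 1) : b * b = 0 := by
  have h := B.supercomm 1 1 b b hb hb
  have h2 : ((1 : ZMod 2).val * (1 : ZMod 2).val) = 1 := by decide
  rw [h2, pow_one, neg_one_mul] at h
  have h3 : (2 : ℝ) • (b * b) = 0 := by
    rw [two_smul]
    nth_rewrite 1 [h]
    exact neg_add_cancel _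
  exact (smul_eq_zero.1 h3).resolve_left two_ne_zero

theorem SuperWeil.one_le_order (B : SuperWeil) : 1 ≤ B.order := by
  by_contra h
  have h0 : B.order = 0 := by omega
  have h1 : ([] : List B).prod = 0 := B.nilp [] (by simp [h0]) (by simp)
  have h2 := congrArg B.aug h1
  simp at h2

theorem zmod_two_cases (i : ZMod 2) : i = 0 ∨ i = 1 := by
  revert i; decide

theorem SuperWeil.mem_decomp (B : SuperWeil) (b : B) :
    ∃ b0 ∈ B.gr 0, ∃ b1 ∈ B.gr 1, b = b0 + b1 := by
  refine ⟨_, SetLike.coe_mem (DirectSum.decompose B.gr b 0), _,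
    SetLike.coe_mem (DirectSum.decompose B.gr b 1), ?_⟩
  classical
  have h := DirectSum.sum_support_decompose B.gr b
  conv_lhs => rw [← h]
  rw [Finset.sum_subset (Finset.subset_univ _)]
  · exact Fin.sum_univ_two (fun i : Fin 2 => ((DirectSum.decompose B.gr b (i : ZMod 2)) : B))
  · intro i _ hi
    simpa using hi

theorem SuperWeil.even_comm (B : SuperWeil) {a : B} (ha : a ∈ B.gr 0) (b : B) :
    a * b = b * a := by
  obtain ⟨b0, h0, b1, h1, rfl⟩ := B.mem_decomp b
  have e0 := B.supercomm 0 0 a b0 ha h0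
  have e1 := B.supercomm 0 1 a b1 ha h1
  simp only [ZMod.val_zero, zero_mul, pow_zero, one_mul] at e0 e1
  rw [mul_add, add_mul, e0, e1]

theorem SuperWeil.even_mem_center (B : SuperWeil) {a : B} (ha : a ∈ B.gr 0) :
    a ∈ Subalgebra.center ℝ (B : Type) :=
  Subalgebra.mem_center_iff.2 fun b => (B.even_comm ha b).symm

theorem SuperWeil.algebraMap_mem (B : SuperWeil) (r : ℝ) : algebraMap ℝ B r ∈ B.gr 0 :=
  SetLike.algebraMap_mem_graded _ _

theorem SuperWeil.mul_mem (B : SuperWeil) {i j : ZMod 2} {a b : B} (ha : a ∈ B.gr i)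
    (hb : b ∈ B.gr j) : a * b ∈ B.gr (i + j) :=
  SetLike.GradedMul.mul_mem ha hb

theorem SuperWeil.mul_mem_even (B : SuperWeil) {j : ZMod 2} {a b : B} (ha : a ∈ B.gr 0)
    (hb : b ∈ B.gr j) : a * b ∈ B.gr j := by
  simpa using B.mul_mem ha hb

theorem SuperWeil.one_mem (B : SuperWeil) : (1 : B) ∈ B.gr 0 :=
  SetLike.GradedOne.one_mem

/-! ## Taylor polynomials -/

/-- The Taylor polynomial of degree `< N` of `f` at `x₀`, as a polynomial in the increment. -/
def taylorPoly {n : ℕ} (N : ℕ) (f : (Fin n → ℝ) → ℝ) (x₀ : Fin n → ℝ) :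
    MvPolynomial (Fin n) ℝ :=
  ∑ k ∈ Finset.range N, ∑ t : Fin k → Fin n,
    MvPolynomial.C ((k.factorial : ℝ)⁻¹ *
      iteratedFDeriv ℝ k f x₀ (fun j => Pi.single (t j) 1)) * ∏ j, MvPolynomial.X (t j)

theorem eval_taylorPoly {n : ℕ} (N : ℕ) (f : (Fin n → ℝ) → ℝ) (x₀ y : Fin n → ℝ) :
    MvPolynomial.eval y (taylorPoly N f x₀) =
      ∑ k ∈ Finset.range N, (k.factorial : ℝ)⁻¹ • iteratedFDeriv ℝ k f x₀ (fun _ => y) := by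
  simp only [taylorPoly, map_sum, map_mul, MvPolynomial.eval_C, map_prod, MvPolynomial.eval_X]
  refine Finset.sum_congr rfl fun k _ => ?_
  have hy : (fun _ : Fin k => y) =
      fun _ : Fin k => ∑ i, y i • (Pi.single i (1 : ℝ) : Fin n → ℝ) := by
    funext _
    ext i
    simp [Finset.sum_apply, Pi.single_apply]
  rw [hy]
  have := (iteratedFDeriv ℝ k f x₀).toMultilinearMap.map_sum
    (fun (_ : Fin k) (i : Fin n) => y i • (Pi.single i (1 : ℝ) : Fin n → ℝ))
  simp only [ContinuousMultilinearMap.coe_coe] at this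
  rw [this, smul_eq_mul, Finset.mul_sum]
  refine Finset.sum_congr rfl fun t _ => ?_
  rw [ContinuousMultilinearMap.map_smul_univ, smul_eq_mul]
  ring

/-- Taylor's theorem, locally uniformly in the base point. -/
theorem taylor_isBigO {n : ℕ} {f : (Fin n → ℝ) → ℝ} {x₀ : Fin n → ℝ} (hf : ContDiffAt ℝ ∞ f x₀)
    (N : ℕ) :
    (fun z : (Fin n → ℝ) × (Fin n → ℝ) => f (z.1 + z.2) -
      ∑ k ∈ Finset.range (N + 1), (k.factorial : ℝ)⁻¹ • iteratedFDeriv ℝ k f z.1 (fun _ => z.2))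
      =O[𝓝 (x₀, 0)] fun z => ‖z.2‖ ^ (N + 1) := by
  have h1 : ContDiffAt ℝ ((N : ℕ∞) + 1 : ℕ∞) f x₀ := hf.of_le (by exact_mod_cast le_top)
  have h2 := h1.eventually (by exact_mod_cast ENat.natCast_ne_top (N + 1))
  have h3 : ContinuousAt (iteratedFDeriv ℝ (N + 1) f) x₀ :=
    (h1.iteratedFDeriv_right (i := N + 1) (m := 0) (by simp)).continuousAt
  have h4 : ∀ᶠ x in 𝓝 x₀, ‖iteratedFDeriv ℝ (N + 1) f x‖ < ‖iteratedFDeriv ℝ (N + 1) f x₀‖ + 1 :=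
    h3.norm.eventually_lt continuousAt_const (by simp)
  obtain ⟨δ, hδ, hball⟩ := Metric.eventually_nhds_iff.1 (h2.and h4)
  refine IsBigO.of_bound
    ((N.factorial : ℝ)⁻¹ * (‖iteratedFDeriv ℝ (N + 1) f x₀‖ + 1)) ?_
  have h5 : ∀ᶠ z : (Fin n → ℝ) × (Fin n → ℝ) in 𝓝 (x₀, 0),
      dist z.1 x₀ < δ / 2 ∧ ‖z.2‖ < δ / 2 := by
    refine Filter.Eventually.and ?_ ?_
    · have : Tendsto (fun z : (Fin n → ℝ) × (Fin n → ℝ) => dist z.1 x₀) (𝓝 (x₀, 0))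
          (𝓝 (dist x₀ x₀)) := by
        apply ContinuousAt.tendsto (f := fun z : (Fin n → ℝ) × (Fin n → ℝ) => dist z.1 x₀)
        fun_prop
      rw [dist_self] at this
      exact this.eventually_lt_const (by positivity)
    · have : Tendsto (fun z : (Fin n → ℝ) × (Fin n → ℝ) => ‖z.2‖) (𝓝 (x₀, 0))
          (𝓝 ‖(0 : Fin n → ℝ)‖) := by
        apply ContinuousAt.tendsto (f := fun z : (Fin n → ℝ) × (Fin n → ℝ) => ‖z.2‖)
        fun_prop
      rw [norm_zero] at this
      exact this.eventually_lt_const (by positivity)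
  filter_upwards [h5] with z hz
  have hin : ∀ t : ℝ, t ∈ Set.Icc (0 : ℝ) 1 → dist (z.1 + t • z.2) x₀ < δ := by
    intro t ht
    calc dist (z.1 + t • z.2) x₀ ≤ dist (z.1 + t • z.2) z.1 + dist z.1 x₀ := dist_triangle _ _ _
      _ < δ / 2 + δ / 2 := by
        refine add_lt_add ?_ hz.1
        rw [dist_eq_norm, add_sub_cancel_left, norm_smul, Real.norm_of_nonneg ht.1]
        calc t * ‖z.2‖ ≤ 1 * ‖z.2‖ := by gcongr; exact ht.2
          _ < δ / 2 := by rw [one_mul]; exact hz.2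
      _ = δ := by ring
  -- The integral form of the remainder, combined with a bound on the (N+1)-st derivative on one
  -- ball around `x₀` that contains all the segments, gives a constant independent of the base
  -- point.
  rw [map_add_eq_sum_add_integral_iteratedFDeriv (f := f) (x := z.1) (y := z.2) (n := N)
    (fun t ht => by simpa using (hball (hin t ht)).1), add_sub_cancel_left, norm_smul, mul_assoc]
  have hN : ‖(N.factorial : ℝ)⁻¹‖ = (N.factorial : ℝ)⁻¹ := Real.norm_of_nonneg (by positivity)
  rw [hN]
  gcongr
  rw [norm_pow, norm_norm]
  have key := intervalIntegral.norm_integral_le_of_norm_le_const (a := (0 : ℝ)) (b := 1)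
    (f := fun t : ℝ => (1 - t) ^ N • iteratedFDeriv ℝ (N + 1) f (z.1 + t • z.2) (fun _ => z.2))
    (C := (‖iteratedFDeriv ℝ (N + 1) f x₀‖ + 1) * ‖z.2‖ ^ (N + 1)) ?_
  · simpa using key
  · intro t ht
    rw [Set.uIoc_of_le zero_le_one] at ht
    have ht' : t ∈ Set.Icc (0 : ℝ) 1 := ⟨ht.1.le, ht.2⟩
    rw [norm_smul, norm_pow]
    have e1 : ‖1 - t‖ ^ N ≤ 1 := by
      apply pow_le_one₀ (norm_nonneg _)
      rw [Real.norm_of_nonneg (by linarith [ht.2])]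
      linarith [ht.1]
    have e2 : ‖iteratedFDeriv ℝ (N + 1) f (z.1 + t • z.2) (fun _ => z.2)‖ ≤
        (‖iteratedFDeriv ℝ (N + 1) f x₀‖ + 1) * ‖z.2‖ ^ (N + 1) := by
      refine (ContinuousMultilinearMap.le_opNorm _ _).trans ?_
      rw [Finset.prod_const, Finset.card_univ, Fintype.card_fin]
      gcongr
      exact (hball (hin t ht')).2.le
    calc _ ≤ 1 * ((‖iteratedFDeriv ℝ (N + 1) f x₀‖ + 1) * ‖z.2‖ ^ (N + 1)) := by gcongr
      _ = _ := one_mul _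

/-- A univariate polynomial that is `O(s^N)` at the origin is divisible by `X^N`. -/
theorem X_pow_dvd_of_isBigO {q : Polynomial ℝ} {N : ℕ}
    (h : (fun s : ℝ => q.eval s) =O[𝓝 0] fun s => s ^ N) : Polynomial.X ^ N ∣ q := by
  by_cases hq : q = 0
  · simp [hq]
  obtain ⟨r, hr, hr0⟩ := Polynomial.exists_eq_pow_rootMultiplicity_mul_and_not_dvd q hq 0
  set m := q.rootMultiplicity 0
  rw [Polynomial.C_0, sub_zero] at hr hr0
  by_cases hm : N ≤ m
  · rw [hr]
    exact (pow_dvd_pow _ hm).mul_right _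
  exfalso
  push Not at hm
  -- If the multiplicity m of the root 0 were below N, the cofactor r would be O(s^(N - m)) off 0.
  -- It would then vanish at 0, against maximality of m.
  have h1 : (fun s : ℝ => r.eval s) =O[𝓝[≠] 0] fun s => s ^ (N - m) := by
    obtain ⟨C, hC⟩ := h.bound
    refine IsBigO.of_bound C ?_
    filter_upwards [hC.filter_mono nhdsWithin_le_nhds, self_mem_nhdsWithin] with s hs hs0
    have hs0' : 0 < ‖s‖ := norm_pos_iff.2 hs0
    rw [hr] at hs
    simp only [Polynomial.eval_mul, Polynomial.eval_pow, Polynomial.eval_X, norm_mul,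
      norm_pow] at hs
    have e : ‖s‖ ^ N = ‖s‖ ^ m * ‖s‖ ^ (N - m) := by rw [← pow_add]; congr 1; omega
    rw [e] at hs
    rw [norm_pow]
    have : ‖s‖ ^ m * ‖r.eval s‖ ≤ ‖s‖ ^ m * (C * ‖s‖ ^ (N - m)) := by linarith
    exact le_of_mul_le_mul_left this (by positivity)
  have h2 : Tendsto (fun s : ℝ => r.eval s) (𝓝[≠] 0) (𝓝 0) := by
    refine h1.trans_tendsto ?_
    have : Tendsto (fun s : ℝ => s ^ (N - m)) (𝓝 0) (𝓝 (0 ^ (N - m))) :=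
      (continuous_pow _).tendsto 0
    rw [zero_pow (by omega)] at this
    exact this.mono_left nhdsWithin_le_nhds
  have h3 : Tendsto (fun s : ℝ => r.eval s) (𝓝[≠] 0) (𝓝 (r.eval 0)) :=
    (r.continuous.tendsto 0).mono_left nhdsWithin_le_nhds
  have h4 := tendsto_nhds_unique h3 h2
  exact hr0 (Polynomial.X_dvd_iff.2 (by rw [Polynomial.coeff_zero_eq_eval_zero, h4]))

open MvPolynomial in
/-- A polynomial that is `O(‖y‖^N)` at the origin vanishes at nilpotent points. -/
theorem aeval_eq_zero_of_isBigO {ι A : Type} [Fintype ι] [CommRing A] [Algebra ℝ A] {N : ℕ}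
    (p : MvPolynomial ι ℝ)
    (hp : (fun y : ι → ℝ => eval y p) =O[𝓝 0] fun y => ‖y‖ ^ N) (ν : ι → A)
    (hν : ∀ l : List ι, N ≤ l.length → (l.map ν).prod = 0) : aeval ν p = 0 := by
  have hcomp : ∀ k < N, homogeneousComponent k p = 0 := by
    intro k hk
    apply MvPolynomial.funext
    intro y
    rw [map_zero]
    -- The restriction of p to the line through y: its coefficients are the homogeneous components
    -- of p at y, so those of index below N vanish.
    let q : Polynomial ℝ := ∑ i ∈ Finset.range (p.totalDegree + 1),
      Polynomial.C (eval y (homogeneousComponent i p)) * Polynomial.X ^ i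
    have hq : ∀ s : ℝ, q.eval s = eval (s • y) p := by
      intro s
      conv_rhs => rw [← sum_homogeneousComponent p]
      rw [map_sum]
      simp only [q, Polynomial.eval_finsetSum, Polynomial.eval_mul, Polynomial.eval_C,
        Polynomial.eval_pow, Polynomial.eval_X]
      refine Finset.sum_congr rfl fun i _ => ?_
      rw [eval_eq, eval_eq, Finset.sum_mul]
      refine Finset.sum_congr rfl fun d hd => ?_
      have hdi := (homogeneousComponent_isHomogeneous i p).degree_eq_sum_deg_support hd
      simp only [Pi.smul_apply, smul_eq_mul, mul_pow, Finset.prod_mul_distrib]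
      rw [Finset.prod_pow_eq_pow_sum, ← hdi]
      ring
    have hO : (fun s : ℝ => q.eval s) =O[𝓝 0] fun s => s ^ N := by
      have ht : Tendsto (fun s : ℝ => s • y) (𝓝 0) (𝓝 0) := by
        have : Tendsto (fun s : ℝ => s • y) (𝓝 0) (𝓝 ((0 : ℝ) • y)) := by
          apply Continuous.tendsto; fun_prop
        simpa using this
      have := hp.comp_tendsto ht
      refine (IsBigO.congr_left this fun s => (hq s).symm).trans ?_
      refine IsBigO.of_bound (‖y‖ ^ N) (Eventually.of_forall fun s => ?_)
      simp only [Function.comp, norm_smul, norm_pow, norm_norm, norm_mul]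
      rw [mul_pow, mul_comm]
    have hd := Polynomial.X_pow_dvd_iff.1 (X_pow_dvd_of_isBigO hO) k hk
    simp only [q, Polynomial.finsetSum_coeff, Polynomial.coeff_C_mul_X_pow] at hd
    rw [Finset.sum_ite_eq] at hd
    split_ifs at hd with hmem
    · exact hd
    · rw [homogeneousComponent_eq_zero _ _ (by simpa using hmem), map_zero]
  rw [← sum_homogeneousComponent p, map_sum]
  refine Finset.sum_eq_zero fun k _ => ?_
  by_cases hk : k < N
  · rw [hcomp k hk, map_zero]
  · push Not at hk
    rw [aeval_def, eval₂_eq]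
    refine Finset.sum_eq_zero fun d hd => ?_
    -- A monomial of degree k ≥ N is a product of at least N of the `ν i`, which vanishes by `hν`.
    have hdeg : d.degree = k := by
      have h1 := (homogeneousComponent_isHomogeneous k p) (mem_support_iff.1 hd)
      rw [← h1, Finsupp.degree_eq_weight_one]
      rfl
    have : ∏ i ∈ d.support, ν i ^ d i = (d.toMultiset.toList.map ν).prod := by
      rw [← Multiset.prod_coe, ← Multiset.map_coe, Multiset.coe_toList, Finsupp.toMultiset_map,
        Finsupp.prod_toMultiset]
      rw [Finsupp.prod_mapDomain_index (by simp) (by intro _ _ _; rw [pow_add])]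
      rfl
    rw [this, hν, mul_zero]
    rw [Multiset.length_toList, Finsupp.card_toMultiset]
    exact hk.trans hdeg.symm.le

theorem _root_.MvPolynomial.eval_bind₁' {σ τ : Type} (y : τ → ℝ) (h : σ → MvPolynomial τ ℝ)
    (p : MvPolynomial σ ℝ) : MvPolynomial.eval y (MvPolynomial.bind₁ h p) =
      MvPolynomial.eval (fun a => MvPolynomial.eval y (h a)) p := by
  rw [MvPolynomial.eval, MvPolynomial.eval₂Hom_bind₁]
  rfl

/-! ## Evaluation of smooth functions at even points -/

section Smooth

variable {B : SuperWeil} {n n' : ℕ}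

/-- The nilpotent parts of a family of even elements. -/
def nilCenter (x : Fin n → B) (hx : ∀ a, x a ∈ B.gr 0) (a : Fin n) :
    Subalgebra.center ℝ (B : Type) :=
  ⟨x a - algebraMap ℝ B (B.aug (x a)),
    B.even_mem_center (Submodule.sub_mem _ (hx a) (B.algebraMap_mem _))⟩

theorem SuperWeil.aug_nil (b : B) : B.aug (b - algebraMap ℝ B (B.aug b)) = 0 := by
  rw [map_sub, AlgHom.commutes]
  exact sub_self _

/-- Substitution into real polynomials needs a commutative target. Even elements are central, so
their nilpotent parts are taken in the center, and the nilpotency condition has to be available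
there. -/
theorem center_prod_eq_zero {ι : Type} (ν : ι → Subalgebra.center ℝ (B : Type))
    (hν : ∀ i, B.aug (ν i : B) = 0) (l : List ι) (hl : B.order ≤ l.length) :
    (l.map ν).prod = 0 := by
  apply Subtype.coe_injective
  have h := map_list_prod (Subalgebra.center ℝ (B : Type)).val (l.map ν)
  rw [List.map_map] at h
  refine h.trans ?_
  refine B.nilp _ (by simpa using hl) ?_
  intro b hb
  rw [List.mem_map] at hb
  obtain ⟨i, _, rfl⟩ := hb
  exact hν i

theorem coe_center_prod {k : ℕ} (ν : Fin k → Subalgebra.center ℝ (B : Type)) :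
    ((∏ j, ν j : Subalgebra.center ℝ (B : Type)) : B) = (List.ofFn fun j => (ν j : B)).prod := by
  have h := map_list_prod (Subalgebra.center ℝ (B : Type)).val (List.ofFn ν)
  rw [List.prod_ofFn, List.map_ofFn] at h
  exact h

theorem evalSmooth_eq_sum_of_le (f : (Fin n → ℝ) → ℝ) (x : Fin n → B) {N : ℕ}
    (hN : B.order ≤ N) :
    evalSmooth B f x = ∑ k ∈ Finset.range N, ∑ t : Fin k → Fin n,
      ((k.factorial : ℝ)⁻¹ *
        iteratedFDeriv ℝ k f (fun a => B.aug (x a)) (fun j => Pi.single (t j) 1)) •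
      (List.ofFn fun j => x (t j) - algebraMap ℝ B (B.aug (x (t j)))).prod := by
  refine Finset.sum_subset (Finset.range_mono hN) fun k _ hk => ?_
  refine Finset.sum_eq_zero fun t _ => ?_
  rw [B.nilp _ (by simpa using hk), smul_zero]
  intro b hb
  rw [List.mem_ofFn] at hb
  obtain ⟨j, rfl⟩ := hb
  exact SuperWeil.aug_nil _

/-- The value of `f` by its Taylor polynomial of any sufficiently high degree. -/
theorem evalSmooth_eq_aeval_of_le (f : (Fin n → ℝ) → ℝ) (x : Fin n → B)
    (hx : ∀ a, x a ∈ B.gr 0) {N : ℕ} (hN : B.order ≤ N) :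
    evalSmooth B f x =
      (MvPolynomial.aeval (nilCenter x hx) (taylorPoly N f fun a => B.aug (x a)) :
        Subalgebra.center ℝ (B : Type)) := by
  have hterm : ∀ k, ((∑ t : Fin k → Fin n, MvPolynomial.aeval (nilCenter x hx)
      (MvPolynomial.C ((k.factorial : ℝ)⁻¹ * iteratedFDeriv ℝ k f (fun a => B.aug (x a))
        (fun j => Pi.single (t j) 1)) * ∏ j, MvPolynomial.X (t j)) :
        Subalgebra.center ℝ (B : Type)) : B) =
      ∑ t : Fin k → Fin n, ((k.factorial : ℝ)⁻¹ *
        iteratedFDeriv ℝ k f (fun a => B.aug (x a)) (fun j => Pi.single (t j) 1)) •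
      (List.ofFn fun j => x (t j) - algebraMap ℝ B (B.aug (x (t j)))).prod := by
    intro k
    rw [AddSubmonoidClass.coe_finsetSum]
    refine Finset.sum_congr rfl fun t _ => ?_
    rw [← MvPolynomial.smul_eq_C_mul, map_smul, map_prod]
    simp only [MvPolynomial.aeval_X]
    rw [SetLike.val_smul, coe_center_prod]
    rfl
  rw [taylorPoly, map_sum, evalSmooth_eq_sum_of_le f x hN, AddSubmonoidClass.coe_finsetSum]
  simp only [map_sum]
  rw [Finset.sum_congr rfl fun k _ => hterm k]

theorem evalSmooth_eq_aeval (f : (Fin n → ℝ) → ℝ) (x : Fin n → B) (hx : ∀ a, x a ∈ B.gr 0) :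
    evalSmooth B f x =
      (MvPolynomial.aeval (nilCenter x hx) (taylorPoly B.order f fun a => B.aug (x a)) :
        Subalgebra.center ℝ (B : Type)) :=
  evalSmooth_eq_aeval_of_le f x hx le_rfl

theorem taylorPoly_isBigO {f : (Fin n → ℝ) → ℝ} {x₀ : Fin n → ℝ} (hf : ContDiffAt ℝ ∞ f x₀)
    (N : ℕ) : (fun y : Fin n → ℝ => MvPolynomial.eval y (taylorPoly (N + 1) f x₀) - f (x₀ + y))
      =O[𝓝 0] fun y => ‖y‖ ^ (N + 1) := by
  have h := taylor_isBigO hf N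
  have ht : Tendsto (fun y : Fin n → ℝ => ((x₀, y) : (Fin n → ℝ) × (Fin n → ℝ))) (𝓝 0)
      (𝓝 (x₀, 0)) := (Continuous.prodMk_right x₀).tendsto 0
  have h2 := h.comp_tendsto ht
  rw [← isBigO_neg_left] at h2
  refine h2.congr_left fun y => ?_
  simp only [Function.comp, eval_taylorPoly]
  ring

/-- Two polynomials that approximate f up to `B.order` differ by a polynomial that is O(‖y‖^order),
and such a polynomial vanishes at nilpotent points. Hence any such approximant may replace the
Taylor polynomial. The sum, product and composition rules follow, because sums, products and
composites of Taylor polynomials are again approximants. -/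
theorem evalSmooth_eq_of_isBigO {f : (Fin n → ℝ) → ℝ} (x : Fin n → B) (hx : ∀ a, x a ∈ B.gr 0)
    (hf : ContDiffAt ℝ ∞ f fun a => B.aug (x a)) (p : MvPolynomial (Fin n) ℝ)
    (hp : (fun y : Fin n → ℝ => MvPolynomial.eval y p - f ((fun a => B.aug (x a)) + y))
      =O[𝓝 0] fun y => ‖y‖ ^ B.order) :
    evalSmooth B f x =
      (MvPolynomial.aeval (nilCenter x hx) p : Subalgebra.center ℝ (B : Type)) := by
  rw [evalSmooth_eq_aeval f x hx]
  congr 1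
  rw [← sub_eq_zero, ← map_sub]
  obtain ⟨N, hN⟩ : ∃ N, B.order = N + 1 := ⟨B.order - 1, by have := B.one_le_order; omega⟩
  refine aeval_eq_zero_of_isBigO (N := B.order) _ ?_ _
    (fun l hl => center_prod_eq_zero _ (fun i => SuperWeil.aug_nil _) l hl)
  rw [hN] at hp ⊢
  refine ((taylorPoly_isBigO hf N).sub hp).congr_left fun y => ?_
  rw [map_sub]
  ring

theorem taylorPoly_order_isBigO {f : (Fin n → ℝ) → ℝ} {x₀ : Fin n → ℝ}
    (hf : ContDiffAt ℝ ∞ f x₀) :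
    (fun y : Fin n → ℝ => MvPolynomial.eval y (taylorPoly B.order f x₀) - f (x₀ + y))
      =O[𝓝 0] fun y => ‖y‖ ^ B.order := by
  obtain ⟨N, hN⟩ : ∃ N, B.order = N + 1 := ⟨B.order - 1, by have := B.one_le_order; omega⟩
  rw [hN]
  exact taylorPoly_isBigO hf N

theorem evalSmooth_const (c : ℝ) (x : Fin n → B) (hx : ∀ a, x a ∈ B.gr 0) :
    evalSmooth B (fun _ => c) x = algebraMap ℝ B c := by
  rw [evalSmooth_eq_of_isBigO x hx contDiffAt_const (MvPolynomial.C c)]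
  · rw [MvPolynomial.aeval_C]; rfl
  · simp only [MvPolynomial.eval_C, sub_self]
    exact isBigO_zero _ _

theorem evalSmooth_proj (a : Fin n) (x : Fin n → B) (hx : ∀ a, x a ∈ B.gr 0) :
    evalSmooth B (fun y => y a) x = x a := by
  rw [evalSmooth_eq_of_isBigO x hx (contDiffAt_apply ℝ ℝ a _)
    (MvPolynomial.C (B.aug (x a)) + MvPolynomial.X a)]
  · rw [map_add, MvPolynomial.aeval_C, MvPolynomial.aeval_X]
    exact add_sub_cancel _ _
  · simp only [map_add, MvPolynomial.eval_C, MvPolynomial.eval_X, Pi.add_apply, sub_self]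
    exact isBigO_zero _ _

theorem evalSmooth_mul {f g : (Fin n → ℝ) → ℝ} (x : Fin n → B) (hx : ∀ a, x a ∈ B.gr 0)
    (hf : ContDiffAt ℝ ∞ f fun a => B.aug (x a)) (hg : ContDiffAt ℝ ∞ g fun a => B.aug (x a)) :
    evalSmooth B (fun y => f y * g y) x = evalSmooth B f x * evalSmooth B g x := by
  rw [evalSmooth_eq_of_isBigO x hx (hf.mul hg) (taylorPoly B.order f (fun a => B.aug (x a)) *
    taylorPoly B.order g (fun a => B.aug (x a))), map_mul, evalSmooth_eq_aeval f x hx,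
    evalSmooth_eq_aeval g x hx]
  · rfl
  · have h1 := taylorPoly_order_isBigO (B := B) hf
    have h2 := taylorPoly_order_isBigO (B := B) hg
    set x₀ := fun a => B.aug (x a)
    have b1 : (fun y : Fin n → ℝ => MvPolynomial.eval y (taylorPoly B.order f x₀)) =O[𝓝 0]
        fun _ => (1 : ℝ) :=
      ((MvPolynomial.continuous_eval _).tendsto 0).isBigO_one ℝ
    have b2 : (fun y : Fin n → ℝ => g (x₀ + y)) =O[𝓝 0] fun _ => (1 : ℝ) := by
      have hc : ContinuousAt (fun y => g (x₀ + y)) 0 := by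
        apply ContinuousAt.comp (g := g)
        · simpa using hg.continuousAt
        · fun_prop
      exact hc.tendsto.isBigO_one ℝ
    have t1 := b1.mul h2
    have t2 := h1.mul b2
    simp only [one_mul] at t1
    simp only [mul_one] at t2
    refine (t1.add t2).congr_left fun y => ?_
    rw [map_mul]
    ring

theorem evalSmooth_add {f g : (Fin n → ℝ) → ℝ} (x : Fin n → B) (hx : ∀ a, x a ∈ B.gr 0)
    (hf : ContDiffAt ℝ ∞ f fun a => B.aug (x a)) (hg : ContDiffAt ℝ ∞ g fun a => B.aug (x a)) :
    evalSmooth B (fun y => f y + g y) x = evalSmooth B f x + evalSmooth B g x := by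
  rw [evalSmooth_eq_of_isBigO x hx (hf.add hg) (taylorPoly B.order f (fun a => B.aug (x a)) +
    taylorPoly B.order g (fun a => B.aug (x a))), map_add, evalSmooth_eq_aeval f x hx,
    evalSmooth_eq_aeval g x hx]
  · rfl
  · refine ((taylorPoly_order_isBigO (B := B) hf).add
      (taylorPoly_order_isBigO (B := B) hg)).congr_left fun y => ?_
    rw [map_add]
    ring

theorem evalSmooth_smul {f : (Fin n → ℝ) → ℝ} (c : ℝ) (x : Fin n → B)
    (hx : ∀ a, x a ∈ B.gr 0) (hf : ContDiffAt ℝ ∞ f fun a => B.aug (x a)) :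
    evalSmooth B (fun y => c * f y) x = c • evalSmooth B f x := by
  rw [evalSmooth_mul x hx contDiffAt_const hf, evalSmooth_const c x hx, Algebra.smul_def]

theorem evalSmooth_sum {ι : Type} (s : Finset ι) {f : ι → (Fin n → ℝ) → ℝ} (x : Fin n → B)
    (hx : ∀ a, x a ∈ B.gr 0) (hf : ∀ i ∈ s, ContDiffAt ℝ ∞ (f i) fun a => B.aug (x a)) :
    evalSmooth B (fun y => ∑ i ∈ s, f i y) x = ∑ i ∈ s, evalSmooth B (f i) x := by
  classical
  induction s using Finset.induction_on with
  | empty => simpa using evalSmooth_const 0 x hx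
  | insert a s ha ih =>
    simp only [Finset.sum_insert ha]
    rw [evalSmooth_add x hx (hf a (Finset.mem_insert_self _ _))
      (ContDiffAt.sum fun i hi => hf i (Finset.mem_insert_of_mem hi)),
      ih fun i hi => hf i (Finset.mem_insert_of_mem hi)]

theorem evalSmooth_congr {f g : (Fin n → ℝ) → ℝ} (x : Fin n → B)
    (h : f =ᶠ[𝓝 fun a => B.aug (x a)] g) : evalSmooth B f x = evalSmooth B g x := by
  unfold evalSmooth
  refine Finset.sum_congr rfl fun k _ => Finset.sum_congr rfl fun t _ => ?_
  rw [(h.iteratedFDeriv ℝ k).eq_of_nhds]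

theorem aug_evalSmooth (f : (Fin n → ℝ) → ℝ) (x : Fin n → B) :
    B.aug (evalSmooth B f x) = f fun a => B.aug (x a) := by
  unfold evalSmooth
  rw [map_sum, Finset.sum_eq_single 0]
  · simp
  · intro k _ hk
    rw [map_sum]
    refine Finset.sum_eq_zero fun t _ => ?_
    obtain ⟨k, rfl⟩ := Nat.exists_eq_succ_of_ne_zero hk
    rw [map_smul, List.ofFn_succ, List.prod_cons, map_mul, SuperWeil.aug_nil, zero_mul, smul_zero]
  · intro h
    exact absurd (Finset.mem_range.2 B.one_le_order) h

theorem evalSmooth_mem (f : (Fin n → ℝ) → ℝ) (x : Fin n → B) (hx : ∀ a, x a ∈ B.gr 0) :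
    evalSmooth B f x ∈ B.gr 0 := by
  unfold evalSmooth
  refine Submodule.sum_mem _ fun k _ => Submodule.sum_mem _ fun t _ => Submodule.smul_mem _ _ ?_
  generalize hl : (List.ofFn fun j => x (t j) - algebraMap ℝ B (B.aug (x (t j)))) = l
  have : ∀ b ∈ l, b ∈ B.gr 0 := by
    intro b hb
    rw [← hl, List.mem_ofFn] at hb
    obtain ⟨j, rfl⟩ := hb
    exact Submodule.sub_mem _ (hx _) (B.algebraMap_mem _)
  clear hl
  induction l with
  | nil => exact B.one_mem
  | cons b l ih =>
    rw [List.prod_cons]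
    exact B.mul_mem_even (this b (by simp)) (ih fun c hc => this c (by simp [hc]))

/-- The approximant for the composite is the Taylor polynomial of f with the Taylor polynomials of
the `g a`, freed of their constant terms, substituted into it. Its error has two sources: the inner
approximation and the outer one. -/
theorem evalSmooth_comp {f : (Fin n' → ℝ) → ℝ} {g : Fin n' → (Fin n → ℝ) → ℝ} (x : Fin n → B)
    (hx : ∀ a, x a ∈ B.gr 0) (hg : ∀ a, ContDiffAt ℝ ∞ (g a) fun a => B.aug (x a))
    (hf : ContDiffAt ℝ ∞ f fun a => g a fun a => B.aug (x a)) :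
    evalSmooth B (fun y => f fun a => g a y) x =
      evalSmooth B f fun a => evalSmooth B (g a) x := by
  set x₀ := fun a => B.aug (x a) with hx₀
  have hgpi : ContDiffAt ℝ ∞ (fun y a => g a y) x₀ := contDiffAt_pi.2 hg
  have hy : ∀ a, evalSmooth B (g a) x ∈ B.gr 0 := fun a => evalSmooth_mem _ _ hx
  rw [evalSmooth_eq_of_isBigO (f := fun y => f fun a => g a y) x hx (hf.comp x₀ hgpi)
    (MvPolynomial.bind₁ (fun a => taylorPoly B.order (g a) x₀ - MvPolynomial.C (g a x₀))
      (taylorPoly B.order f fun a => g a x₀)), evalSmooth_eq_aeval f _ hy]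
  · congr 1
    rw [MvPolynomial.aeval_bind₁]
    have e1 : (fun a => B.aug (evalSmooth B (g a) x)) = fun a => g a x₀ :=
      funext fun a => aug_evalSmooth _ _
    rw [e1]
    congr 2
    funext a
    rw [map_sub, MvPolynomial.aeval_C]
    apply Subtype.coe_injective
    change ((MvPolynomial.aeval (nilCenter x hx) (taylorPoly B.order (g a) x₀) :
      Subalgebra.center ℝ (B : Type)) : B) - algebraMap ℝ B (g a x₀) =
        evalSmooth B (g a) x - algebraMap ℝ B (B.aug (evalSmooth B (g a) x))
    rw [aug_evalSmooth, evalSmooth_eq_aeval (g a) x hx]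
  · set y₀ := fun a => g a x₀
    set T := taylorPoly B.order f y₀
    have hTf := taylorPoly_order_isBigO (B := B) hf
    -- increments of `g`
    have hd : (fun y : Fin n → ℝ => (fun a => g a (x₀ + y)) - y₀) =O[𝓝 0] fun y => y := by
      have h1 := (hgpi.differentiableAt (by simp)).isBigO_sub
      have ht : Tendsto (fun y : Fin n → ℝ => x₀ + y) (𝓝 0) (𝓝 x₀) := by
        have : ContinuousAt (fun y : Fin n → ℝ => x₀ + y) 0 := by fun_prop
        simpa [ContinuousAt] using this
      have h2 := h1.comp_tendsto ht
      refine (h2.congr_left fun y => ?_).congr_right fun y => ?_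
      · rfl
      · simp
    have ht0 : Tendsto (fun y : Fin n → ℝ => (fun a => g a (x₀ + y)) - y₀) (𝓝 0) (𝓝 0) :=
      hd.trans_tendsto tendsto_id
    have hp : (fun y : Fin n → ℝ => fun a => MvPolynomial.eval y (taylorPoly B.order (g a) x₀) -
        g a (x₀ + y)) =O[𝓝 0] fun y => ‖y‖ ^ B.order :=
      isBigO_pi.2 fun a => taylorPoly_order_isBigO (hg a)
    have ht1 : Tendsto (fun y : Fin n → ℝ => fun a =>
        MvPolynomial.eval y (taylorPoly B.order (g a) x₀) - g a x₀) (𝓝 0) (𝓝 0) := by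
      have h0 : Tendsto (fun y : Fin n → ℝ => ‖y‖ ^ B.order) (𝓝 0) (𝓝 0) := by
        have : ContinuousAt (fun y : Fin n → ℝ => ‖y‖ ^ B.order) 0 := by fun_prop
        have h1 := B.one_le_order
        simpa [ContinuousAt, zero_pow (show B.order ≠ 0 by omega)] using this
      have h2 := (hp.trans_tendsto h0).add ht0
      rw [add_zero] at h2
      refine h2.congr fun y => ?_
      funext a
      simp [y₀]
    have hstrict : HasStrictFDerivAt (fun u : Fin n' → ℝ => MvPolynomial.eval u T)
        (fderiv ℝ (fun u : Fin n' → ℝ => MvPolynomial.eval u T) 0) 0 := by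
      have : ContDiffAt ℝ 1 (fun u : Fin n' → ℝ => MvPolynomial.eval u T) 0 := by
        have := AnalyticOnNhd.eval_mvPolynomial (𝕜 := ℝ) T 0 (Set.mem_univ _)
        exact this.contDiffAt
      exact this.hasStrictFDerivAt (by simp)
    -- The polynomial T is Lipschitz near 0, so passing from the inner polynomials to the true
    -- increments of g costs only O(‖y‖^order).
    have hl := hstrict.isBigO_sub.comp_tendsto (ht1.prodMk_nhds ht0)
    have hl2 : (fun y : Fin n → ℝ =>
        MvPolynomial.eval (fun a => MvPolynomial.eval y (taylorPoly B.order (g a) x₀) - g a x₀) T -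
        MvPolynomial.eval ((fun a => g a (x₀ + y)) - y₀) T) =O[𝓝 0] fun y => ‖y‖ ^ B.order := by
      refine IsBigO.trans hl (hp.congr_left fun y => ?_)
      funext a
      simp [y₀]
    -- The Taylor error of f at the increments of g, which are themselves O(y).
    have hl3 := (hTf.comp_tendsto ht0).trans (hd.norm_left.norm_right.pow B.order)
    refine (hl2.add hl3).congr_left fun y => ?_
    simp only [Function.comp, add_sub_cancel]
    rw [MvPolynomial.eval_bind₁']
    simp only [map_sub, MvPolynomial.eval_C]
    exact sub_add_sub_cancel _ _ _

/-- Taylor's formula for a nilpotent even increment. -/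
theorem evalSmooth_add_nil {f : (Fin n → ℝ) → ℝ} (y ν : Fin n → B) (hy : ∀ a, y a ∈ B.gr 0)
    (hν : ∀ a, ν a ∈ B.gr 0) (hν0 : ∀ a, B.aug (ν a) = 0)
    (hf : ContDiffAt ℝ ∞ f fun a => B.aug (y a)) {N : ℕ} (hN : B.order ≤ N) :
    evalSmooth B f (fun a => y a + ν a) = ∑ k ∈ Finset.range N, ∑ t : Fin k → Fin n,
      (k.factorial : ℝ)⁻¹ • (evalSmooth B
        (fun z => iteratedFDeriv ℝ k f z (fun j => Pi.single (t j) 1)) y *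
          (List.ofFn fun j => ν (t j)).prod) := by
  have hsum : ∀ a, y a + ν a ∈ B.gr 0 := fun a => Submodule.add_mem _ (hy a) (hν a)
  have haug : (fun a => B.aug (y a + ν a)) = fun a => B.aug (y a) := by
    funext a
    rw [map_add, hν0, add_zero]
  set x₀ := fun a => B.aug (y a)
  let νc : Fin n → Subalgebra.center ℝ (B : Type) := fun a => ⟨ν a, B.even_mem_center (hν a)⟩
  let w : Fin n ⊕ Fin n → Subalgebra.center ℝ (B : Type) := Sum.elim (nilCenter y hy) νc
  have hw : ∀ i, B.aug (w i : B) = 0 := by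
    rintro (a | a)
    · exact SuperWeil.aug_nil _
    · exact hν0 a
  let D : (k : ℕ) → (Fin k → Fin n) → (Fin n → ℝ) → ℝ :=
    fun k t z => iteratedFDeriv ℝ k f z (fun j => Pi.single (t j) 1)
  have hD : ∀ k t, ContDiffAt ℝ ∞ (D k t) x₀ := by
    intro k t
    have h1 : ContDiffAt ℝ ∞ (iteratedFDeriv ℝ k f) x₀ :=
      hf.iteratedFDeriv_right (i := k) (m := ∞) (by exact_mod_cast le_rfl)
    exact (ContinuousMultilinearMap.apply ℝ (fun _ : Fin k => Fin n → ℝ) ℝ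
      (fun j => Pi.single (t j) 1)).contDiff.contDiffAt.comp x₀ h1
  -- The nilpotent part of y and the increment ν are treated as 2n independent nilpotent variables.
  -- Both sides are values of polynomials p₁, p₂ in these variables, and it suffices that p₁ - p₂ is
  -- O(‖z‖^N).
  let p₁ : MvPolynomial (Fin n ⊕ Fin n) ℝ :=
    MvPolynomial.bind₁ (fun a => MvPolynomial.X (Sum.inl a) + MvPolynomial.X (Sum.inr a))
      (taylorPoly N f x₀)
  let p₂ : MvPolynomial (Fin n ⊕ Fin n) ℝ := ∑ k ∈ Finset.range N, ∑ t : Fin k → Fin n,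
    (k.factorial : ℝ)⁻¹ • (MvPolynomial.rename Sum.inl (taylorPoly N (D k t) x₀) *
      ∏ j, MvPolynomial.X (Sum.inr (t j)))
  have e1 : evalSmooth B f (fun a => y a + ν a) =
      (MvPolynomial.aeval w p₁ : Subalgebra.center ℝ (B : Type)) := by
    rw [evalSmooth_eq_aeval_of_le f _ hsum hN, haug, MvPolynomial.aeval_bind₁]
    congr 3
    funext a
    apply Subtype.coe_injective
    simp only [map_add, MvPolynomial.aeval_X]
    change y a + ν a - algebraMap ℝ B (B.aug (y a + ν a)) =
      y a - algebraMap ℝ B (B.aug (y a)) + ν a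
    rw [map_add, hν0, add_zero]
    abel
  have e2 : (∑ k ∈ Finset.range N, ∑ t : Fin k → Fin n,
      (k.factorial : ℝ)⁻¹ • (evalSmooth B (D k t) y * (List.ofFn fun j => ν (t j)).prod)) =
      (MvPolynomial.aeval w p₂ : Subalgebra.center ℝ (B : Type)) := by
    simp only [p₂, map_sum, AddSubmonoidClass.coe_finsetSum]
    refine Finset.sum_congr rfl fun k _ => Finset.sum_congr rfl fun t _ => ?_
    rw [map_smul, map_mul, MvPolynomial.aeval_rename, map_prod,
      evalSmooth_eq_aeval_of_le _ y hy hN]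
    simp only [MvPolynomial.aeval_X]
    rw [SetLike.val_smul, MulMemClass.coe_mul, coe_center_prod]
    rfl
  rw [e1]
  refine Eq.trans ?_ e2.symm
  congr 1
  rw [← sub_eq_zero, ← map_sub]
  refine aeval_eq_zero_of_isBigO (N := N) _ ?_ _
    (fun l hl => center_prod_eq_zero _ hw l (hN.trans hl))
  obtain ⟨N, rfl⟩ : ∃ M, N = M + 1 := ⟨N - 1, by have := B.one_le_order; omega⟩
  have hL : (fun z : Fin n ⊕ Fin n → ℝ => fun a => z (Sum.inl a)) =O[𝓝 0] fun z => z :=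
    isBigO_pi.2 fun a => IsBigO.of_bound 1 (Eventually.of_forall fun z => by
      rw [one_mul]; exact norm_le_pi_norm z _)
  have hR : (fun z : Fin n ⊕ Fin n → ℝ => fun a => z (Sum.inr a)) =O[𝓝 0] fun z => z :=
    isBigO_pi.2 fun a => IsBigO.of_bound 1 (Eventually.of_forall fun z => by
      rw [one_mul]; exact norm_le_pi_norm z _)
  have tL := hL.trans_tendsto tendsto_id
  have tR := hR.trans_tendsto tendsto_id
  have tLR := tL.add tR
  rw [add_zero] at tLR
  -- the first polynomial
  have h1 := ((taylorPoly_isBigO hf N).comp_tendsto tLR).trans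
    ((hL.add hR).norm_left.norm_right.pow (N + 1))
  -- the remainder
  have tz : Tendsto (fun z : Fin n ⊕ Fin n → ℝ => (((x₀ + fun a => z (Sum.inl a)),
      fun a => z (Sum.inr a)) : (Fin n → ℝ) × (Fin n → ℝ))) (𝓝 0) (𝓝 (x₀, 0)) := by
    have := (tendsto_const_nhds (x := x₀)).add tL
    rw [add_zero] at this
    exact this.prodMk_nhds tR
  -- Here the base point of the expansion moves with z, so Taylor's theorem is needed locally
  -- uniformly in the base point.
  have h2 := ((taylor_isBigO hf N).comp_tendsto tz).trans (hR.norm_left.norm_right.pow (N + 1))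
  have hbdd : ∀ k (t : Fin k → Fin n), (fun z : Fin n ⊕ Fin n → ℝ =>
      (k.factorial : ℝ)⁻¹ * ∏ j, z (Sum.inr (t j))) =O[𝓝 0] fun _ => (1 : ℝ) := by
    intro k t
    have hc : Continuous (fun z : Fin n ⊕ Fin n → ℝ =>
      (k.factorial : ℝ)⁻¹ * ∏ j, z (Sum.inr (t j))) := by fun_prop
    exact (hc.tendsto 0).isBigO_one ℝ
  have h3 : (fun z : Fin n ⊕ Fin n → ℝ => ∑ k ∈ Finset.range (N + 1), ∑ t : Fin k → Fin n,
      ((k.factorial : ℝ)⁻¹ * ∏ j, z (Sum.inr (t j))) *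
        (MvPolynomial.eval (fun a => z (Sum.inl a)) (taylorPoly (N + 1) (D k t) x₀) -
          D k t (x₀ + fun a => z (Sum.inl a)))) =O[𝓝 0] fun z => ‖z‖ ^ (N + 1) := by
    refine IsBigO.fun_sum fun k _ => IsBigO.fun_sum fun t _ => ?_
    have := (hbdd k t).mul (((taylorPoly_isBigO (hD k t) N).comp_tendsto tL).trans
      (hL.norm_left.norm_right.pow (N + 1)))
    refine this.congr_right fun z => ?_
    exact one_mul _
  refine ((h1.add h2).sub h3).congr_left fun z => ?_
  have hder : ∀ k, (k.factorial : ℝ)⁻¹ • iteratedFDeriv ℝ k f (x₀ + fun a => z (Sum.inl a))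
      (fun _ => fun a => z (Sum.inr a)) = ∑ t : Fin k → Fin n,
        ((k.factorial : ℝ)⁻¹ * ∏ j, z (Sum.inr (t j))) *
          D k t (x₀ + fun a => z (Sum.inl a)) := by
    intro k
    have h1 := eval_taylorPoly (k + 1) f (x₀ + fun a => z (Sum.inl a)) fun a => z (Sum.inr a)
    have h2 := eval_taylorPoly k f (x₀ + fun a => z (Sum.inl a)) fun a => z (Sum.inr a)
    rw [taylorPoly, Finset.sum_range_succ, map_add] at h1
    rw [Finset.sum_range_succ, ← h2, ← taylorPoly] at h1
    rw [← add_left_cancel h1, map_sum]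
    refine Finset.sum_congr rfl fun t _ => ?_
    simp only [map_mul, MvPolynomial.eval_C, map_prod, MvPolynomial.eval_X, D]
    ring
  have ev1 : MvPolynomial.eval z p₁ = MvPolynomial.eval
      ((fun a => z (Sum.inl a)) + fun a => z (Sum.inr a)) (taylorPoly (N + 1) f x₀) := by
    simp only [p₁]
    rw [MvPolynomial.eval_bind₁']
    simp only [map_add, MvPolynomial.eval_X]
    rfl
  have ev2 : MvPolynomial.eval z p₂ = ∑ k ∈ Finset.range (N + 1), ∑ t : Fin k → Fin n,
      ((k.factorial : ℝ)⁻¹ * ∏ j, z (Sum.inr (t j))) *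
        MvPolynomial.eval (fun a => z (Sum.inl a)) (taylorPoly (N + 1) (D k t) x₀) := by
    simp only [p₂, map_sum]
    refine Finset.sum_congr rfl fun k _ => Finset.sum_congr rfl fun t _ => ?_
    rw [MvPolynomial.smul_eval, map_mul, MvPolynomial.eval_rename, map_prod]
    simp only [MvPolynomial.eval_X, Function.comp_def]
    ring
  rw [map_sub, ev1, ev2]
  simp only [Function.comp, hder, mul_sub, Finset.sum_sub_distrib, add_assoc]
  ring

end Smooth

/-! ## Ordered monomials -/

section Monomials

variable {S : Type} [Fintype S] [LinearOrder S] [Parity S] {B : SuperWeil}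

/-- The ordered monomial with exponents `α`. -/
def mono (v : S → B) (α : S → ℕ) : B :=
  ((Finset.univ.sort (· ≤ ·)).map fun s => v s ^ α s).prod

/-- The increasing word with letter counts `α`. -/
def word (α : S → ℕ) : List S :=
  (Finset.univ.sort (· ≤ ·)).flatMap fun s => List.replicate (α s) s

theorem mono_eq_word (v : S → B) (α : S → ℕ) : mono v α = ((word α).map v).prod := by
  unfold mono word
  generalize Finset.sort (Finset.univ : Finset S) (· ≤ ·) = l
  induction l with
  | nil => simp
  | cons s l ih => simp [ih]

theorem count_word (α : S → ℕ) (s : S) : (word α).count s = α s := by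
  unfold word
  rw [List.count_flatMap]
  have : (List.count s ∘ fun t => List.replicate (α t) t) = fun t => if t = s then α s else 0 := by
    funext t
    simp only [Function.comp, List.count_replicate, beq_iff_eq]
    split_ifs with h
    · rw [h]
    · rfl
  rw [this, ← Multiset.sum_coe, ← Multiset.map_coe, Finset.sort_eq]
  exact (Finset.sum_ite_eq' Finset.univ s fun _ => α s).trans (if_pos (Finset.mem_univ s))

theorem length_word (α : S → ℕ) : (word α).length = ∑ s, α s := by
  have h : Multiset.card (word α : Multiset S) = ∑ s, (word α : Multiset S).count s :=
    (Multiset.sum_count_eq_card fun a _ => Finset.mem_univ a).symm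
  simpa [count_word] using h

/-- Exchanging two adjacent letters costs a sign that depends only on their parities. The factor can
therefore be chosen before the algebra and the values, and `RepN.exists_coef` relies on this. -/
theorem prod_word_perm {l l' : List S} (h : l.Perm l') :
    ∃ σ : ℝ, ∀ (B : SuperWeil) (v : S → B), B.IsFormal v →
      (l.map v).prod = σ • (l'.map v).prod := by
  induction h with
  | nil => exact ⟨1, by simp⟩
  | cons a _ ih =>
    obtain ⟨σ, hσ⟩ := ih
    refine ⟨σ, fun B v hv => ?_⟩
    rw [List.map_cons, List.map_cons, List.prod_cons, List.prod_cons, hσ B v hv, mul_smul_comm]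
  | swap a b l =>
    refine ⟨(-1) ^ ((Parity.par b : ZMod 2).val * (Parity.par a : ZMod 2).val), fun B v hv => ?_⟩
    simp only [List.map_cons, List.prod_cons]
    rw [← mul_assoc, B.supercomm _ _ _ _ (hv b).1 (hv a).1, Algebra.smul_def, map_pow, map_neg,
      map_one]
    simp only [mul_assoc]
  | trans _ _ ih1 ih2 =>
    obtain ⟨σ, hσ⟩ := ih1
    obtain ⟨τ, hτ⟩ := ih2
    exact ⟨σ * τ, fun B v hv => by rw [hσ B v hv, hτ B v hv, smul_smul]⟩

/-- Every word in formal variables is, up to a sign, an ordered monomial. -/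
theorem prod_word (l : List S) :
    ∃ σ : ℝ, ∀ (B : SuperWeil) (v : S → B), B.IsFormal v →
      (l.map v).prod = σ • mono v (fun s => l.count s) := by
  have hp : l.Perm (word fun s => l.count s) :=
    List.perm_iff_count.2 fun s => (count_word (fun s => l.count s) s).symm
  obtain ⟨σ, hσ⟩ := prod_word_perm hp
  exact ⟨σ, fun B v hv => by rw [hσ B v hv, mono_eq_word]⟩

theorem mono_eq_zero {v : S → B} (hv : ∀ s, B.aug (v s) = 0) {α : S → ℕ}
    (hα : B.order ≤ ∑ s, α s) : mono v α = 0 := by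
  rw [mono_eq_word]
  refine B.nilp _ (by simpa [length_word] using hα) ?_
  intro b hb
  obtain ⟨s, _, rfl⟩ := List.mem_map.1 hb
  exact hv s

theorem mono_zero (v : S → B) : mono v 0 = 1 := by
  unfold mono
  simp

theorem SuperWeil.pow_mem (B : SuperWeil) {i : ZMod 2} {b : B} (hb : b ∈ B.gr i) (k : ℕ) :
    b ^ k ∈ B.gr (k * i) := by
  have := SetLike.pow_mem_graded k hb
  rwa [nsmul_eq_mul] at this

theorem mono_mem {v : S → B} (hv : ∀ s, v s ∈ B.gr (Parity.par s)) (α : S → ℕ) :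
    mono v α ∈ B.gr (∑ s, (α s : ZMod 2) * Parity.par s) := by
  have h : ∀ l : List S, (l.map fun s => v s ^ α s).prod ∈
      B.gr ((l.map fun s => (α s : ZMod 2) * Parity.par s).sum) := by
    intro l
    induction l with
    | nil => simpa using B.one_mem
    | cons s l ih =>
      simp only [List.map_cons, List.prod_cons, List.sum_cons]
      exact B.mul_mem (B.pow_mem (hv s) _) ih
  have e : ((Finset.univ.sort (· ≤ ·)).map fun s => (α s : ZMod 2) * Parity.par s).sum =
      ∑ s, (α s : ZMod 2) * Parity.par s := by
    rw [← Multiset.sum_coe, ← Multiset.map_coe, Finset.sort_eq]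
    rfl
  rw [← e]
  exact h _

/-! ## First-order expansion of monomials -/

theorem pow_mul_comm_sign {i j : ZMod 2} {a d : B} (ha : a ∈ B.gr i) (hd : d ∈ B.gr j) (k : ℕ) :
    a ^ k * d = (-1 : ℝ) ^ (j.val * (i.val * k)) • (d * a ^ k) := by
  induction k with
  | zero => simp
  | succ k ih =>
    rw [pow_succ, mul_assoc, B.supercomm i j a d ha hd]
    have : ((-1 : B) ^ (i.val * j.val)) = algebraMap ℝ B ((-1) ^ (i.val * j.val)) := by simp
    rw [this, ← Algebra.smul_def, mul_smul_comm, ← mul_assoc, ih, smul_mul_assoc, smul_smul,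
      mul_assoc, ← pow_add]
    congr 2
    ring

/-- `I` is a two-sided ideal. -/
def TwoSided (I : Submodule ℝ B) : Prop := ∀ a, ∀ b ∈ I, a * b ∈ I ∧ b * a ∈ I

/-- In the even case this is the binomial formula, in which terms with two factors from I vanish. In
the odd case a and d need not commute, but only the exponents 0 and 1 are allowed. -/
theorem add_pow_sq_zero {I : Submodule ℝ B} (hI : TwoSided I) (h2 : ∀ a ∈ I, ∀ b ∈ I, a * b = 0)
    {i : ZMod 2} {a d : B} (ha : a ∈ B.gr i) (hd : d ∈ B.gr i) (hdI : d ∈ I) {k : ℕ}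
    (hk : i = 1 → k ≤ 1) : (a + d) ^ k = a ^ k + (k : ℝ) • (d * a ^ (k - 1)) := by
  rcases zmod_two_cases i with rfl | rfl
  · clear hk
    induction k with
    | zero => simp
    | succ k ih =>
      rw [pow_succ, ih]
      cases k with
      | zero => simp
      | succ k =>
        have hda : a ^ (k + 1) * d = d * a ^ (k + 1) := (B.even_comm hd _).symm
        have hz : d * a ^ (k + 1 - 1) * d = 0 := h2 _ (hI _ _ hdI).2 _ hdI
        rw [add_mul, mul_add, mul_add, smul_mul_assoc, smul_mul_assoc, hz, hda, smul_zero,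
          add_zero, mul_assoc, ← pow_succ, ← pow_succ]
        simp only [Nat.add_sub_cancel]
        push_cast
        module
  · have := hk rfl
    interval_cases k <;> simp

/-- Leibniz rule: terms with two increments die because I has square zero, and in the others the
increment is carried to the front. The list is sorted, so the factors passed on the way are those
with smaller index, and the accumulated sign is the one in `dVar`. -/
theorem prod_add_expand {I : Submodule ℝ B} (hI : TwoSided I)
    (h2 : ∀ a ∈ I, ∀ b ∈ I, a * b = 0) {v δ : S → B} (hv : ∀ s, v s ∈ B.gr (Parity.par s))
    (hδ : ∀ s, δ s ∈ B.gr (Parity.par s)) (hδI : ∀ s, δ s ∈ I) (α : S → ℕ)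
    (hα : ∀ s, Parity.par s = (1 : ZMod 2) → α s ≤ 1) (l : List S) (hl : l.Pairwise (· < ·)) :
    (l.map fun s => (v s + δ s) ^ α s).prod = (l.map fun s => v s ^ α s).prod +
      ∑ t ∈ l.toFinset, ((-1 : ℝ) ^ ((Parity.par t : ZMod 2).val *
        ∑ u ∈ l.toFinset.filter (· < t), (Parity.par u : ZMod 2).val * α u) * α t) •
          (δ t * (l.map fun s => v s ^ ((α - Pi.single t 1 : S → ℕ) s)).prod) := by
  induction l with
  | nil => simp
  | cons s l ih =>
    obtain ⟨hs, hl'⟩ := List.pairwise_cons.1 hl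
    have hsl : s ∉ l.toFinset := fun h => lt_irrefl s (hs s (List.mem_toFinset.1 h))
    specialize ih hl'
    simp only [List.map_cons, List.prod_cons, List.toFinset_cons]
    rw [Finset.sum_insert hsl, ih,
      add_pow_sq_zero hI h2 (hv s) (hδ s) (hδI s) (hα s), add_mul, mul_add]
    have hz : ((α s : ℝ) • (δ s * v s ^ (α s - 1))) * (∑ t ∈ l.toFinset,
        ((-1 : ℝ) ^ ((Parity.par t : ZMod 2).val *
        ∑ u ∈ l.toFinset.filter (· < t), (Parity.par u : ZMod 2).val * α u) * α t) •
          (δ t * (l.map fun s => v s ^ ((α - Pi.single t 1 : S → ℕ) s)).prod)) = 0 := by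
      apply h2
      · exact I.smul_mem _ (hI _ _ (hδI s)).2
      · exact I.sum_mem fun t _ => I.smul_mem _ (hI _ _ (hδI t)).2
    rw [mul_add, hz, add_zero]
    have h0 : (insert s l.toFinset).filter (· < s) = ∅ := by
      refine Finset.filter_eq_empty_iff.2 fun u hu => ?_
      rcases Finset.mem_insert.1 hu with rfl | hu
      · exact lt_irrefl _
      · exact (hs u (List.mem_toFinset.1 hu)).asymm
    have h1 : (l.map fun u => v u ^ ((α - Pi.single s 1 : S → ℕ) u)) = l.map fun u => v u ^ α u := by
      refine List.map_congr_left fun u hu => ?_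
      have : u ≠ s := fun h => hsl (h ▸ List.mem_toFinset.2 hu)
      simp [this]
    rw [h0, h1, Finset.sum_empty, mul_zero, pow_zero, one_mul]
    -- Moving `δ t` to the left of `v s ^ α s` produces exactly the sign contributed by the new
    -- index s < t to the inner sum.
    have h3 : (v s ^ α s * ∑ t ∈ l.toFinset,
        ((-1 : ℝ) ^ ((Parity.par t : ZMod 2).val *
        ∑ u ∈ l.toFinset.filter (· < t), (Parity.par u : ZMod 2).val * α u) * α t) •
          (δ t * (l.map fun s => v s ^ ((α - Pi.single t 1 : S → ℕ) s)).prod)) =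
        ∑ t ∈ l.toFinset, ((-1 : ℝ) ^ ((Parity.par t : ZMod 2).val *
        ∑ u ∈ (insert s l.toFinset).filter (· < t), (Parity.par u : ZMod 2).val * α u) * α t) •
          (δ t * (v s ^ ((α - Pi.single t 1 : S → ℕ) s) *
            (l.map fun s => v s ^ ((α - Pi.single t 1 : S → ℕ) s)).prod)) := by
      rw [Finset.mul_sum]
      refine Finset.sum_congr rfl fun t ht => ?_
      have hst : s < t := hs t (List.mem_toFinset.1 ht)
      have hf : (insert s l.toFinset).filter (· < t) =
          insert s (l.toFinset.filter (· < t)) := by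
        rw [Finset.filter_insert, if_pos hst]
      have hs' : s ∉ l.toFinset.filter (· < t) := fun h => hsl (Finset.mem_filter.1 h).1
      rw [hf, Finset.sum_insert hs']
      have e : (α - Pi.single t 1 : S → ℕ) s = α s := by simp [hst.ne]
      rw [e, mul_smul_comm, ← mul_assoc, pow_mul_comm_sign (hv s) (hδ t) (α s), smul_mul_assoc,
        smul_smul, mul_assoc]
      congr 1
      · rw [mul_add, pow_add]
        ring
      · rw [mul_assoc]
    rw [h3]
    simp only [Pi.sub_apply, Pi.single_eq_same, smul_mul_assoc, mul_assoc]
    abel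

theorem mono_add {I : Submodule ℝ B} (hI : TwoSided I) (h2 : ∀ a ∈ I, ∀ b ∈ I, a * b = 0)
    {v δ : S → B} (hv : ∀ s, v s ∈ B.gr (Parity.par s))
    (hδ : ∀ s, δ s ∈ B.gr (Parity.par s)) (hδI : ∀ s, δ s ∈ I) (α : S → ℕ)
    (hα : ∀ s, Parity.par s = (1 : ZMod 2) → α s ≤ 1) :
    mono (fun s => v s + δ s) α = mono v α +
      ∑ t, ((-1 : ℝ) ^ ((Parity.par t : ZMod 2).val *
        ∑ u ∈ Finset.univ.filter (· < t), (Parity.par u : ZMod 2).val * α u) * α t) •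
          (δ t * mono v (α - Pi.single t 1)) := by
  have h := prod_add_expand hI h2 hv hδ hδI α hα (Finset.univ.sort (· ≤ ·))
    (Finset.sortedLT_sort _).pairwise
  rw [Finset.sort_toFinset] at h
  exact h

/-! ## Congruences -/

theorem TwoSided.pow_sub {K : Submodule ℝ B} (hK : TwoSided K) {a b : B} (h : a - b ∈ K) (k : ℕ) :
    a ^ k - b ^ k ∈ K := by
  induction k with
  | zero => simp
  | succ k ih =>
    have : a ^ (k + 1) - b ^ (k + 1) = a ^ k * (a - b) + (a ^ k - b ^ k) * b := by
      rw [pow_succ, pow_succ]; noncomm_ring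
    rw [this]
    exact K.add_mem (hK _ _ h).1 (hK _ _ ih).2

theorem TwoSided.prod_sub {K : Submodule ℝ B} (hK : TwoSided K) {ι : Type} (f g : ι → B)
    (l : List ι) (h : ∀ i ∈ l, f i - g i ∈ K) : (l.map f).prod - (l.map g).prod ∈ K := by
  induction l with
  | nil => simp
  | cons i l ih =>
    simp only [List.map_cons, List.prod_cons]
    have : f i * (l.map f).prod - g i * (l.map g).prod =
        (f i - g i) * (l.map f).prod + g i * ((l.map f).prod - (l.map g).prod) := by noncomm_ring
    rw [this]
    exact K.add_mem (hK _ _ (h i (by simp))).2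
      (hK _ _ (ih fun j hj => h j (by simp [hj]))).1

theorem TwoSided.prod_mem {K : Submodule ℝ B} (hK : TwoSided K) {ι : Type} (f : ι → B)
    (l : List ι) (h : ∃ i ∈ l, f i ∈ K) : (l.map f).prod ∈ K := by
  induction l with
  | nil => simp at h
  | cons i l ih =>
    rw [List.map_cons, List.prod_cons]
    obtain ⟨j, hj, hjK⟩ := h
    rcases List.mem_cons.1 hj with rfl | hj
    · exact (hK _ _ hjK).2
    · exact (hK _ _ (ih ⟨j, hj, hjK⟩)).1

/-- A product with a factor from `J` is insensitive modulo `K'` to changes modulo `K`, if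
`J K` and `K J` lie in `K'`. -/
theorem prod_sub_mem_of_factor {J K K' : Submodule ℝ B} (hJ : TwoSided J) (hK : TwoSided K)
    (hK' : TwoSided K') (hJK : ∀ a ∈ J, ∀ b ∈ K, a * b ∈ K' ∧ b * a ∈ K') {ι : Type} (f g : ι → B)
    (l : List ι) (h : ∀ i ∈ l, f i - g i ∈ K)
    (hex : ∃ i ∈ l, f i ∈ J ∧ g i ∈ J ∧ f i - g i ∈ K') :
    (l.map f).prod - (l.map g).prod ∈ K' := by
  induction l with
  | nil => simp at hex
  | cons i l ih =>
    simp only [List.map_cons, List.prod_cons]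
    have : f i * (l.map f).prod - g i * (l.map g).prod =
        (f i - g i) * (l.map f).prod + g i * ((l.map f).prod - (l.map g).prod) := by noncomm_ring
    rw [this]
    obtain ⟨j, hj, hfj, hgj, hd⟩ := hex
    rcases List.mem_cons.1 hj with rfl | hj
    · exact K'.add_mem (hK' _ _ hd).2
        (hJK _ hgj _ (hK.prod_sub f g l fun k hk => h k (by simp [hk]))).1
    · exact K'.add_mem
        (hJK _ (hJ.prod_mem f l ⟨j, hj, hfj⟩) _ (h i (by simp))).2
        (hK' _ _ (ih (fun k hk => h k (by simp [hk])) ⟨j, hj, hfj, hgj, hd⟩)).1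

/-- Equal bodies give the same Taylor coefficients, so only the products of nilpotent parts have to
be compared. -/
theorem evalSmooth_sub_mem {K : Submodule ℝ B} (hK : TwoSided K) {n : ℕ} (f : (Fin n → ℝ) → ℝ)
    {x y : Fin n → B} (haug : ∀ a, B.aug (x a) = B.aug (y a)) (h : ∀ a, x a - y a ∈ K) :
    evalSmooth B f x - evalSmooth B f y ∈ K := by
  unfold evalSmooth
  rw [← Finset.sum_sub_distrib]
  refine K.sum_mem fun k _ => ?_
  rw [← Finset.sum_sub_distrib]
  refine K.sum_mem fun t _ => ?_
  simp only [haug]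
  rw [← smul_sub]
  refine K.smul_mem _ ?_
  have := hK.prod_sub (fun j => x (t j) - algebraMap ℝ B (B.aug (y (t j))))
    (fun j => y (t j) - algebraMap ℝ B (B.aug (y (t j)))) (List.finRange k)
    (fun j _ => by rw [sub_sub_sub_cancel_right]; exact h _)
  rwa [← List.ofFn_eq_map, ← List.ofFn_eq_map] at this

end Monomials

/-! ## Evaluation of coefficient families -/

section EvalV

variable {S : Type} [Fintype S] [LinearOrder S] [Parity S] {n : ℕ} {B : SuperWeil}

/-- Value of a coefficient family at even coordinates `e` and formal variables `v`. -/
def evalV (F : (S → ℕ) → (Fin n → ℝ) → ℝ) (e : Fin n → B) (v : S → B) : B :=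
  ∑ α ∈ Fintype.piFinset (fun _ : S => Finset.range B.order), evalSmooth B (F α) e * mono v α

/-- The coefficients are smooth on `U`, and no monomial contains the square of an odd variable. -/
def SmoothCoef (U : Set (Fin n → ℝ)) (F : (S → ℕ) → (Fin n → ℝ) → ℝ) : Prop :=
  (∀ α, ContDiffOn ℝ ∞ (F α) U) ∧
    ∀ α s, Parity.par s = (1 : ZMod 2) → 2 ≤ α s → ∀ x ∈ U, F α x = 0

theorem SmoothCoef.contDiffAt {U : Set (Fin n → ℝ)} (hU : IsOpen U)
    {F : (S → ℕ) → (Fin n → ℝ) → ℝ} (hF : SmoothCoef U F) (α : S → ℕ) {x : Fin n → ℝ}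
    (hx : x ∈ U) : ContDiffAt ℝ ∞ (F α) x :=
  (hF.1 α).contDiffAt (hU.mem_nhds hx)

theorem evalSmooth_zero (e : Fin n → B) : evalSmooth B (fun _ => 0) e = 0 := by
  unfold evalSmooth
  refine Finset.sum_eq_zero fun k _ => Finset.sum_eq_zero fun t _ => ?_
  have : iteratedFDeriv ℝ k (fun _ : Fin n → ℝ => (0 : ℝ)) = 0 := iteratedFDeriv_fun_zero
  rw [this]
  simp

theorem evalSmooth_eq_zero_of_eqOn {U : Set (Fin n → ℝ)} (hU : IsOpen U) {f : (Fin n → ℝ) → ℝ}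
    (hf : ∀ x ∈ U, f x = 0) (e : Fin n → B) (he : (fun a => B.aug (e a)) ∈ U) :
    evalSmooth B f e = 0 := by
  rw [evalSmooth_congr e (g := fun _ => 0)
    (Filter.eventually_of_mem (hU.mem_nhds he) hf), evalSmooth_zero]

/-- Monomials of total degree at least `B.order` vanish, so the range of summation may be any finite
set that contains the exponents of smaller degree. This freedom serves whenever exponents are
shifted or algebras of different order are compared. -/
theorem evalV_eq_sum (F : (S → ℕ) → (Fin n → ℝ) → ℝ) (e : Fin n → B) {v : S → B}
    (hv : ∀ s, B.aug (v s) = 0) (A : Finset (S → ℕ))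
    (hA : ∀ α : S → ℕ, ∑ s, α s < B.order → α ∈ A) :
    evalV F e v = ∑ α ∈ A, evalSmooth B (F α) e * mono v α := by
  classical
  have key : ∀ C : Finset (S → ℕ), (∀ α : S → ℕ, ∑ s, α s < B.order → α ∈ C) → ∀ D, C ⊆ D →
      ∑ α ∈ C, evalSmooth B (F α) e * mono v α = ∑ α ∈ D, evalSmooth B (F α) e * mono v α := by
    intro C hC D hD
    refine Finset.sum_subset hD fun α _ hα => ?_
    rw [mono_eq_zero hv, mul_zero]
    by_contra h
    exact hα (hC α (not_le.1 h))
  unfold evalV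
  rw [key _ _ _ (Finset.subset_union_left (s₂ := A)), key A hA _ Finset.subset_union_right]
  intro α hα
  refine Fintype.mem_piFinset.2 fun s => Finset.mem_range.2 (lt_of_le_of_lt ?_ hα)
  exact Finset.single_le_sum (f := α) (fun _ _ => Nat.zero_le _) (Finset.mem_univ s)

/-- The exponents below `N` in every variable. -/
def box (S : Type) [Fintype S] [LinearOrder S] (N : ℕ) : Finset (S → ℕ) :=
  Fintype.piFinset fun _ : S => Finset.range N

theorem mem_box {N : ℕ} {α : S → ℕ} : α ∈ box S N ↔ ∀ s, α s < N := by
  simp [box]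

theorem mem_box_of_sum_lt {N : ℕ} {α : S → ℕ} (h : ∑ s, α s < N) : α ∈ box S N :=
  mem_box.2 fun s => lt_of_le_of_lt
    (Finset.single_le_sum (f := α) (fun _ _ => Nat.zero_le _) (Finset.mem_univ s)) h

theorem evalV_eq_sum_box (F : (S → ℕ) → (Fin n → ℝ) → ℝ) (e : Fin n → B) {v : S → B}
    (hv : ∀ s, B.aug (v s) = 0) {N : ℕ} (hN : B.order ≤ N) :
    evalV F e v = ∑ α ∈ box S N, evalSmooth B (F α) e * mono v α :=
  evalV_eq_sum F e hv _ fun _ h => mem_box_of_sum_lt (h.trans_le hN)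

theorem evalV_congr {U : Set (Fin n → ℝ)} (hU : IsOpen U) {F G : (S → ℕ) → (Fin n → ℝ) → ℝ}
    (e : Fin n → B) (he : (fun a => B.aug (e a)) ∈ U) {v : S → B} (hv : ∀ s, B.aug (v s) = 0)
    (h : ∀ α, ∑ s, α s < B.order → ∀ x ∈ U, F α x = G α x) : evalV F e v = evalV G e v := by
  refine Finset.sum_congr rfl fun α _ => ?_
  by_cases hα : ∑ s, α s < B.order
  · rw [evalSmooth_congr e (Filter.eventually_of_mem (hU.mem_nhds he) (h α hα))]
  · rw [mono_eq_zero hv (not_lt.1 hα), mul_zero, mul_zero]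

theorem aug_mono {v : S → B} (hv : ∀ s, B.aug (v s) = 0) (α : S → ℕ) :
    B.aug (mono v α) = if α = 0 then 1 else 0 := by
  split_ifs with h
  · rw [h, mono_zero, map_one]
  · obtain ⟨s, hs⟩ := Function.ne_iff.1 h
    unfold mono
    rw [map_list_prod]
    refine List.prod_eq_zero (List.mem_map.2 ⟨v s ^ α s, List.mem_map.2 ⟨s, by simp, rfl⟩, ?_⟩)
    rw [map_pow, hv, zero_pow hs]

theorem aug_evalV (F : (S → ℕ) → (Fin n → ℝ) → ℝ) (e : Fin n → B) {v : S → B}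
    (hv : ∀ s, B.aug (v s) = 0) : B.aug (evalV F e v) = F 0 fun a => B.aug (e a) := by
  unfold evalV
  rw [map_sum, Finset.sum_eq_single 0]
  · rw [map_mul, mono_zero, map_one, mul_one, aug_evalSmooth]
  · intro α _ h
    rw [map_mul, aug_mono hv, if_neg h, mul_zero]
  · intro h
    exact absurd (Fintype.mem_piFinset.2 fun _ => Finset.mem_range.2 B.one_le_order) h

theorem evalV_mem {U : Set (Fin n → ℝ)} (hU : IsOpen U) {p : ZMod 2}
    {F : (S → ℕ) → (Fin n → ℝ) → ℝ}
    (hF : ∀ α, ∀ x ∈ U, F α x ≠ 0 → ∑ s, (α s : ZMod 2) * Parity.par s = p)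
    {e : Fin n → B} (he : ∀ a, e a ∈ B.gr 0) (heU : (fun a => B.aug (e a)) ∈ U) {v : S → B}
    (hv : ∀ s, v s ∈ B.gr (Parity.par s)) : evalV F e v ∈ B.gr p := by
  refine Submodule.sum_mem _ fun α _ => ?_
  by_cases h : ∀ x ∈ U, F α x = 0
  · rw [evalSmooth_eq_zero_of_eqOn hU h e heU, zero_mul]
    exact Submodule.zero_mem _
  · push Not at h
    obtain ⟨x, hx, hne⟩ := h
    rw [← hF α x hx hne]
    exact B.mul_mem_even (evalSmooth_mem _ _ he) (mono_mem hv α)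

/-- Left derivative of a coefficient family with respect to a formal variable. -/
def dFormal (s : S) (F : (S → ℕ) → (Fin n → ℝ) → ℝ) : (S → ℕ) → (Fin n → ℝ) → ℝ := fun α x =>
  (-1) ^ ((Parity.par s : ZMod 2).val *
      ∑ t ∈ Finset.univ.filter (· < s), (Parity.par t : ZMod 2).val * α t) *
    ((α s : ℝ) + 1) * F (α + Pi.single s 1) x

/-- Derivative of a coefficient family with respect to an even coordinate. -/
def dEven (a : Fin n) (F : (S → ℕ) → (Fin n → ℝ) → ℝ) : (S → ℕ) → (Fin n → ℝ) → ℝ := fun α x =>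
  fderiv ℝ (F α) x (Pi.single a 1)

theorem SmoothCoef.dFormal {U : Set (Fin n → ℝ)} {F : (S → ℕ) → (Fin n → ℝ) → ℝ}
    (hF : SmoothCoef U F) (s : S) : SmoothCoef U (dFormal s F) := by
  refine ⟨fun α => contDiffOn_const.mul (hF.1 _), fun α t ht h2 x hx => ?_⟩
  have : F (α + Pi.single s 1) x = 0 := hF.2 _ t ht (h2.trans (by simp)) x hx
  simp [Microformal.dFormal, this]

theorem SmoothCoef.dEven {U : Set (Fin n → ℝ)} (hU : IsOpen U)
    {F : (S → ℕ) → (Fin n → ℝ) → ℝ} (hF : SmoothCoef U F) (a : Fin n) :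
    SmoothCoef U (dEven a F) := by
  refine ⟨fun α => ?_, fun α t ht h2 x hx => ?_⟩
  · exact (((hF.1 α).fderiv_of_isOpen hU (m := ∞) (by exact_mod_cast le_rfl)).clm_apply
      contDiffOn_const)
  · have h0 : F α =ᶠ[𝓝 x] fun _ => 0 :=
      Filter.eventually_of_mem (hU.mem_nhds hx) fun y hy => hF.2 α t ht h2 y hy
    change fderiv ℝ (F α) x (Pi.single a 1) = 0
    rw [h0.fderiv_eq]
    simp

theorem evalSmooth_expand {I : Submodule ℝ B}
    (h2 : ∀ a ∈ I, ∀ b ∈ I, a * b = 0) {f : (Fin n → ℝ) → ℝ} {e δ : Fin n → B}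
    (he : ∀ a, e a ∈ B.gr 0) (hδ : ∀ a, δ a ∈ B.gr 0) (hδI : ∀ a, δ a ∈ I)
    (hf : ContDiffAt ℝ ∞ f fun a => B.aug (e a)) :
    evalSmooth B f (fun a => e a + δ a) = evalSmooth B f e +
      ∑ a, δ a * evalSmooth B (fun x => fderiv ℝ f x (Pi.single a 1)) e := by
  have hδ0 : ∀ a, B.aug (δ a) = 0 := fun a => by
    have := congrArg B.aug (h2 _ (hδI a) _ (hδI a))
    rw [map_mul, map_zero] at this
    exact mul_self_eq_zero.1 this
  -- The truncation `B.order + 2` always leaves two terms to split off, even if the order is 1. The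
  -- remaining terms contain a product of two increments.
  rw [evalSmooth_add_nil e δ he hδ hδ0 hf (N := B.order + 2) (by omega), Finset.sum_range_succ',
    Finset.sum_range_succ', Finset.sum_eq_zero, zero_add, add_comm]
  · congr 1
    · simp
    · rw [← (Equiv.funUnique (Fin 1) (Fin n)).symm.sum_comp]
      refine Finset.sum_congr rfl fun a _ => ?_
      simp [B.even_comm (hδ a)]
  · intro k _
    refine Finset.sum_eq_zero fun t _ => ?_
    have : (List.ofFn fun j : Fin (k + 1 + 1) => δ (t j)).prod = 0 := by
      rw [List.ofFn_succ, List.ofFn_succ, List.prod_cons, List.prod_cons, ← mul_assoc,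
        h2 _ (hδI _) _ (hδI _), zero_mul]
    rw [this, mul_zero, smul_zero]

/-- The reindexing is α ↦ α - e_t on the exponents with `α t ≠ 0`. The box must be strictly larger
than `B.order`, so that every exponent of degree below the order is such a shift. The result has the
form of the derivative terms in `mono_add`. -/
theorem evalV_dFormal_sum {U : Set (Fin n → ℝ)} (hU : IsOpen U)
    {F : (S → ℕ) → (Fin n → ℝ) → ℝ} (hF : SmoothCoef U F) {e : Fin n → B}
    (he : ∀ a, e a ∈ B.gr 0) (heU : (fun a => B.aug (e a)) ∈ U) {v : S → B}
    (hv : ∀ s, B.aug (v s) = 0) (t : S) {N : ℕ} (hN : B.order < N) :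
    evalV (dFormal t F) e v = ∑ α ∈ box S N, evalSmooth B (F α) e *
      (((-1 : ℝ) ^ ((Parity.par t : ZMod 2).val *
        ∑ u ∈ Finset.univ.filter (· < t), (Parity.par u : ZMod 2).val * α u) * α t) •
          mono v (α - Pi.single t 1)) := by
  classical
  have hinj : Set.InjOn (fun α : S → ℕ => α - Pi.single t 1)
      ((box S N).filter fun α => α t ≠ 0) := by
    intro α hα β hβ h
    simp only [Finset.coe_filter, Set.mem_ofPred_eq] at hα hβ
    funext s
    have hs := congrFun h s
    simp only [Pi.sub_apply, Pi.single_apply] at hs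
    by_cases hst : s = t
    · subst hst
      simp only [if_true] at hs
      omega
    · simpa [hst] using hs
  rw [evalV_eq_sum _ e hv
    (((box S N).filter fun α => α t ≠ 0).image fun α => α - Pi.single t 1), Finset.sum_image hinj]
  · rw [← Finset.sum_filter_add_sum_filter_not (box S N) (fun α => α t ≠ 0)]
    rw [Finset.sum_eq_zero (s := (box S N).filter fun α => ¬ α t ≠ 0), add_zero]
    · refine Finset.sum_congr rfl fun α hα => ?_
      have hα0 := (Finset.mem_filter.1 hα).2
      have e1 : (α - Pi.single t 1 + Pi.single t 1 : S → ℕ) = α := by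
        funext s
        by_cases hst : s = t
        · subst hst
          simp only [Pi.add_apply, Pi.sub_apply, Pi.single_eq_same]
          omega
        · simp [hst]
      have e2 : ∑ u ∈ Finset.univ.filter (· < t), (Parity.par u : ZMod 2).val *
          (α - Pi.single t 1 : S → ℕ) u =
          ∑ u ∈ Finset.univ.filter (· < t), (Parity.par u : ZMod 2).val * α u := by
        refine Finset.sum_congr rfl fun u hu => ?_
        have : u ≠ t := (Finset.mem_filter.1 hu).2.ne
        simp [this]
      have e3 : (((α - Pi.single t 1 : S → ℕ) t : ℕ) : ℝ) + 1 = α t := by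
        have : (α - Pi.single t 1 : S → ℕ) t + 1 = α t := by
          simp only [Pi.sub_apply, Pi.single_eq_same]
          omega
        exact_mod_cast this
      unfold dFormal
      rw [e1, e2, e3, evalSmooth_smul _ e he (hF.contDiffAt hU α heU), smul_mul_assoc,
        mul_smul_comm]
    · intro α hα
      have h0 : α t = 0 := by simpa using (Finset.mem_filter.1 hα).2
      rw [h0, Nat.cast_zero, mul_zero, zero_smul, mul_zero]
  · intro α hα
    refine Finset.mem_image.2 ⟨α + Pi.single t 1, Finset.mem_filter.2 ⟨?_, by simp⟩, ?_⟩
    · refine mem_box_of_sum_lt ?_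
      simp only [Pi.add_apply, Finset.sum_add_distrib]
      rw [Finset.sum_pi_single']
      simp
      omega
    · funext s
      simp

/-- First-order Taylor expansion. -/
theorem evalV_expand {U : Set (Fin n → ℝ)} (hU : IsOpen U)
    {F : (S → ℕ) → (Fin n → ℝ) → ℝ} (hF : SmoothCoef U F) {I : Submodule ℝ B} (hI : TwoSided I)
    (h2 : ∀ a ∈ I, ∀ b ∈ I, a * b = 0) {e δe : Fin n → B} {v δ : S → B}
    (he : ∀ a, e a ∈ B.gr 0) (heU : (fun a => B.aug (e a)) ∈ U) (hδe : ∀ a, δe a ∈ B.gr 0)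
    (hδeI : ∀ a, δe a ∈ I) (hv : B.IsFormal v) (hδ : ∀ s, δ s ∈ B.gr (Parity.par s))
    (hδI : ∀ s, δ s ∈ I) :
    evalV F (fun a => e a + δe a) (fun s => v s + δ s) = evalV F e v +
      ∑ a, δe a * evalV (dEven a F) e v + ∑ s, δ s * evalV (dFormal s F) e v := by
  have haug : ∀ b ∈ I, B.aug b = 0 := fun b hb => by
    have := congrArg B.aug (h2 _ hb _ hb)
    rw [map_mul, map_zero] at this
    exact mul_self_eq_zero.1 this
  have hv0 : ∀ s, B.aug (v s) = 0 := fun s => (hv s).2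
  have hv' : ∀ s, B.aug (v s + δ s) = 0 := fun s => by
    rw [map_add, hv0, haug _ (hδI s), add_zero]
  have hN : B.order ≤ B.order + 1 := by omega
  rw [evalV_eq_sum_box F _ hv' hN, evalV_eq_sum_box F e hv0 hN]
  simp only [evalV_dFormal_sum hU hF he heU hv0 _ (Nat.lt_succ_self B.order),
    evalV_eq_sum_box _ e hv0 hN]
  have hterm : ∀ α, evalSmooth B (F α) (fun a => e a + δe a) * mono (fun s => v s + δ s) α =
      evalSmooth B (F α) e * mono v α +
      ∑ a, δe a * (evalSmooth B (dEven a F α) e * mono v α) +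
      ∑ t, δ t * (evalSmooth B (F α) e * (((-1 : ℝ) ^ ((Parity.par t : ZMod 2).val *
        ∑ u ∈ Finset.univ.filter (· < t), (Parity.par u : ZMod 2).val * α u) * α t) •
          mono v (α - Pi.single t 1))) := by
    intro α
    -- `mono_add` applies only if odd variables occur at most once. For all other exponents the
    -- coefficient vanishes on U, together with its derivatives, and every term is zero.
    by_cases hα : ∀ s, Parity.par s = (1 : ZMod 2) → α s ≤ 1
    · rw [evalSmooth_expand h2 he hδe hδeI (hF.contDiffAt hU α heU),
        mono_add hI h2 (fun s => (hv s).1) hδ hδI α hα, add_mul, mul_add, mul_add]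
      have hz : (∑ a, δe a * evalSmooth B (fun x => fderiv ℝ (F α) x (Pi.single a 1)) e) *
          (∑ t, ((-1 : ℝ) ^ ((Parity.par t : ZMod 2).val *
            ∑ u ∈ Finset.univ.filter (· < t), (Parity.par u : ZMod 2).val * α u) * α t) •
              (δ t * mono v (α - Pi.single t 1))) = 0 := by
        apply h2
        · exact I.sum_mem fun a _ => (hI _ _ (hδeI a)).2
        · exact I.sum_mem fun t _ => I.smul_mem _ (hI _ _ (hδI t)).2
      rw [hz, add_zero, Finset.sum_mul, Finset.mul_sum]
      have e1 : ∑ a, δe a * evalSmooth B (fun x => fderiv ℝ (F α) x (Pi.single a 1)) e * mono v α =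
          ∑ a, δe a * (evalSmooth B (dEven a F α) e * mono v α) :=
        Finset.sum_congr rfl fun a _ => mul_assoc _ _ _
      rw [e1]
      have e2 : ∑ t, evalSmooth B (F α) e * (((-1 : ℝ) ^ ((Parity.par t : ZMod 2).val *
        ∑ u ∈ Finset.univ.filter (· < t), (Parity.par u : ZMod 2).val * α u) * α t) •
          (δ t * mono v (α - Pi.single t 1))) =
          ∑ t, δ t * (evalSmooth B (F α) e * (((-1 : ℝ) ^ ((Parity.par t : ZMod 2).val *
        ∑ u ∈ Finset.univ.filter (· < t), (Parity.par u : ZMod 2).val * α u) * α t) •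
          mono v (α - Pi.single t 1))) := by
        refine Finset.sum_congr rfl fun t _ => ?_
        rw [mul_smul_comm, mul_smul_comm, mul_smul_comm, ← mul_assoc,
          B.even_comm (evalSmooth_mem _ _ he) (δ t), mul_assoc]
      rw [e2]
      abel
    · push Not at hα
      obtain ⟨s, hs, h1⟩ := hα
      have hz : ∀ x ∈ U, F α x = 0 := hF.2 α s hs h1
      have hz' : ∀ a, ∀ x ∈ U, dEven a F α x = 0 := fun a => (hF.dEven hU a).2 α s hs h1
      have heU' : (fun a => B.aug (e a + δe a)) ∈ U := by
        have : (fun a => B.aug (e a + δe a)) = fun a => B.aug (e a) := by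
          funext a
          rw [map_add, haug _ (hδeI a), add_zero]
        rwa [this]
      rw [evalSmooth_eq_zero_of_eqOn hU hz _ heU, evalSmooth_eq_zero_of_eqOn hU hz _ heU']
      simp only [fun a => evalSmooth_eq_zero_of_eqOn hU (hz' a) _ heU, zero_mul, mul_zero,
        Finset.sum_const_zero, add_zero]
  simp only [hterm, Finset.sum_add_distrib, Finset.mul_sum]
  rw [Finset.sum_comm (s := box S (B.order + 1)), Finset.sum_comm (s := box S (B.order + 1))]

/-! ## Congruences for values -/

theorem evalV_sub_mem {K : Submodule ℝ B} (hK : TwoSided K)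
    (F : (S → ℕ) → (Fin n → ℝ) → ℝ) {e e' : Fin n → B} {v v' : S → B}
    (haug : ∀ a, B.aug (e a) = B.aug (e' a)) (he : ∀ a, e a - e' a ∈ K)
    (hv : ∀ s, v s - v' s ∈ K) : evalV F e v - evalV F e' v' ∈ K := by
  unfold evalV
  rw [← Finset.sum_sub_distrib]
  refine K.sum_mem fun α _ => ?_
  have : evalSmooth B (F α) e * mono v α - evalSmooth B (F α) e' * mono v' α =
      (evalSmooth B (F α) e - evalSmooth B (F α) e') * mono v α +
        evalSmooth B (F α) e' * (mono v α - mono v' α) := by noncomm_ring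
  rw [this]
  refine K.add_mem (hK _ _ (evalSmooth_sub_mem hK _ haug he)).2 (hK _ _ ?_).1
  exact hK.prod_sub _ _ _ fun s _ => hK.pow_sub (hv s) _

/-- If every monomial of `F` contains a variable from `Z`, and the values of these variables lie
in `J`, then the values of `F` are insensitive modulo `K'` to changes modulo `K`. -/
theorem evalV_sub_mem_of_formal {U : Set (Fin n → ℝ)} (hU : IsOpen U) {J K K' : Submodule ℝ B}
    (hJ : TwoSided J) (hK : TwoSided K) (hK' : TwoSided K')
    (hJK : ∀ a ∈ J, ∀ b ∈ K, a * b ∈ K' ∧ b * a ∈ K')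
    {F : (S → ℕ) → (Fin n → ℝ) → ℝ} {Z : S → Prop}
    (hF : ∀ α, (∀ s, Z s → α s = 0) → ∀ x ∈ U, F α x = 0)
    {e e' : Fin n → B} {v v' : S → B} (heU : (fun a => B.aug (e a)) ∈ U)
    (haug : ∀ a, B.aug (e a) = B.aug (e' a)) (he : ∀ a, e a - e' a ∈ K)
    (hv : ∀ s, v s - v' s ∈ K) (hZ : ∀ s, Z s → v s ∈ J ∧ v' s ∈ J ∧ v s - v' s ∈ K') :
    evalV F e v - evalV F e' v' ∈ K' := by
  unfold evalV
  rw [← Finset.sum_sub_distrib]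
  refine K'.sum_mem fun α _ => ?_
  have heU' : (fun a => B.aug (e' a)) ∈ U := by simpa only [haug] using heU
  by_cases hα : ∀ s, Z s → α s = 0
  · rw [evalSmooth_eq_zero_of_eqOn hU (hF α hα) _ heU,
      evalSmooth_eq_zero_of_eqOn hU (hF α hα) _ heU', zero_mul, zero_mul, sub_zero]
    exact K'.zero_mem
  · push Not at hα
    obtain ⟨s, hs, hne⟩ := hα
    obtain ⟨h1, h2, h3⟩ := hZ s hs
    have hpow : ∀ {b : B}, b ∈ J → b ^ α s ∈ J := by
      intro b hb
      obtain ⟨k, hk⟩ := Nat.exists_eq_succ_of_ne_zero hne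
      rw [hk, pow_succ]
      exact (hJ _ _ hb).1
    have hmem : s ∈ (Finset.univ.sort (· ≤ ·) : List S) := by simp
    have hd : mono v α - mono v' α ∈ K' :=
      prod_sub_mem_of_factor hJ hK hK' hJK _ _ _ (fun t _ => hK.pow_sub (hv t) _)
        ⟨s, hmem, hpow h1, hpow h2, hK'.pow_sub h3 _⟩
    have hm : mono v α ∈ J := hJ.prod_mem _ _ ⟨s, hmem, hpow h1⟩
    have : evalSmooth B (F α) e * mono v α - evalSmooth B (F α) e' * mono v' α =
        (evalSmooth B (F α) e - evalSmooth B (F α) e') * mono v α +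
          evalSmooth B (F α) e' * (mono v α - mono v' α) := by noncomm_ring
    rw [this]
    exact K'.add_mem (hJK _ hm _ (evalSmooth_sub_mem hK _ haug he)).2 (hK' _ _ hd).1

/-- If every monomial of `F` contains a variable from `Z`, and the values of these variables lie
in `J`, then the values of `F` lie in `J`. -/
theorem evalV_mem_of_formal {U : Set (Fin n → ℝ)} (hU : IsOpen U) {J : Submodule ℝ B}
    (hJ : TwoSided J) {F : (S → ℕ) → (Fin n → ℝ) → ℝ} {Z : S → Prop}
    (hF : ∀ α, (∀ s, Z s → α s = 0) → ∀ x ∈ U, F α x = 0)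
    {e : Fin n → B} {v : S → B} (heU : (fun a => B.aug (e a)) ∈ U)
    (hZ : ∀ s, Z s → v s ∈ J) : evalV F e v ∈ J := by
  refine J.sum_mem fun α _ => ?_
  by_cases hα : ∀ s, Z s → α s = 0
  · rw [evalSmooth_eq_zero_of_eqOn hU (hF α hα) _ heU, zero_mul]
    exact J.zero_mem
  · push Not at hα
    obtain ⟨s, hs, hne⟩ := hα
    obtain ⟨k, hk⟩ := Nat.exists_eq_succ_of_ne_zero hne
    refine (hJ _ _ (hJ.prod_mem _ _ ⟨s, by simp, ?_⟩)).1
    rw [hk, pow_succ]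
    exact (hJ _ _ (hZ s hs)).1

/-! ## Naturality -/

/-- The two algebras may have different orders. Truncating both Taylor sums at the larger one makes
them agree term by term. -/
theorem evalSmooth_map {B' : SuperWeil} (φ : B →ₐ[ℝ] B') (hφ : ∀ b, B'.aug (φ b) = B.aug b)
    (f : (Fin n → ℝ) → ℝ) (e : Fin n → B) :
    φ (evalSmooth B f e) = evalSmooth B' f fun a => φ (e a) := by
  rw [evalSmooth_eq_sum_of_le f e (le_max_left B.order B'.order),
    evalSmooth_eq_sum_of_le f _ (le_max_right B.order B'.order)]
  simp only [map_sum, map_smul, hφ, map_list_prod, List.map_ofFn, Function.comp_def, map_sub,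
    AlgHom.commutes]

theorem evalV_map {B' : SuperWeil} (φ : B →ₐ[ℝ] B') (hφ : ∀ b, B'.aug (φ b) = B.aug b)
    (F : (S → ℕ) → (Fin n → ℝ) → ℝ) (e : Fin n → B) {v : S → B} (hv : ∀ s, B.aug (v s) = 0) :
    φ (evalV F e v) = evalV F (fun a => φ (e a)) fun s => φ (v s) := by
  rw [evalV_eq_sum_box F e hv (le_max_left B.order B'.order),
    evalV_eq_sum_box F _ (fun s => (hφ _).trans (hv s)) (le_max_right B.order B'.order)]
  simp only [map_sum, map_mul, evalSmooth_map φ hφ, mono, map_list_prod, List.map_map,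
    Function.comp_def, map_pow]

end EvalV

/-! ## Test algebras -/

/-- A `ZMod 2`-grading given by projections. -/
@[reducible]
def gradedOfProj {A : Type} [Ring A] [Algebra ℝ A] (G : ZMod 2 → Submodule ℝ A)
    (hone : (1 : A) ∈ G 0) (hmul : ∀ i j (a b : A), a ∈ G i → b ∈ G j → a * b ∈ G (i + j))
    (π : ZMod 2 → A → A) (hπ : ∀ i a, π i a ∈ G i) (hsum : ∀ a, π 0 a + π 1 a = a)
    (hid : ∀ i, ∀ a ∈ G i, π i a = a) (hz : ∀ i j, i ≠ j → ∀ a ∈ G i, π j a = 0)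
    (hadd : ∀ i a b, π i (a + b) = π i a + π i b) :
    GradedAlgebra G where
  one_mem := hone
  mul_mem {i j a b} ha hb := hmul i j a b ha hb
  decompose' a := ∑ i, DirectSum.of (fun i => G i) i ⟨π i a, hπ i a⟩
  left_inv a := by
    rw [map_sum]
    simp only [DirectSum.coeAddMonoidHom_of]
    exact (Fin.sum_univ_two (fun i : Fin 2 => π (i : ZMod 2) a)).trans (hsum a)
  right_inv x := by
    induction x using DirectSum.induction_on with
    | zero =>
      refine Finset.sum_eq_zero fun i _ => ?_
      have : (⟨π i (DirectSum.coeAddMonoidHom G 0), hπ i _⟩ : G i) = 0 := by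
        apply Subtype.ext
        have h := hadd i 0 0
        rw [add_zero] at h
        rw [map_zero]
        exact left_eq_add.1 h
      rw [this, map_zero]
    | of i y =>
      dsimp only
      rw [Finset.sum_eq_single i]
      · congr 1
        apply Subtype.ext
        rw [DirectSum.coeAddMonoidHom_of]
        exact hid i _ y.2
      · intro j _ hj
        have : (⟨π j (DirectSum.coeAddMonoidHom G (DirectSum.of (fun i => G i) i y)), hπ j _⟩ :
            G j) = 0 := by
          apply Subtype.ext
          rw [DirectSum.coeAddMonoidHom_of]
          exact hz i j hj.symm _ y.2
        rw [this, map_zero]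
      · simp
    | add x y hx hy =>
      refine Eq.trans ?_ (congrArg₂ (· + ·) hx hy)
      dsimp only
      rw [← Finset.sum_add_distrib]
      refine Finset.sum_congr rfl fun i _ => ?_
      rw [← map_add]
      congr 1
      apply Subtype.ext
      rw [map_add]
      exact hadd i _ _

/-- The real numbers as a test algebra. -/
def realWeil : SuperWeil where
  carrier := ℝ
  gr i := if i = 0 then ⊤ else ⊥
  graded := gradedOfProj _ (by simp)
    (by
      intro i j a b ha hb
      by_cases hi : i = 0
      · by_cases hj : j = 0
        · simp [hi, hj]
        · simp [hj] at hb
          simp [hb]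
      · simp [hi] at ha
        simp [ha])
    (fun i a => if i = 0 then a else 0)
    (by intro i a; split_ifs <;> simp)
    (by intro a; simp)
    (by
      intro i a ha
      by_cases hi : i = 0
      · simp [hi]
      · simp [hi] at ha
        simp [ha])
    (by
      intro i j hij a ha
      by_cases hj : j = 0
      · subst hj
        simp [hij] at ha
        simp [ha]
      · simp [hj])
    (by intro i a b; split_ifs <;> simp)
  supercomm := by
    intro i j a b ha hb
    by_cases hi : i = 0
    · simp [hi, mul_comm]
    · simp [hi] at ha
      simp [ha]
  finite := inferInstance
  aug := AlgHom.id ℝ ℝ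
  order := 1
  nilp := by
    intro l hl h
    cases l with
    | nil => simp at hl
    | cons a l =>
      have : a = 0 := h a (by simp)
      simp [this]

/-! ### Dual numbers over a test algebra, with a generator of either parity -/

section Eps

/-- The algebra involution that multiplies odd elements by `(-1)^p`. -/
def SuperWeil.twist (B : SuperWeil) (p : ZMod 2) : B →ₗ[ℝ] B :=
  GradedAlgebra.proj B.gr 0 + (-1 : ℝ) ^ p.val • GradedAlgebra.proj B.gr 1

theorem SuperWeil.proj_mem (B : SuperWeil) (i : ZMod 2) (b : B) :
    GradedAlgebra.proj B.gr i b ∈ B.gr i :=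
  SetLike.coe_mem (DirectSum.decompose B.gr b i)

theorem SuperWeil.proj_of_mem (B : SuperWeil) {i : ZMod 2} {b : B} (hb : b ∈ B.gr i) :
    GradedAlgebra.proj B.gr i b = b :=
  DirectSum.decompose_of_mem_same _ hb

theorem SuperWeil.proj_of_mem_ne (B : SuperWeil) {i j : ZMod 2} {b : B} (hb : b ∈ B.gr i)
    (h : i ≠ j) : GradedAlgebra.proj B.gr j b = 0 :=
  DirectSum.decompose_of_mem_ne _ hb h

theorem SuperWeil.proj_add_proj (B : SuperWeil) (b : B) :
    GradedAlgebra.proj B.gr 0 b + GradedAlgebra.proj B.gr 1 b = b := by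
  obtain ⟨b0, h0, b1, h1, rfl⟩ := B.mem_decomp b
  rw [map_add, map_add, B.proj_of_mem h0, B.proj_of_mem_ne h1 (by decide),
    B.proj_of_mem_ne h0 (by decide), B.proj_of_mem h1]
  abel

theorem SuperWeil.twist_of_mem (B : SuperWeil) (p : ZMod 2) {i : ZMod 2} {b : B}
    (hb : b ∈ B.gr i) : B.twist p b = (-1 : ℝ) ^ (i.val * p.val) • b := by
  rcases zmod_two_cases i with rfl | rfl
  · simp [twist, B.proj_of_mem hb, B.proj_of_mem_ne hb (show (0 : ZMod 2) ≠ 1 by decide)]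
  · have : (1 : ZMod 2).val = 1 := rfl
    simp [twist, B.proj_of_mem hb, B.proj_of_mem_ne hb (show (1 : ZMod 2) ≠ 0 by decide), this]

theorem SuperWeil.twist_mem (B : SuperWeil) (p : ZMod 2) {i : ZMod 2} {b : B}
    (hb : b ∈ B.gr i) : B.twist p b ∈ B.gr i := by
  rw [B.twist_of_mem p hb]
  exact Submodule.smul_mem _ _ hb

theorem SuperWeil.twist_one (B : SuperWeil) (p : ZMod 2) : B.twist p 1 = 1 := by
  rw [B.twist_of_mem p B.one_mem]
  simp

theorem SuperWeil.twist_mul_of_mem (B : SuperWeil) (p : ZMod 2) {i j : ZMod 2} {a b : B}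
    (ha : a ∈ B.gr i) (hb : b ∈ B.gr j) : B.twist p (a * b) = B.twist p a * B.twist p b := by
  rw [B.twist_of_mem p ha, B.twist_of_mem p hb, B.twist_of_mem p (B.mul_mem ha hb),
    smul_mul_smul_comm, ← pow_add]
  congr 1
  rcases zmod_two_cases i with rfl | rfl <;> rcases zmod_two_cases j with rfl | rfl <;>
    rcases zmod_two_cases p with rfl | rfl <;> simp [ZMod.val_one, CharTwo.add_self_eq_zero]

theorem SuperWeil.twist_mul (B : SuperWeil) (p : ZMod 2) (a b : B) :
    B.twist p (a * b) = B.twist p a * B.twist p b := by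
  obtain ⟨a0, ha0, a1, ha1, rfl⟩ := B.mem_decomp a
  obtain ⟨b0, hb0, b1, hb1, rfl⟩ := B.mem_decomp b
  simp only [add_mul, mul_add, map_add, B.twist_mul_of_mem p ha0 hb0, B.twist_mul_of_mem p ha0 hb1,
    B.twist_mul_of_mem p ha1 hb0, B.twist_mul_of_mem p ha1 hb1]

theorem SuperWeil.aug_twist (B : SuperWeil) (p : ZMod 2) (b : B) :
    B.aug (B.twist p b) = B.aug b := by
  obtain ⟨b0, h0, b1, h1, rfl⟩ := B.mem_decomp b
  rw [map_add, B.twist_of_mem p h0, B.twist_of_mem p h1, map_add, map_add, map_smul,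
    map_smul, B.aug_odd h1]
  simp

/-- This is the purpose of the twist: it records what happens to b when an element of parity p is
moved from its right to its left. -/
theorem SuperWeil.mul_eq_mul_twist (B : SuperWeil) {p : ZMod 2} {d b : B} (hd : d ∈ B.gr p) :
    b * d = d * B.twist p b := by
  obtain ⟨b0, h0, b1, h1, rfl⟩ := B.mem_decomp b
  rw [map_add, B.twist_of_mem p h0, B.twist_of_mem p h1, add_mul, mul_add, mul_smul_comm,
    mul_smul_comm, B.supercomm _ _ _ _ h0 hd, B.supercomm _ _ _ _ h1 hd, Algebra.smul_def,
    Algebra.smul_def]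
  simp

/-- Elements `a + ε b`, where `ε` has parity `p` and square zero. -/
def Eps (B : SuperWeil) (_p : ZMod 2) : Type := B.carrier × B.carrier

variable (B : SuperWeil) (p : ZMod 2)

namespace Eps

variable {B p} in
/-- The component without `ε`. -/
def re (x : Eps B p) : B := x.1

variable {B p} in
/-- The coefficient of `ε`. -/
def im (x : Eps B p) : B := x.2

variable {B p} in
/-- The element with given components. -/
def mk (a b : B) : Eps B p := (a, b)

instance : AddCommGroup (Eps B p) := inferInstanceAs (AddCommGroup (B.carrier × B.carrier))
instance : Module ℝ (Eps B p) := inferInstanceAs (Module ℝ (B.carrier × B.carrier))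
-- The generator stands on the left, as in a + εb, and aε equals ε times the twist of a. With this
-- convention the coefficient of ε in an expansion is a left derivative.
instance : Mul (Eps B p) := ⟨fun x y => mk (x.re * y.re) (B.twist p x.re * y.im + x.im * y.re)⟩
instance : One (Eps B p) := ⟨mk 1 0⟩

variable {B p}

theorem ext {x y : Eps B p} (h1 : x.re = y.re) (h2 : x.im = y.im) : x = y := Prod.ext h1 h2

theorem mul_fst (x y : Eps B p) : (x * y).re = x.re * y.re := rfl
theorem mul_snd (x y : Eps B p) : (x * y).im = B.twist p x.re * y.im + x.im * y.re := rfl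
theorem add_fst (x y : Eps B p) : (x + y).re = x.re + y.re := rfl
theorem add_snd (x y : Eps B p) : (x + y).im = x.im + y.im := rfl
theorem smul_fst (r : ℝ) (x : Eps B p) : (r • x).re = r • x.re := rfl
theorem smul_snd (r : ℝ) (x : Eps B p) : (r • x).im = r • x.im := rfl
theorem zero_fst : (0 : Eps B p).re = 0 := rfl
theorem zero_snd : (0 : Eps B p).im = 0 := rfl
theorem one_fst : (1 : Eps B p).re = 1 := rfl
theorem one_snd : (1 : Eps B p).im = 0 := rfl

instance : Ring (Eps B p) :=
  { (inferInstance : AddCommGroup (Eps B p)), (inferInstance : Mul (Eps B p)),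
    (inferInstance : One (Eps B p)) with
    left_distrib := fun x y z => ext (mul_add _ _ _) (by
      simp only [mul_snd, add_snd, add_fst, mul_add]; abel)
    right_distrib := fun x y z => ext (add_mul _ _ _) (by
      simp only [mul_snd, add_snd, add_fst, add_mul, map_add]; abel)
    zero_mul := fun x => ext (zero_mul _) (by
      simp only [mul_snd, zero_fst, zero_snd, zero_mul, map_zero, add_zero])
    mul_zero := fun x => ext (mul_zero _) (by
      simp only [mul_snd, zero_fst, zero_snd, mul_zero, add_zero])
    mul_assoc := fun x y z => ext (mul_assoc _ _ _) (by
      simp only [mul_snd, mul_fst, B.twist_mul, mul_add, add_mul, mul_assoc]; abel)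
    one_mul := fun x => ext (one_mul _) (by
      simp only [mul_snd, one_fst, one_snd, B.twist_one, one_mul, zero_mul, add_zero])
    mul_one := fun x => ext (mul_one _) (by
      simp only [mul_snd, one_fst, one_snd, mul_one, mul_zero, zero_add]) }

instance : Algebra ℝ (Eps B p) :=
  Algebra.ofModule
    (fun r x y => ext (smul_mul_assoc _ _ _) (by
      simp only [mul_snd, smul_snd, smul_fst, map_smul, smul_mul_assoc, smul_add]))
    (fun r x y => ext (mul_smul_comm _ _ _) (by
      simp only [mul_snd, smul_snd, smul_fst, mul_smul_comm, smul_add]))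

variable (B p)

/-- The grading. -/
def grading (i : ZMod 2) : Submodule ℝ (Eps B p) :=
  Submodule.prod (B.gr i) (B.gr (i + p))

variable {B p}

theorem mem_grading {i : ZMod 2} {x : Eps B p} :
    x ∈ grading B p i ↔ x.re ∈ B.gr i ∧ x.im ∈ B.gr (i + p) := Iff.rfl

instance : GradedAlgebra (grading B p) :=
  gradedOfProj _ ⟨B.one_mem, Submodule.zero_mem _⟩
    (by
      rintro i j x y ⟨hx1, hx2⟩ ⟨hy1, hy2⟩
      refine ⟨B.mul_mem hx1 hy1, Submodule.add_mem _ ?_ ?_⟩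
      · have := B.mul_mem (B.twist_mem p hx1) hy2
        rwa [← add_assoc] at this
      · have := B.mul_mem hx2 hy1
        rwa [add_right_comm] at this)
    (fun i x => mk (GradedAlgebra.proj B.gr i x.re) (GradedAlgebra.proj B.gr (i + p) x.im))
    (fun i x => ⟨B.proj_mem _ _, B.proj_mem _ _⟩)
    (by
      intro x
      refine ext (B.proj_add_proj x.re) ?_
      change GradedAlgebra.proj B.gr (0 + p) x.im + GradedAlgebra.proj B.gr (1 + p) x.im = x.im
      rcases zmod_two_cases p with rfl | rfl
      · exact B.proj_add_proj x.im
      · rw [add_comm]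
        exact B.proj_add_proj x.im)
    (fun i x hx => ext (B.proj_of_mem hx.1) (B.proj_of_mem hx.2))
    (fun i j hij x hx => ext (B.proj_of_mem_ne hx.1 hij)
      (B.proj_of_mem_ne hx.2 fun h => hij (add_right_cancel h)))
    (fun i x y => ext (map_add _ _ _) (map_add _ _ _))

theorem supercomm (i j : ZMod 2) (x y : Eps B p) (hx : x ∈ grading B p i)
    (hy : y ∈ grading B p j) : x * y = (-1) ^ (i.val * j.val) * (y * x) := by
  have h : ((-1 : Eps B p) ^ (i.val * j.val)) =
      algebraMap ℝ (Eps B p) ((-1) ^ (i.val * j.val)) := by simp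
  have hB : ∀ k : ℕ, ((-1 : B) ^ k) = algebraMap ℝ B ((-1) ^ k) := by simp
  rw [h, ← Algebra.smul_def]
  rw [mem_grading] at hx hy
  have e1 := B.supercomm _ _ _ _ hx.1 hy.1
  have e2 := B.supercomm _ _ _ _ hx.1 hy.2
  have e3 := B.supercomm _ _ _ _ hx.2 hy.1
  rw [hB, ← Algebra.smul_def] at e1 e2 e3
  refine ext e1 ?_
  rw [mul_snd, smul_snd, mul_snd, B.twist_of_mem p hx.1, B.twist_of_mem p hy.1, smul_mul_assoc,
    e2, e3, smul_mul_assoc, smul_add, smul_smul, smul_smul, add_comm]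
  congr 2
  · rcases zmod_two_cases i with rfl | rfl <;> rcases zmod_two_cases j with rfl | rfl <;>
      rcases zmod_two_cases p with rfl | rfl <;> simp [ZMod.val_one, CharTwo.add_self_eq_zero]
  · rcases zmod_two_cases i with rfl | rfl <;> rcases zmod_two_cases j with rfl | rfl <;>
      rcases zmod_two_cases p with rfl | rfl <;> simp [ZMod.val_one, CharTwo.add_self_eq_zero]

/-- The augmentation. -/
def aug : Eps B p →ₐ[ℝ] ℝ :=
  AlgHom.ofLinearMap (B.aug.toLinearMap ∘ₗ LinearMap.fst ℝ B B) (map_one B.aug)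
    (fun x y => map_mul B.aug x.re y.re)

theorem prod_fst (l : List (Eps B p)) : l.prod.re = (l.map Eps.re).prod := by
  induction l with
  | nil => rfl
  | cons x l ih => rw [List.prod_cons, mul_fst, ih, List.map_cons, List.prod_cons]

theorem prod_snd_eq_zero (l : List (Eps B p)) (hl : ∀ x ∈ l, aug x = 0) (l₀ : List B)
    (hl₀ : ∀ b ∈ l₀, B.aug b = 0) (h : B.order + 1 ≤ l₀.length + l.length) :
    l₀.prod * l.prod.im = 0 := by
  induction l generalizing l₀ with
  | nil =>
    rw [B.nilp l₀ (by simp at h; omega) hl₀, zero_mul]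
  | cons x l ih =>
    have hx : B.aug x.re = 0 := hl x (by simp)
    have hl' : ∀ y ∈ l, aug y = 0 := fun y hy => hl y (by simp [hy])
    rw [List.prod_cons, mul_snd, mul_add, prod_fst]
    have e1 := ih hl' (l₀ ++ [B.twist p x.re])
      (by
        intro b hb
        rcases List.mem_append.1 hb with hb | hb
        · exact hl₀ b hb
        · rw [List.mem_singleton.1 hb, B.aug_twist, hx])
      (by simp at h ⊢; omega)
    rw [List.prod_append, List.prod_singleton, mul_assoc] at e1
    rw [e1, zero_add]
    cases l with
    | nil => rw [B.nilp l₀ (by simp at h; omega) hl₀, zero_mul]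
    | cons y l =>
      have hy : B.aug y.re = 0 := hl y (by simp)
      have e2 := B.nilp (l₀ ++ (x.im * y.re) :: l.map Eps.re)
        (by simp at h ⊢; omega)
        (by
          intro b hb
          rcases List.mem_append.1 hb with hb | hb
          · exact hl₀ b hb
          · rcases List.mem_cons.1 hb with rfl | hb
            · rw [map_mul, hy, mul_zero]
            · obtain ⟨z, hz, rfl⟩ := List.mem_map.1 hb
              exact hl z (by simp [hz]))
      rw [List.prod_append, List.prod_cons] at e2
      rw [List.map_cons, List.prod_cons, ← mul_assoc x.im]
      exact e2

end Eps

/-- The test algebra `B[ε]` with `ε` of parity `p` and square zero. -/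
def SuperWeil.eps : SuperWeil where
  carrier := Eps B p
  gr := Eps.grading B p
  supercomm := Eps.supercomm
  finite := by
    have := B.finite
    exact inferInstanceAs (Module.Finite ℝ (B.carrier × B.carrier))
  aug := Eps.aug
  order := B.order + 1
  nilp := by
    intro l hl h
    refine Eps.ext (p := p) ?_ ?_
    · refine (Eps.prod_fst l).trans ?_
      refine B.nilp _ (by rw [List.length_map]; omega) ?_
      intro b hb
      obtain ⟨x, hx, rfl⟩ := List.mem_map.1 hb
      exact h x hx
    · have := Eps.prod_snd_eq_zero l h [] (by simp) (by simpa using hl)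
      rw [List.prod_nil, one_mul] at this
      exact this

/-- The inclusion `B → B[ε]`. -/
def SuperWeil.epsInl : B →ₐ[ℝ] B.eps p :=
  AlgHom.ofLinearMap (LinearMap.inl ℝ B B : B →ₗ[ℝ] Eps B p) rfl
    (fun a b => Eps.ext (p := p) rfl (by
      change (0 : B) = B.twist p a * 0 + 0 * b
      simp))

/-- The element `ε`. -/
def SuperWeil.epsGen : B.eps p := (Eps.mk 0 1 : Eps B p)

/-- The ideal generated by `ε`. -/
def SuperWeil.epsIdeal : Submodule ℝ (B.eps p) :=
  LinearMap.ker (LinearMap.fst ℝ B B : Eps B p →ₗ[ℝ] B)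

variable {B p}

theorem SuperWeil.epsInl_aug (b : B) : (B.eps p).aug (B.epsInl p b) = B.aug b := rfl

theorem SuperWeil.epsInl_mem {i : ZMod 2} {b : B} (hb : b ∈ B.gr i) :
    B.epsInl p b ∈ (B.eps p).gr i := ⟨hb, Submodule.zero_mem _⟩

theorem SuperWeil.epsGen_mem : B.epsGen p ∈ (B.eps p).gr p :=
  ⟨Submodule.zero_mem _, by
    change (1 : B) ∈ B.gr (p + p)
    rw [CharTwo.add_self_eq_zero]
    exact B.one_mem⟩

theorem SuperWeil.mem_epsIdeal {x : B.eps p} : x ∈ B.epsIdeal p ↔ Eps.re (p := p) x = 0 := Iff.rfl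

theorem SuperWeil.epsGen_mem_ideal : B.epsGen p ∈ B.epsIdeal p := rfl

theorem SuperWeil.epsIdeal_twoSided : TwoSided (B.epsIdeal p) := by
  intro a b hb
  refine ⟨?_, ?_⟩
  · change Eps.re (p := p) a * Eps.re (p := p) b = 0
    rw [SuperWeil.mem_epsIdeal.1 hb, mul_zero]
  · change Eps.re (p := p) b * Eps.re (p := p) a = 0
    rw [SuperWeil.mem_epsIdeal.1 hb, zero_mul]

theorem SuperWeil.epsIdeal_sq : ∀ a ∈ B.epsIdeal p, ∀ b ∈ B.epsIdeal p, a * b = 0 := by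
  intro a ha b hb
  refine Eps.ext (p := p) ?_ ?_
  · change Eps.re (p := p) a * Eps.re (p := p) b = 0
    rw [SuperWeil.mem_epsIdeal.1 ha, zero_mul]
  · change B.twist p (Eps.re (p := p) a) * Eps.im (p := p) b + Eps.im (p := p) a * Eps.re (p := p) b = 0
    rw [SuperWeil.mem_epsIdeal.1 ha, SuperWeil.mem_epsIdeal.1 hb, map_zero, zero_mul, mul_zero,
      add_zero]

theorem SuperWeil.epsGen_mul_inl (b : B) :
    B.epsGen p * B.epsInl p b = (Eps.mk 0 b : Eps B p) :=
  Eps.ext (p := p) (zero_mul b) (by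
    change B.twist p 0 * 0 + 1 * b = b
    simp)

/-- The coefficient of ε can be read off, so an identity over B[ε] yields an identity of derivatives
over B. -/
theorem SuperWeil.epsGen_mul_inl_injective {b b' : B}
    (h : B.epsGen p * B.epsInl p b = B.epsGen p * B.epsInl p b') : b = b' := by
  rw [SuperWeil.epsGen_mul_inl, SuperWeil.epsGen_mul_inl] at h
  exact congrArg (Eps.im (p := p)) h

end Eps

/-! ### Functions of points in test algebras, and which of them are superfunctions -/

section Points

variable {S : Type} [Fintype S] [LinearOrder S] [Parity S] {n : ℕ}

/-- Even coordinates over `U` and values of formal variables. -/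
structure VPt (U : Set (Fin n → ℝ)) {B : SuperWeil} (e : Fin n → B) (v : S → B) : Prop where
  even : ∀ a, e a ∈ B.gr 0
  body : (fun a => B.aug (e a)) ∈ U
  formal : B.IsFormal v

theorem VPt.aug_zero {U : Set (Fin n → ℝ)} {B : SuperWeil} {e : Fin n → B} {v : S → B}
    (h : VPt U e v) (s : S) : B.aug (v s) = 0 := (h.formal s).2

theorem realWeil_mem (x : ℝ) : (show realWeil from x) ∈ realWeil.gr 0 := by
  change x ∈ (if (0 : ZMod 2) = 0 then (⊤ : Submodule ℝ ℝ) else ⊥)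
  simp

theorem vpt_real {U : Set (Fin n → ℝ)} {x : Fin n → ℝ} (hx : x ∈ U) :
    VPt U (B := realWeil) x (0 : S → realWeil) where
  even _a := realWeil_mem _
  body := hx
  formal _s := ⟨Submodule.zero_mem _, map_zero _⟩

theorem VPt.map {U : Set (Fin n → ℝ)} {B : SuperWeil} {e : Fin n → B} {v : S → B}
    (h : VPt U e v) (p : ZMod 2) :
    VPt U (fun a => B.epsInl p (e a)) fun s => B.epsInl p (v s) where
  even a := SuperWeil.epsInl_mem (h.even a)
  body := h.body
  formal s := ⟨SuperWeil.epsInl_mem (h.formal s).1, h.aug_zero s⟩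

/-! ## Superfunctions are determined by their values -/

/-- An infinitesimal increment ε in the variable s, of the same parity as s, exposes the left
derivative in s: the values of F over B[ε] contain those of the derivative over B. -/
theorem evalV_eps_formal {U : Set (Fin n → ℝ)} (hU : IsOpen U)
    {F : (S → ℕ) → (Fin n → ℝ) → ℝ} (hF : SmoothCoef U F) {B : SuperWeil} {e : Fin n → B}
    {v : S → B} (h : VPt U e v) (s : S) :
    evalV F (fun a => B.epsInl (Parity.par s) (e a)) (fun t => B.epsInl (Parity.par s) (v t) +
        if t = s then B.epsGen (Parity.par s) else 0) =
      B.epsInl (Parity.par s) (evalV F e v) +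
        B.epsGen (Parity.par s) * B.epsInl (Parity.par s) (evalV (dFormal s F) e v) := by
  have h' := h.map (Parity.par s)
  have := evalV_expand hU hF SuperWeil.epsIdeal_twoSided SuperWeil.epsIdeal_sq
    (e := fun a => B.epsInl (Parity.par s) (e a)) (δe := 0)
    (v := fun t => B.epsInl (Parity.par s) (v t))
    (δ := fun t => if t = s then B.epsGen (Parity.par s) else 0) h'.even h'.body
    (fun _ => Submodule.zero_mem _) (fun _ => Submodule.zero_mem _) h'.formal
    (by
      intro t
      split_ifs with hts
      · rw [hts]
        exact SuperWeil.epsGen_mem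
      · exact Submodule.zero_mem _)
    (by
      intro t
      split_ifs
      · exact SuperWeil.epsGen_mem_ideal
      · exact Submodule.zero_mem _)
  simp only [Pi.zero_apply, add_zero, zero_mul, Finset.sum_const_zero, ite_mul,
    Finset.sum_ite_eq', Finset.mem_univ, if_true] at this
  rw [this, evalV_map _ (fun _ => SuperWeil.epsInl_aug _) _ _ h.aug_zero,
    evalV_map _ (fun _ => SuperWeil.epsInl_aug _) _ _ h.aug_zero]

/-- Induction on the degree. The constant coefficient is the value over the real numbers. Any other
coefficient is, up to a nonzero factor, a coefficient of smaller degree of a derivative in some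
variable s with `α s ≠ 0`. Values of that derivative over algebras of order at most N are determined
by values of F over their dual numbers, whose order is one larger; this is why the bound on the
degree and the bound on the order move together. -/
theorem coef_eq_of_evalV_eq {U : Set (Fin n → ℝ)} (hU : IsOpen U) (N : ℕ)
    {F G : (S → ℕ) → (Fin n → ℝ) → ℝ} (hF : SmoothCoef U F) (hG : SmoothCoef U G)
    (h : ∀ B : SuperWeil, B.order ≤ N → ∀ (e : Fin n → B) (v : S → B), VPt U e v →
      evalV F e v = evalV G e v) (α : S → ℕ) (hα : ∑ s, α s < N) {x : Fin n → ℝ} (hx : x ∈ U) :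
    F α x = G α x := by
  induction N generalizing F G α with
  | zero => omega
  | succ N ih =>
    by_cases h0 : α = 0
    · subst h0
      have hr := congrArg realWeil.aug (h realWeil (by simp [realWeil]) _ _ (vpt_real hx))
      exact (aug_evalV F _ (vpt_real hx).aug_zero).symm.trans
        (hr.trans (aug_evalV G _ (vpt_real hx).aug_zero))
    · obtain ⟨s, hs⟩ := Function.ne_iff.1 h0
      have hs' : α s ≠ 0 := hs
      have e1 : (α - Pi.single s 1 + Pi.single s 1 : S → ℕ) = α := by
        funext t
        by_cases hst : t = s
        · subst hst
          simp only [Pi.add_apply, Pi.sub_apply, Pi.single_eq_same]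
          omega
        · simp [hst]
      have hsum : ∑ t, (α - Pi.single s 1 : S → ℕ) t < N := by
        have : ∑ t, α t = ∑ t, (α - Pi.single s 1 : S → ℕ) t + 1 := by
          conv_lhs => rw [← e1]
          simp only [Pi.add_apply, Finset.sum_add_distrib]
          rw [Finset.sum_pi_single']
          simp
        omega
      have key := ih (hF.dFormal s) (hG.dFormal s) (fun B hB e v hp => by
        have h1 := h (B.eps (Parity.par s)) (by change B.order + 1 ≤ N + 1; omega)
          (fun a => B.epsInl (Parity.par s) (e a)) (fun t => B.epsInl (Parity.par s) (v t) +
            if t = s then B.epsGen (Parity.par s) else 0)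
          ⟨(hp.map _).even, (hp.map _).body, fun t => by
            refine ⟨Submodule.add_mem _ ((hp.map _).formal t).1 ?_, ?_⟩
            · split_ifs with hts
              · rw [hts]
                exact SuperWeil.epsGen_mem
              · exact Submodule.zero_mem _
            · rw [map_add, (hp.map _).aug_zero t, zero_add]
              split_ifs
              · exact map_zero B.aug
              · exact map_zero _⟩
        rw [evalV_eps_formal hU hF hp, evalV_eps_formal hU hG hp,
          h B (by omega) e v hp] at h1
        exact SuperWeil.epsGen_mul_inl_injective (add_left_cancel h1)) _ hsum
      unfold Microformal.dFormal at key
      rw [e1] at key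
      refine mul_left_cancel₀ (mul_ne_zero (pow_ne_zero _ (by norm_num)) ?_) key
      positivity

theorem coef_ext {U : Set (Fin n → ℝ)} (hU : IsOpen U)
    {F G : (S → ℕ) → (Fin n → ℝ) → ℝ} (hF : SmoothCoef U F) (hG : SmoothCoef U G)
    (h : ∀ (B : SuperWeil) (e : Fin n → B) (v : S → B), VPt U e v →
      evalV F e v = evalV G e v) (α : S → ℕ) {x : Fin n → ℝ} (hx : x ∈ U) :
    F α x = G α x :=
  coef_eq_of_evalV_eq hU (∑ s, α s + 1) hF hG (fun B _ => h B) α (Nat.lt_succ_self _) hx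

/-! ## Representable functions of points -/

/-- A function of points with values in arbitrary test algebras. -/
abbrev PtFun (n : ℕ) (S : Type) : Type 1 := ∀ B : SuperWeil, (Fin n → B) → (S → B) → B

/-- `T` is given by a superfunction. -/
def Rep (U : Set (Fin n → ℝ)) (T : PtFun n S) : Prop :=
  ∃ F : (S → ℕ) → (Fin n → ℝ) → ℝ, SmoothCoef U F ∧
    ∀ (B : SuperWeil) (e : Fin n → B) (v : S → B), VPt U e v → T B e v = evalV F e v

/-- On test algebras of order at most `N`, `T` is a polynomial in the formal variables with smooth
coefficients. -/
def RepN (U : Set (Fin n → ℝ)) (N : ℕ) (T : PtFun n S) : Prop :=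
  ∃ (ι : Type) (_ : Fintype ι) (g : ι → (Fin n → ℝ) → ℝ) (l : ι → List S),
    (∀ i, ContDiffOn ℝ ∞ (g i) U) ∧ ∀ B : SuperWeil, B.order ≤ N →
      ∀ (e : Fin n → B) (v : S → B), VPt U e v →
        T B e v = ∑ i, evalSmooth B (g i) e * ((l i).map v).prod

variable {U : Set (Fin n → ℝ)} {N : ℕ} {T T' : PtFun n S}

theorem RepN.congr (h : RepN U N T) (hT : ∀ B : SuperWeil, B.order ≤ N →
    ∀ (e : Fin n → B) (v : S → B), VPt U e v → T' B e v = T B e v) : RepN U N T' := by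
  obtain ⟨ι, hι, g, l, hg, h⟩ := h
  exact ⟨ι, hι, g, l, hg, fun B hB e v hp => (hT B hB e v hp).trans (h B hB e v hp)⟩

theorem repN_smooth {g : (Fin n → ℝ) → ℝ} (hg : ContDiffOn ℝ ∞ g U) :
    RepN (S := S) U N fun B e _ => evalSmooth B g e :=
  ⟨Unit, inferInstance, fun _ => g, fun _ => [], fun _ => hg, fun B _ e v _ => by simp⟩

theorem repN_const (r : ℝ) : RepN (S := S) U N fun B _ _ => algebraMap ℝ B r :=
  (repN_smooth (contDiffOn_const (c := r))).congr fun _B _ e _ hp =>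
    (evalSmooth_const r e hp.even).symm

theorem repN_var (s : S) : RepN U N fun _ _ v => v s :=
  ⟨Unit, inferInstance, fun _ _ => 1, fun _ => [s], fun _ => contDiffOn_const,
    fun B _ e v hp => by simp [evalSmooth_const _ e hp.even]⟩

theorem repN_coord (a : Fin n) : RepN (S := S) U N fun _ e _ => e a :=
  (repN_smooth (contDiff_apply ℝ ℝ a).contDiffOn).congr fun _B _ e _ hp =>
    (evalSmooth_proj a e hp.even).symm

theorem RepN.add (h : RepN U N T) (h' : RepN U N T') :
    RepN U N fun B e v => T B e v + T' B e v := by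
  obtain ⟨ι, hι, g, l, hg, h⟩ := h
  obtain ⟨ι', hι', g', l', hg', h'⟩ := h'
  refine ⟨ι ⊕ ι', inferInstance, Sum.elim g g', Sum.elim l l', ?_, ?_⟩
  · rintro (i | i)
    · exact hg i
    · exact hg' i
  · intro B hB e v hp
    dsimp only
    rw [h B hB e v hp, h' B hB e v hp, Fintype.sum_sum_type]
    rfl

theorem RepN.mul (hU : IsOpen U) (h : RepN U N T) (h' : RepN U N T') :
    RepN U N fun B e v => T B e v * T' B e v := by
  obtain ⟨ι, hι, g, l, hg, h⟩ := h
  obtain ⟨ι', hι', g', l', hg', h'⟩ := h'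
  refine ⟨ι × ι', inferInstance, fun i x => g i.1 x * g' i.2 x, fun i => l i.1 ++ l' i.2,
    fun i => (hg i.1).mul (hg' i.2), ?_⟩
  intro B hB e v hp
  dsimp only
  rw [h B hB e v hp, h' B hB e v hp, Fintype.sum_prod_type, Finset.sum_mul_sum]
  refine Finset.sum_congr rfl fun i _ => Finset.sum_congr rfl fun j _ => ?_
  rw [evalSmooth_mul e hp.even ((hg i).contDiffAt (hU.mem_nhds hp.body))
    ((hg' j).contDiffAt (hU.mem_nhds hp.body)), List.map_append, List.prod_append, mul_assoc,
    mul_assoc, ← mul_assoc ((l i).map v).prod, ← B.even_comm (evalSmooth_mem (g' j) e hp.even)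
      ((l i).map v).prod, mul_assoc]

theorem RepN.smul (hU : IsOpen U) (r : ℝ) (h : RepN U N T) :
    RepN U N fun B e v => r • T B e v :=
  ((repN_const r).mul hU h).congr fun _B _ _e _v _ => Algebra.smul_def _ _

theorem RepN.neg (hU : IsOpen U) (h : RepN U N T) : RepN U N fun B e v => -T B e v :=
  (h.smul hU (-1)).congr fun B _ e v _ => by simp

theorem RepN.sub (hU : IsOpen U) (h : RepN U N T) (h' : RepN U N T') :
    RepN U N fun B e v => T B e v - T' B e v :=
  (h.add (h'.neg hU)).congr fun _B _ _e _v _ => sub_eq_add_neg _ _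

theorem RepN.sum {κ : Type} (s : Finset κ) {T : κ → PtFun n S} (h : ∀ k ∈ s, RepN U N (T k)) :
    RepN U N fun B e v => ∑ k ∈ s, T k B e v := by
  classical
  induction s using Finset.induction_on with
  | empty => exact (repN_const 0).congr fun B _ e v _ => by simp
  | insert a s ha ih =>
    simp only [Finset.sum_insert ha]
    exact (h a (Finset.mem_insert_self _ _)).add (ih fun k hk => h k (Finset.mem_insert_of_mem hk))

theorem RepN.listProd (hU : IsOpen U) {κ : Type} (l : List κ) {T : κ → PtFun n S}
    (h : ∀ k ∈ l, RepN U N (T k)) : RepN U N fun B e v => (l.map fun k => T k B e v).prod := by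
  induction l with
  | nil => exact (repN_const 1).congr fun B _ e v _ => by simp
  | cons k l ih =>
    simp only [List.map_cons, List.prod_cons]
    exact (h k (by simp)).mul hU (ih fun j hj => h j (by simp [hj]))

theorem RepN.pow (hU : IsOpen U) (h : RepN U N T) (k : ℕ) :
    RepN U N fun B e v => T B e v ^ k :=
  (RepN.listProd hU (List.replicate k ()) (T := fun _ => T) fun _ _ => h).congr fun B _ e v _ => by
    simp

theorem SmoothCoef.repN {F : (S → ℕ) → (Fin n → ℝ) → ℝ} (hF : SmoothCoef U F) (N : ℕ) :
    RepN U N fun _ e v => evalV F e v := by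
  refine ⟨box S N, inferInstance, fun α => F α, fun α => word (α : S → ℕ), fun α => hF.1 _, ?_⟩
  intro B hB e v hp
  dsimp only
  rw [evalV_eq_sum_box F e hp.aug_zero hB, ← Finset.sum_coe_sort]
  simp only [mono_eq_word]

theorem mono_eq_zero_of_odd {B : SuperWeil} {v : S → B} (hv : B.IsFormal v) {α : S → ℕ} {s : S}
    (hs : Parity.par s = (1 : ZMod 2)) (h2 : 2 ≤ α s) : mono v α = 0 := by
  unfold mono
  refine List.prod_eq_zero (List.mem_map.2 ⟨s, by simp, ?_⟩)
  have h1 : v s ∈ B.gr 1 := hs ▸ (hv s).1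
  obtain ⟨k, hk⟩ := Nat.exists_eq_add_of_le h2
  rw [hk, pow_add, pow_two, B.odd_sq h1, zero_mul]

-- Each word is a fixed multiple of an ordered monomial, by `prod_word`, and the terms are collected
-- by exponent. Exponents with a repeated odd variable can be assigned the coefficient zero, because
-- their monomials vanish.
open Classical in
theorem RepN.exists_coef (hU : IsOpen U) (h : RepN U N T) :
    ∃ F : (S → ℕ) → (Fin n → ℝ) → ℝ, SmoothCoef U F ∧ ∀ B : SuperWeil, B.order ≤ N →
      ∀ (e : Fin n → B) (v : S → B), VPt U e v → T B e v = evalV F e v := by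
  obtain ⟨ι, hι, g, l, hg, h⟩ := h
  choose σ hσ using fun i => prod_word (l i)
  let κ : ι → S → ℕ := fun i s => (l i).count s
  let F : (S → ℕ) → (Fin n → ℝ) → ℝ := fun α x =>
    if ∃ s, Parity.par s = (1 : ZMod 2) ∧ 2 ≤ α s then 0
    else ∑ i, if κ i = α then σ i * g i x else 0
  refine ⟨F, ⟨fun α => ?_, fun α s hs h2 x _ => if_pos ⟨s, hs, h2⟩⟩, ?_⟩
  · by_cases hα : ∃ s, Parity.par s = (1 : ZMod 2) ∧ 2 ≤ α s
    · have : F α = fun _ => 0 := funext fun x => if_pos hα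
      rw [this]
      exact contDiffOn_const
    · have : F α = fun x => ∑ i, if κ i = α then σ i * g i x else 0 := funext fun x => if_neg hα
      rw [this]
      refine ContDiffOn.sum fun i _ => ?_
      split_ifs
      · exact contDiffOn_const.mul (hg i)
      · exact contDiffOn_const
  · intro B hB e v hp
    have hgi : ∀ i, ContDiffAt ℝ ∞ (g i) fun a => B.aug (e a) := fun i =>
      (hg i).contDiffAt (hU.mem_nhds hp.body)
    rw [h B hB e v hp, evalV_eq_sum F e hp.aug_zero (box S B.order ∪ Finset.univ.image κ)
      fun α hα => Finset.mem_union_left _ (mem_box_of_sum_lt hα)]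
    have hF : ∀ α, evalSmooth B (F α) e * mono v α =
        ∑ i, if κ i = α then σ i • (evalSmooth B (g i) e * mono v α) else 0 := by
      intro α
      by_cases hα : ∃ s, Parity.par s = (1 : ZMod 2) ∧ 2 ≤ α s
      · obtain ⟨s, hs, h2⟩ := hα
        simp [mono_eq_zero_of_odd hp.formal hs h2]
      · have : F α = fun x => ∑ i, if κ i = α then σ i * g i x else 0 :=
          funext fun x => if_neg hα
        rw [this, evalSmooth_sum (f := fun i x => if κ i = α then σ i * g i x else 0) _ _ hp.even,
          Finset.sum_mul]
        · refine Finset.sum_congr rfl fun i _ => ?_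
          split_ifs
          · rw [evalSmooth_smul _ e hp.even (hgi i), smul_mul_assoc]
          · rw [evalSmooth_zero, zero_mul]
        · intro i _
          split_ifs
          · exact contDiffAt_const.mul (hgi i)
          · exact contDiffAt_const
    simp only [hF]
    rw [Finset.sum_comm]
    refine Finset.sum_congr rfl fun i _ => ?_
    rw [Finset.sum_ite_eq, if_pos (Finset.mem_union_right _ (Finset.mem_image_of_mem _
      (Finset.mem_univ i))), hσ i B v hp.formal, mul_smul_comm]

/-- The coefficient families found for the different bounds N agree in degrees below the smaller
bound, since values determine coefficients. So the coefficient of α may be taken from the family for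
N = |α| + 1. On an algebra of order N only degrees below N matter. -/
theorem rep_of_repN (hU : IsOpen U) (h : ∀ N, RepN U N T) : Rep U T := by
  choose F hF hFT using fun N => (h N).exists_coef hU
  have hstab : ∀ (α : S → ℕ) N M, ∑ s, α s < N → N ≤ M → ∀ x ∈ U, F N α x = F M α x := by
    intro α N M h1 h2 x hx
    exact coef_eq_of_evalV_eq hU N (hF N) (hF M) (fun B hB e v hp => by
      rw [← hFT N B hB e v hp, ← hFT M B (hB.trans h2) e v hp]) α h1 hx
  refine ⟨fun α => F (∑ s, α s + 1) α, ⟨fun α => (hF _).1 α, fun α s => (hF _).2 α s⟩, ?_⟩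
  intro B e v hp
  rw [hFT B.order B le_rfl e v hp]
  refine evalV_congr hU e hp.body hp.aug_zero fun α hα x hx => ?_
  exact (hstab α _ _ (Nat.lt_succ_self _) hα x hx).symm

/-! ## Composition -/

/-- The terms of y with empty word form a smooth function y₀ of the even coordinates, and the
remainder ν has nilpotent values. Taylor expansion of f around y₀ in powers of ν stops before degree
N on algebras of order at most N, and its terms are products of representable functions. -/
theorem RepN.comp_smooth (hU : IsOpen U) {n' : ℕ} {V : Set (Fin n' → ℝ)} (hV : IsOpen V)
    {f : (Fin n' → ℝ) → ℝ} (hf : ContDiffOn ℝ ∞ f V) {y : Fin n' → PtFun n S}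
    (hy : ∀ a, RepN U N (y a))
    (hyp : ∀ (B : SuperWeil) (e : Fin n → B) (v : S → B), VPt U e v →
      (∀ a, y a B e v ∈ B.gr 0) ∧ (fun a => B.aug (y a B e v)) ∈ V) :
    RepN U N fun B e v => evalSmooth B f fun a => y a B e v := by
  classical
  -- No algebra has order 0. For N ≥ 1 the real numbers, of order 1, are among the admitted
  -- algebras.
  rcases Nat.eq_zero_or_pos N with rfl | hN
  · exact ⟨Empty, inferInstance, fun _ _ => 0, fun _ => [], fun i => i.elim, fun B hB => by
      have := B.one_le_order; omega⟩
  choose ι hι g l hg hyr using hy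
  -- the body of `y`
  let y₀ : Fin n' → (Fin n → ℝ) → ℝ := fun a x => ∑ i, if l a i = [] then g a i x else 0
  have hsm : ∀ a i, ContDiffOn ℝ ∞ (fun x => if l a i = [] then g a i x else 0) U := by
    intro a i
    split_ifs
    · exact hg a i
    · exact contDiffOn_const
  have hy₀ : ∀ a, ContDiffOn ℝ ∞ (y₀ a) U := fun a => ContDiffOn.sum fun i _ => hsm a i
  let ν : Fin n' → PtFun n S := fun a B e v => y a B e v - evalSmooth B (y₀ a) e
  have hνr : ∀ a, RepN U N (ν a) := fun a =>
    RepN.sub hU ⟨ι a, hι a, g a, l a, hg a, hyr a⟩ (repN_smooth (hy₀ a))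
  have hνaug : ∀ a (B : SuperWeil), B.order ≤ N → ∀ (e : Fin n → B) (v : S → B), VPt U e v →
      B.aug (ν a B e v) = 0 := by
    intro a B hB e v hp
    have hlist : ∀ L : List S, B.aug ((L.map v).prod) = if L = [] then 1 else 0 := by
      intro L
      cases L with
      | nil => simp
      | cons s L => simp [hp.aug_zero]
    simp only [ν]
    rw [hyr a B hB e v hp, map_sub, map_sum, aug_evalSmooth, sub_eq_zero]
    refine Finset.sum_congr rfl fun i _ => ?_
    rw [map_mul, aug_evalSmooth, hlist]
    split_ifs <;> simp
  have hbody : ∀ (B : SuperWeil), B.order ≤ N → ∀ (e : Fin n → B) (v : S → B), VPt U e v →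
      (fun a => y₀ a fun a => B.aug (e a)) = fun a => B.aug (y a B e v) := by
    intro B hB e v hp
    funext a
    have := hνaug a B hB e v hp
    simp only [ν] at this
    rw [map_sub, aug_evalSmooth, sub_eq_zero] at this
    exact this.symm
  -- The body y₀ maps U into V, as testing the hypothesis on real points shows.
  have hmaps : ∀ x ∈ U, (fun a => y₀ a x) ∈ V := by
    intro x hx
    have h1 := hbody realWeil hN _ _ (vpt_real hx)
    have h2 := (hyp realWeil _ _ (vpt_real hx)).2
    rw [← h1] at h2
    exact h2
  let D : (k : ℕ) → (Fin k → Fin n') → (Fin n' → ℝ) → ℝ :=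
    fun k t z => iteratedFDeriv ℝ k f z (fun j => Pi.single (t j) 1)
  have hD : ∀ k t, ContDiffOn ℝ ∞ (D k t) V := by
    intro k t z hz
    have h1 : ContDiffAt ℝ ∞ (iteratedFDeriv ℝ k f) z :=
      (hf.contDiffAt (hV.mem_nhds hz)).iteratedFDeriv_right (i := k) (m := ∞)
        (by exact_mod_cast le_rfl)
    exact ((ContinuousMultilinearMap.apply ℝ (fun _ : Fin k => Fin n' → ℝ) ℝ
      (fun j => Pi.single (t j) 1)).contDiff.contDiffAt.comp z h1).contDiffWithinAt
  have hDy : ∀ k t, ContDiffOn ℝ ∞ (fun x => D k t fun a => y₀ a x) U := fun k t =>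
    (hD k t).comp (contDiffOn_pi.2 hy₀) hmaps
  have hmain : RepN U N fun B e v => ∑ k ∈ Finset.range N, ∑ t : Fin k → Fin n',
      (k.factorial : ℝ)⁻¹ • (evalSmooth B (fun x => D k t fun a => y₀ a x) e *
        ((List.finRange k).map fun j => ν (t j) B e v).prod) :=
    RepN.sum _ fun k _ => RepN.sum _ fun t _ => ((repN_smooth (hDy k t)).mul hU
      (RepN.listProd hU _ fun j _ => hνr (t j))).smul hU _
  refine hmain.congr fun B hB e v hp => ?_
  have hye : (fun a => y a B e v) = fun a => evalSmooth B (y₀ a) e + ν a B e v :=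
    funext fun a => (add_sub_cancel _ _).symm
  have hb : (fun a => B.aug (evalSmooth B (y₀ a) e)) ∈ V := by
    simp only [aug_evalSmooth]
    exact hmaps _ hp.body
  have hy₀e : ∀ a, evalSmooth B (y₀ a) e ∈ B.gr 0 := fun a => evalSmooth_mem _ _ hp.even
  rw [hye, evalSmooth_add_nil _ _ hy₀e
    (fun a => Submodule.sub_mem _ ((hyp B e v hp).1 a) (hy₀e a))
    (fun a => hνaug a B hB e v hp) (hf.contDiffAt (hV.mem_nhds hb)) hB]
  refine Finset.sum_congr rfl fun k _ => Finset.sum_congr rfl fun t _ => ?_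
  rw [List.ofFn_eq_map, evalSmooth_comp e hp.even
    (fun a => (hy₀ a).contDiffAt (hU.mem_nhds hp.body))
    ((hD k t).contDiffAt (hV.mem_nhds (hmaps _ hp.body)))]

theorem RepN.comp (hU : IsOpen U) {n' : ℕ} {S' : Type} [Fintype S'] [LinearOrder S'] [Parity S']
    {V : Set (Fin n' → ℝ)} (hV : IsOpen V)
    {F : (S' → ℕ) → (Fin n' → ℝ) → ℝ} (hF : SmoothCoef V F) {y : Fin n' → PtFun n S}
    {w : S' → PtFun n S} (hy : ∀ a, RepN U N (y a)) (hw : ∀ s, RepN U N (w s))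
    (hp : ∀ (B : SuperWeil) (e : Fin n → B) (v : S → B), VPt U e v →
      VPt V (fun a => y a B e v) fun s => w s B e v) :
    RepN U N fun B e v => evalV F (fun a => y a B e v) fun s => w s B e v := by
  have h1 : RepN U N fun B e v => ∑ α ∈ box S' N, evalSmooth B (F α) (fun a => y a B e v) *
      ((Finset.univ.sort (· ≤ ·)).map fun s => w s B e v ^ α s).prod :=
    RepN.sum _ fun α _ => (RepN.comp_smooth hU hV (hF.1 α) hy
      fun B e v h => ⟨(hp B e v h).even, (hp B e v h).body⟩).mul hU
        (RepN.listProd hU _ fun s _ => (hw s).pow hU _)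
  exact h1.congr fun B hB e v h => evalV_eq_sum_box F _ (hp B e v h).aug_zero hB

end Points

/-! ### Superfunctions as functions of parameters, coordinates and momenta -/

section Values

variable {n m : ℕ} {P Q : Type} [Fintype P] [LinearOrder P] [Parity P]
  [Fintype Q] [LinearOrder Q] [Parity Q]

/-- The variable of a parameter. -/
abbrev varPar (m : ℕ) (Q : Type) (s : P) : Vars P m Q := Sum.inlₗ s
/-- The variable of an odd coordinate. -/
abbrev varOdd (P Q : Type) (b : Fin m) : Vars P m Q := Sum.inrₗ (Sum.inlₗ (Ix.odd b))
/-- The variable of a momentum. -/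
abbrev varMom (P : Type) (m : ℕ) (k : Q) : Vars P m Q := Sum.inrₗ (Sum.inrₗ k)

theorem vars_cases {C : Vars P m Q → Prop} (h1 : ∀ s, C (varPar m Q s)) (h2 : ∀ b, C (varOdd P Q b))
    (h3 : ∀ k, C (varMom P m k)) (s : Vars P m Q) : C s := by
  rcases s with (s | t)
  · exact h1 s
  · rcases t with (b | k)
    · rcases b with (a | b)
      · exact a.elim0
      · exact h2 b
    · exact h3 k

theorem sum_lex {α β : Type} [Fintype α] [Fintype β] {A : Type*} [AddCommMonoid A]
    (f : α ⊕ₗ β → A) : ∑ s, f s = ∑ a, f (Sum.inlₗ a) + ∑ b, f (Sum.inrₗ b) :=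
  (Fintype.sum_equiv toLex (fun s : α ⊕ β => f (toLex s)) f fun _ => rfl).symm.trans
    (Fintype.sum_sum_type _)

theorem sum_ix {A : Type*} [AddCommMonoid A] (f : Ix n m → A) :
    ∑ k, f k = ∑ a, f (.even a) + ∑ b, f (.odd b) :=
  (Fintype.sum_equiv (Equiv.ofBijective _ Ix.toSum_bijective) f
    (fun s => f ((Equiv.ofBijective _ Ix.toSum_bijective).symm s)) fun k => by simp).trans
    ((sum_lex _).trans (congrArg₂ (· + ·)
      (Finset.sum_congr rfl fun a _ => congrArg f ((Equiv.symm_apply_eq _).2 rfl))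
      (Finset.sum_congr rfl fun a _ => congrArg f ((Equiv.symm_apply_eq _).2 rfl))))

theorem sum_vars {A : Type*} [AddCommMonoid A] (f : Vars P m Q → A) :
    ∑ s, f s = ∑ s, f (varPar m Q s) + (∑ b, f (varOdd P Q b) + ∑ k, f (varMom P m k)) := by
  rw [sum_lex, sum_lex, sum_ix]
  simp

variable {B : SuperWeil}

theorem evalAt_eq_evalV (F : Coef n P m Q) (c : P → B) (x : Ix n m → B) (q : Q → B) :
    evalAt F c x q = evalV F (fun a => x (.even a)) (varVal c x q) := rfl

theorem varVal_par (c : P → B) (x : Ix n m → B) (q : Q → B) (s : P) :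
    varVal c x q (varPar m Q s) = c s := rfl
theorem varVal_odd (c : P → B) (x : Ix n m → B) (q : Q → B) (b : Fin m) :
    varVal c x q (varOdd P Q b) = x (.odd b) := rfl
theorem varVal_mom (c : P → B) (x : Ix n m → B) (q : Q → B) (k : Q) :
    varVal c x q (varMom P m k) = q k := rfl

/-- Parameters, coordinates over `U`, and momenta. -/
structure IsPt (U : Set (Fin n → ℝ)) (c : P → B) (x : Ix n m → B) (q : Q → B) : Prop where
  param : B.IsFormal c
  par : ∀ k, x k ∈ B.gr (Parity.par k)
  body : (fun a => B.aug (x (.even a))) ∈ U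
  mom : B.IsFormal q

theorem SuperWeil.isFormal_zero {σ : Type} [Parity σ] : B.IsFormal (0 : σ → B) :=
  fun _ => ⟨Submodule.zero_mem _, map_zero _⟩

theorem IsPt.vpt {U : Set (Fin n → ℝ)} {c : P → B} {x : Ix n m → B} {q : Q → B}
    (h : IsPt U c x q) : VPt U (fun a => x (.even a)) (varVal c x q) where
  even a := h.par (.even a)
  body := h.body
  formal := vars_cases (fun s => h.param s)
    (fun b => ⟨h.par (.odd b), B.aug_odd (h.par (.odd b))⟩) (fun k => h.mom k)

/-- The coordinates determined by the values of the even coordinates and of the variables. -/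
def coordOf (e : Fin n → B) (v : Vars P m Q → B) : Ix n m → B
  | .even a => e a
  | .odd b => v (varOdd P Q b)

theorem varVal_coordOf (e : Fin n → B) (v : Vars P m Q → B) :
    varVal (fun s => v (varPar m Q s)) (coordOf e v) (fun k => v (varMom P m k)) = v := by
  funext s
  exact vars_cases (C := fun s => varVal (fun s => v (varPar m Q s)) (coordOf e v)
    (fun k => v (varMom P m k)) s = v s) (fun _ => rfl) (fun _ => rfl) (fun _ => rfl) s

theorem VPt.isPt {U : Set (Fin n → ℝ)} {e : Fin n → B} {v : Vars P m Q → B} (h : VPt U e v) :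
    IsPt U (fun s => v (varPar m Q s)) (coordOf e v) (fun k => v (varMom P m k)) where
  param s := h.formal (varPar m Q s)
  par k := match k with
    | .even a => h.even a
    | .odd b => (h.formal (varOdd P Q b)).1
  body := h.body
  mom k := h.formal (varMom P m k)

variable {U : Set (Fin n → ℝ)} {c : P → B} {x : Ix n m → B} {q : Q → B}

/-! ## Values of superfunctions -/

theorem SmoothCoef.dCoord (hU : IsOpen U) {F : Coef n P m Q} (hF : SmoothCoef U F) (k : Ix n m) :
    SmoothCoef U (dCoord k F) :=
  match k with
  | .even a => hF.dEven hU a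
  | .odd _b => hF.dFormal _

theorem SmoothCoef.dMom {F : Coef n P m Q} (hF : SmoothCoef U F) (k : Q) :
    SmoothCoef U (dMom k F) := hF.dFormal _

theorem IsSmoothOn.smoothCoef {F : Coef n P m Q} (hF : IsSmoothOn U F) :
    SmoothCoef U F :=
  ⟨hF.1, fun α s hs h2 x _ => congrFun (hF.2.2 α s hs h2) x⟩

theorem IsSmoothOn.ext {F G : Coef n P m Q} (hF : IsSmoothOn U F) (hG : IsSmoothOn U G)
    (hU : IsOpen U)
    (h : ∀ (B : SuperWeil) (c : P → B) (x : Ix n m → B) (q : Q → B), IsPt U c x q →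
      evalAt F c x q = evalAt G c x q) : F = G := by
  funext α x
  by_cases hx : x ∈ U
  · refine coef_ext hU hF.smoothCoef hG.smoothCoef (fun B e v hp => ?_) α hx
    have := h B _ _ _ hp.isPt
    rw [evalAt_eq_evalV, evalAt_eq_evalV, varVal_coordOf] at this
    exact this
  · rw [hF.2.1 α x hx, hG.2.1 α x hx]

theorem evalAt_expand (hU : IsOpen U) {F : Coef n P m Q} (hF : SmoothCoef U F)
    {I : Submodule ℝ B} (hI : TwoSided I) (h2 : ∀ a ∈ I, ∀ b ∈ I, a * b = 0)
    (h : IsPt U c x q) {δx : Ix n m → B} {δq : Q → B}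
    (hx : ∀ k, δx k ∈ B.gr (Parity.par k)) (hxI : ∀ k, δx k ∈ I)
    (hq : ∀ k, δq k ∈ B.gr (Parity.par k)) (hqI : ∀ k, δq k ∈ I) :
    evalAt F c (fun k => x k + δx k) (fun k => q k + δq k) = evalAt F c x q +
      ∑ k, δx k * evalAt (dCoord k F) c x q + ∑ k, δq k * evalAt (dMom k F) c x q := by
  have hv : varVal c (fun k => x k + δx k) (fun k => q k + δq k) =
      fun s => varVal c x q s + varVal 0 δx δq s := by
    funext s
    exact vars_cases (C := fun s => varVal c (fun k => x k + δx k) (fun k => q k + δq k) s =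
      varVal c x q s + varVal 0 δx δq s) (fun s => (add_zero (c s)).symm) (fun _ => rfl)
      (fun _ => rfl) s
  rw [evalAt_eq_evalV, hv, evalV_expand hU hF hI h2 h.vpt.even h.vpt.body (fun a => hx (.even a))
    (fun a => hxI (.even a)) h.vpt.formal
    (fun s => vars_cases (C := fun s => varVal (0 : P → B) δx δq s ∈ B.gr (Parity.par s))
      (fun s => Submodule.zero_mem _) (fun b => hx (.odd b)) hq s)
    (fun s => vars_cases (C := fun s => varVal (0 : P → B) δx δq s ∈ I)
      (fun s => Submodule.zero_mem _) (fun b => hxI (.odd b)) hqI s), sum_vars, sum_ix]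
  simp only [varVal_par, varVal_odd, varVal_mom, Pi.zero_apply, zero_mul, Finset.sum_const_zero,
    zero_add]
  rw [add_assoc (evalAt F c x q), add_assoc (Finset.sum _ _), ← add_assoc (evalAt F c x q)]
  rfl

theorem aug_sub_mem {K : Submodule ℝ B} (hK : K ≤ LinearMap.ker B.aug.toLinearMap) {a b : B}
    (h : a - b ∈ K) : B.aug a = B.aug b := by
  have : B.aug (a - b) = 0 := hK h
  rwa [map_sub, sub_eq_zero] at this

theorem evalAt_sub_mem {K : Submodule ℝ B} (hK : TwoSided K)
    (hK0 : K ≤ LinearMap.ker B.aug.toLinearMap) (F : Coef n P m Q)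
    {x' : Ix n m → B} {q' : Q → B} (hx : ∀ k, x k - x' k ∈ K) (hq : ∀ k, q k - q' k ∈ K) :
    evalAt F c x q - evalAt F c x' q' ∈ K :=
  evalV_sub_mem hK F (fun a => aug_sub_mem hK0 (hx (.even a))) (fun a => hx (.even a))
    (vars_cases (fun s => by rw [varVal_par, varVal_par, sub_self]; exact K.zero_mem)
      (fun b => hx (.odd b)) hq)

/-- No monomial of `F` is free of parameters and momenta. -/
def FormalOn (U : Set (Fin n → ℝ)) (F : Coef n P m Q) : Prop :=
  ∀ α, (∀ s, α (varPar m Q s) = 0) → (∀ k, α (varMom P m k) = 0) → ∀ x ∈ U, F α x = 0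

/-- The parameters and the momenta. -/
def IsExternal : Vars P m Q → Prop := fun s =>
  (∃ t, s = varPar m Q t) ∨ ∃ k, s = varMom P m k

theorem FormalOn.external {F : Coef n P m Q} (hF : FormalOn U F) (α : Vars P m Q → ℕ)
    (h : ∀ s, IsExternal s → α s = 0) : ∀ x ∈ U, F α x = 0 :=
  hF α (fun s => h _ (Or.inl ⟨s, rfl⟩)) (fun k => h _ (Or.inr ⟨k, rfl⟩))

/-- This is the contraction estimate. Every monomial of F contains a parameter or a momentum, with
value in J, so a change of the coordinates by elements of K is felt only through products of J and
K. It is applied with J the augmentation ideal and K, K' built from two consecutive powers of it. -/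
theorem evalAt_sub_mem_of_formal (hU : IsOpen U) {J K K' : Submodule ℝ B} (hJ : TwoSided J)
    (hK : TwoSided K) (hK' : TwoSided K') (hJK : ∀ a ∈ J, ∀ b ∈ K, a * b ∈ K' ∧ b * a ∈ K')
    (hK0 : K ≤ LinearMap.ker B.aug.toLinearMap) {F : Coef n P m Q} (hF : FormalOn U F)
    (hx : (fun a => B.aug (x (.even a))) ∈ U) {x' : Ix n m → B} {q' : Q → B}
    (hc : ∀ s, c s ∈ J) (hxK : ∀ k, x k - x' k ∈ K)
    (hqK : ∀ k, q k - q' k ∈ K) (hqJ : ∀ k, q k ∈ J) (hqJ' : ∀ k, q' k ∈ J)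
    (hqK' : ∀ k, q k - q' k ∈ K') : evalAt F c x q - evalAt F c x' q' ∈ K' :=
  evalV_sub_mem_of_formal hU hJ hK hK' hJK hF.external hx
    (fun a => aug_sub_mem hK0 (hxK (.even a))) (fun a => hxK (.even a))
    (vars_cases (fun s => by rw [varVal_par, varVal_par, sub_self]; exact K.zero_mem)
      (fun b => hxK (.odd b)) hqK)
    (by
      rintro s (⟨t, rfl⟩ | ⟨k, rfl⟩)
      · simp only [varVal_par, sub_self]
        exact ⟨hc t, hc t, K'.zero_mem⟩
      · exact ⟨hqJ k, hqJ' k, hqK' k⟩)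

theorem evalAt_mem_of_formal (hU : IsOpen U) {J : Submodule ℝ B} (hJ : TwoSided J)
    {F : Coef n P m Q} (hF : FormalOn U F) (hx : (fun a => B.aug (x (.even a))) ∈ U)
    (hc : ∀ s, c s ∈ J) (hq : ∀ k, q k ∈ J) : evalAt F c x q ∈ J :=
  evalV_mem_of_formal hU hJ hF.external hx (by
    rintro s (⟨t, rfl⟩ | ⟨k, rfl⟩)
    · exact hc t
    · exact hq k)

theorem twoSided_bot : TwoSided (⊥ : Submodule ℝ B) := by
  intro a b hb
  rw [Submodule.mem_bot] at hb
  subst hb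
  simp

theorem FormalOn.evalAt_zero (hU : IsOpen U) {F : Coef n P m Q} (hF : FormalOn U F)
    (hx : (fun a => B.aug (x (.even a))) ∈ U) : evalAt F (0 : P → B) x (0 : Q → B) = 0 :=
  (Submodule.mem_bot ℝ).1 (evalAt_mem_of_formal hU twoSided_bot hF hx
    (fun _ => Submodule.zero_mem _) fun _ => Submodule.zero_mem _)

/-- Differentiation in a coordinate removes neither parameters nor momenta from a monomial. -/
theorem FormalOn.dCoord (hU : IsOpen U) {F : Coef n P m Q} (hF : FormalOn U F) (k : Ix n m) :
    FormalOn U (dCoord k F) := by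
  intro α h1 h2 x hx
  match k with
  | .even a =>
    have h0 : F α =ᶠ[𝓝 x] fun _ => 0 :=
      Filter.eventually_of_mem (hU.mem_nhds hx) fun y hy => hF α h1 h2 y hy
    change fderiv ℝ (F α) x (Pi.single a 1) = 0
    rw [h0.fderiv_eq]
    simp
  | .odd b =>
    change _ * F (α + Pi.single (varOdd P Q b) 1) x = 0
    rw [hF _ _ _ x hx, mul_zero]
    · intro s
      rw [Pi.add_apply, h1, Pi.single_eq_of_ne (by intro h; cases h), add_zero]
    · intro s
      rw [Pi.add_apply, h2, Pi.single_eq_of_ne (by intro h; cases h), add_zero]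

theorem evalAt_congr (hU : IsOpen U) {F G : Coef n P m Q} (h : IsPt U c x q)
    (hFG : ∀ α, ∀ x ∈ U, F α x = G α x) : evalAt F c x q = evalAt G c x q :=
  evalV_congr hU _ h.body h.vpt.aug_zero fun α _ => hFG α

theorem aug_evalAt (F : Coef n P m Q) (h : IsPt U c x q) :
    B.aug (evalAt F c x q) = F 0 fun a => B.aug (x (.even a)) :=
  aug_evalV F _ h.vpt.aug_zero

theorem aug_evalAt_dMom (F : Coef n P m Q) (h : IsPt U c x q) (k : Q) :
    B.aug (evalAt (dMom k F) c x q) =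
      F (Pi.single (varMom P m k) 1) fun a => B.aug (x (.even a)) := by
  rw [aug_evalAt _ h]
  change (-1) ^ (_ * ∑ t ∈ _, _ * 0) * (((0 : ℕ) : ℝ) + 1) * F (0 + Pi.single _ 1) _ = _
  simp

theorem evalAt_mem (hU : IsOpen U) {p : ZMod 2} {F : Coef n P m Q} (hF : IsHomog p F)
    (h : IsPt U c x q) : evalAt F c x q ∈ B.gr p :=
  evalV_mem hU (fun α x _ => hF α x) h.vpt.even h.vpt.body fun s => (h.vpt.formal s).1

theorem IsHomog.dVar {p : ZMod 2} {F : Coef n P m Q} (hF : IsHomog p F) (s : Vars P m Q) :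
    IsHomog (p + Parity.par s) (dVar s F) := by
  intro α x h
  have := hF _ x (right_ne_zero_of_mul h)
  rw [← this]
  simp only [Pi.add_apply, Nat.cast_add, add_mul, Finset.sum_add_distrib]
  rw [add_assoc, Finset.sum_eq_single (a := s) (f := fun t => ((Pi.single s 1 : Vars P m Q → ℕ) t : ZMod 2) *
    Parity.par t)]
  · rw [Pi.single_eq_same, Nat.cast_one, one_mul, CharTwo.add_self_eq_zero, add_zero]
  · intro t _ hts
    rw [Pi.single_eq_of_ne hts, Nat.cast_zero, zero_mul]
  · intro hs
    exact absurd (Finset.mem_univ _) hs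

theorem IsHomog.dMom {p : ZMod 2} {F : Coef n P m Q} (hF : IsHomog p F) (k : Q) :
    IsHomog (p + Parity.par k) (dMom k F) := hF.dVar _

theorem evalAt_dCoord_mem (hU : IsOpen U) {p : ZMod 2} {F : Coef n P m Q} (hF : IsHomog p F)
    (h : IsPt U c x q) (k : Ix n m) : evalAt (dCoord k F) c x q ∈ B.gr (p + Parity.par k) := by
  match k with
  | .even a =>
    have : p + Parity.par (Ix.even (m := m) a) = p := add_zero p
    rw [this]
    refine evalV_mem hU (F := dEven a F) ?_ h.vpt.even h.vpt.body fun s => (h.vpt.formal s).1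
    intro α y hy hne
    by_contra hα
    have : F α = fun _ => 0 := by
      funext z
      by_contra hz
      exact hα (hF α z hz)
    refine hne ?_
    change fderiv ℝ (F α) y (Pi.single a 1) = 0
    rw [this]
    simp
  | .odd b => exact evalAt_mem hU (hF.dVar _) h

/-! ## Change of test algebra -/

theorem IsPt.map (h : IsPt U c x q) (p : ZMod 2) :
    IsPt U (fun s => B.epsInl p (c s)) (fun k => B.epsInl p (x k)) fun k => B.epsInl p (q k) where
  param s := ⟨SuperWeil.epsInl_mem (h.param s).1, (h.param s).2⟩
  par k := SuperWeil.epsInl_mem (h.par k)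
  body := h.body
  mom s := ⟨SuperWeil.epsInl_mem (h.mom s).1, (h.mom s).2⟩

theorem evalAt_map (F : Coef n P m Q) (h : IsPt U c x q) (p : ZMod 2) :
    evalAt F (fun s => B.epsInl p (c s)) (fun k => B.epsInl p (x k)) (fun k => B.epsInl p (q k)) =
      B.epsInl p (evalAt F c x q) := by
  have hv : varVal (fun s => B.epsInl p (c s)) (fun k => B.epsInl p (x k))
      (fun k => B.epsInl p (q k)) = fun s => B.epsInl p (varVal (m := m) c x q s) := by
    funext s
    exact vars_cases (C := fun s => varVal (fun s => B.epsInl p (c s)) (fun k => B.epsInl p (x k))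
      (fun k => B.epsInl p (q k)) s = B.epsInl p (varVal (m := m) c x q s))
      (fun _ => rfl) (fun _ => rfl) (fun _ => rfl) s
  rw [evalAt_eq_evalV, hv, evalAt_eq_evalV,
    evalV_map _ (fun _ => SuperWeil.epsInl_aug _) _ _ h.vpt.aug_zero]

/-- The infinitesimal increment of the variable `k`. -/
def epsSingle (B : SuperWeil) {σ : Type} [DecidableEq σ] [Parity σ] (k : σ) : σ → B.eps (Parity.par k) :=
  fun t => if t = k then B.epsGen (Parity.par k) else 0

theorem epsSingle_mem {σ : Type} [DecidableEq σ] [Parity σ] (k t : σ) :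
    epsSingle B k t ∈ (B.eps (Parity.par k)).gr (Parity.par t) := by
  unfold epsSingle
  split_ifs with h
  · rw [h]
    exact SuperWeil.epsGen_mem
  · exact Submodule.zero_mem _

theorem epsSingle_mem_ideal {σ : Type} [DecidableEq σ] [Parity σ] (k t : σ) :
    epsSingle B k t ∈ B.epsIdeal (Parity.par k) := by
  unfold epsSingle
  split_ifs with h
  · exact SuperWeil.epsGen_mem_ideal
  · exact Submodule.zero_mem _

theorem epsIdeal_le (p : ZMod 2) : B.epsIdeal p ≤ LinearMap.ker (B.eps p).aug.toLinearMap := by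
  intro x hx
  change B.aug (Eps.re (p := p) x) = 0
  rw [SuperWeil.mem_epsIdeal.1 hx, map_zero]

theorem IsPt.add {K : Submodule ℝ B} (hK : K ≤ LinearMap.ker B.aug.toLinearMap) (h : IsPt U c x q)
    {δx : Ix n m → B} {δq : Q → B}
    (hx : ∀ k, δx k ∈ B.gr (Parity.par k)) (hxI : ∀ k, δx k ∈ K)
    (hq : ∀ k, δq k ∈ B.gr (Parity.par k)) (hqI : ∀ k, δq k ∈ K) :
    IsPt U c (fun k => x k + δx k) fun k => q k + δq k where
  param := h.param
  par k := Submodule.add_mem _ (h.par k) (hx k)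
  body := by
    have : (fun a => B.aug (x (.even a) + δx (.even a))) = fun a => B.aug (x (.even a)) := by
      funext a
      have : B.aug (δx (.even a)) = 0 := hK (hxI _)
      rw [map_add, this, add_zero]
    rw [this]
    exact h.body
  mom k := ⟨Submodule.add_mem _ (h.mom k).1 (hq k), by
    have : B.aug (δq k) = 0 := hK (hqI _)
    rw [map_add, (h.mom k).2, this, add_zero]⟩

theorem evalAt_eps_coord (hU : IsOpen U) {F : Coef n P m Q} (hF : SmoothCoef U F)
    (h : IsPt U c x q) (k : Ix n m) :
    evalAt F (fun s => B.epsInl (Parity.par k) (c s))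
      (fun t => B.epsInl (Parity.par k) (x t) + epsSingle B k t)
      (fun t => B.epsInl (Parity.par k) (q t)) =
      B.epsInl (Parity.par k) (evalAt F c x q) +
        B.epsGen (Parity.par k) * B.epsInl (Parity.par k) (evalAt (dCoord k F) c x q) := by
  have := evalAt_expand hU hF SuperWeil.epsIdeal_twoSided SuperWeil.epsIdeal_sq
    (h.map (Parity.par k)) (δx := epsSingle B k) (δq := 0) (epsSingle_mem k)
    (epsSingle_mem_ideal k) (fun _ => Submodule.zero_mem _) (fun _ => Submodule.zero_mem _)
  simp only [Pi.zero_apply, add_zero, zero_mul, Finset.sum_const_zero, epsSingle, ite_mul,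
    Finset.sum_ite_eq', Finset.mem_univ, if_true] at this
  rw [evalAt_map _ h, evalAt_map _ h] at this
  exact this

theorem evalAt_eps_mom (hU : IsOpen U) {F : Coef n P m Q} (hF : SmoothCoef U F)
    (h : IsPt U c x q) (k : Q) :
    evalAt F (fun s => B.epsInl (Parity.par k) (c s)) (fun t => B.epsInl (Parity.par k) (x t))
      (fun t => B.epsInl (Parity.par k) (q t) + epsSingle B k t) =
      B.epsInl (Parity.par k) (evalAt F c x q) +
        B.epsGen (Parity.par k) * B.epsInl (Parity.par k) (evalAt (dMom k F) c x q) := by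
  have := evalAt_expand hU hF SuperWeil.epsIdeal_twoSided SuperWeil.epsIdeal_sq
    (h.map (Parity.par k)) (δx := 0) (δq := epsSingle B k) (fun _ => Submodule.zero_mem _)
    (fun _ => Submodule.zero_mem _) (epsSingle_mem k) (epsSingle_mem_ideal k)
  simp only [Pi.zero_apply, add_zero, zero_mul, Finset.sum_const_zero, epsSingle, ite_mul,
    Finset.sum_ite_eq', Finset.mem_univ, if_true] at this
  rw [evalAt_map _ h, evalAt_map _ h] at this
  exact this

/-- Derivatives are computed by this criterion: expand over B[ε] and identify the coefficient of ε.
The chain rule for coefficient families is never written out. -/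
theorem evalAt_dCoord_eq (hU : IsOpen U) {F : Coef n P m Q} (hF : SmoothCoef U F)
    (h : IsPt U c x q) (k : Ix n m) {b : B}
    (hb : evalAt F (fun s => B.epsInl (Parity.par k) (c s))
      (fun t => B.epsInl (Parity.par k) (x t) + epsSingle B k t)
      (fun t => B.epsInl (Parity.par k) (q t)) =
      B.epsInl (Parity.par k) (evalAt F c x q) +
        B.epsGen (Parity.par k) * B.epsInl (Parity.par k) b) : evalAt (dCoord k F) c x q = b := by
  rw [evalAt_eps_coord hU hF h k] at hb
  exact SuperWeil.epsGen_mul_inl_injective (add_left_cancel hb)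

theorem evalAt_dMom_eq (hU : IsOpen U) {F : Coef n P m Q} (hF : SmoothCoef U F)
    (h : IsPt U c x q) (k : Q) {b : B}
    (hb : evalAt F (fun s => B.epsInl (Parity.par k) (c s)) (fun t => B.epsInl (Parity.par k) (x t))
      (fun t => B.epsInl (Parity.par k) (q t) + epsSingle B k t) =
      B.epsInl (Parity.par k) (evalAt F c x q) +
        B.epsGen (Parity.par k) * B.epsInl (Parity.par k) b) : evalAt (dMom k F) c x q = b := by
  rw [evalAt_eps_mom hU hF h k] at hb
  exact SuperWeil.epsGen_mul_inl_injective (add_left_cancel hb)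

/-! ## Representable functions -/

/-- A function of parameters, coordinates and momenta in arbitrary test algebras. -/
abbrev ValFun (n : ℕ) (P : Type) (m : ℕ) (Q : Type) : Type 1 :=
  ∀ B : SuperWeil, (P → B) → (Ix n m → B) → (Q → B) → B

/-- `T` as a function of even coordinates and formal variables. -/
def ValFun.toPtFun (T : ValFun n P m Q) : PtFun n (Vars P m Q) := fun B e v =>
  T B (fun s => v (varPar m Q s)) (coordOf e v) fun k => v (varMom P m k)

/-- `T` is polynomial on test algebras of order at most `N`. -/
def IsRepN (U : Set (Fin n → ℝ)) (N : ℕ) (T : ValFun n P m Q) : Prop := RepN U N T.toPtFun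

theorem isRepN_param (N : ℕ) (s : P) : IsRepN (m := m) (Q := Q) U N fun _ c _ _ => c s :=
  repN_var (varPar m Q s)

theorem isRepN_mom (N : ℕ) (k : Q) : IsRepN (P := P) (m := m) U N fun _ _ _ q => q k :=
  repN_var (varMom P m k)

theorem isRepN_coord (N : ℕ) (k : Ix n m) : IsRepN (P := P) (Q := Q) U N fun _ _ x _ => x k :=
  match k with
  | .even a => repN_coord a
  | .odd b => repN_var (varOdd P Q b)

theorem isRepN_zero (N : ℕ) : IsRepN (P := P) (m := m) (Q := Q) U N fun _ _ _ _ => 0 :=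
  (repN_const 0).congr fun B _ _e _v _ => (map_zero (algebraMap ℝ B)).symm

variable {N : ℕ} {T T' : ValFun n P m Q}

theorem IsRepN.add (h : IsRepN U N T) (h' : IsRepN U N T') :
    IsRepN U N fun B c x q => T B c x q + T' B c x q := RepN.add h h'

theorem IsRepN.mul (hU : IsOpen U) (h : IsRepN U N T) (h' : IsRepN U N T') :
    IsRepN U N fun B c x q => T B c x q * T' B c x q := RepN.mul hU h h'

theorem IsRepN.sub (hU : IsOpen U) (h : IsRepN U N T) (h' : IsRepN U N T') :
    IsRepN U N fun B c x q => T B c x q - T' B c x q := RepN.sub hU h h'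

theorem IsRepN.sum {κ : Type} (s : Finset κ) {T : κ → ValFun n P m Q}
    (h : ∀ k ∈ s, IsRepN U N (T k)) : IsRepN U N fun B c x q => ∑ k ∈ s, T k B c x q :=
  RepN.sum s h

theorem IsRepN.sgn_mul (hU : IsOpen U) {σ : Type} [Parity σ] (k : σ) (h : IsRepN U N T) :
    IsRepN U N fun B c x q => sgn B k * T B c x q :=
  (RepN.smul hU ((-1) ^ (Parity.par k : ZMod 2).val) h).congr fun B _ e v _ => by
    rw [Algebra.smul_def]
    simp [ValFun.toPtFun, sgn]

theorem IsRepN.comp (hU : IsOpen U) {n' m' : ℕ} {P' Q' : Type} [Fintype P'] [LinearOrder P']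
    [Parity P'] [Fintype Q'] [LinearOrder Q'] [Parity Q'] {V : Set (Fin n' → ℝ)} (hV : IsOpen V)
    {F : Coef n' P' m' Q'} (hF : SmoothCoef V F) {C : P' → ValFun n P m Q}
    {X : Ix n' m' → ValFun n P m Q} {R : Q' → ValFun n P m Q} (hC : ∀ s, IsRepN U N (C s))
    (hX : ∀ k, IsRepN U N (X k)) (hR : ∀ k, IsRepN U N (R k))
    (hp : ∀ (B : SuperWeil) (c : P → B) (x : Ix n m → B) (q : Q → B), IsPt U c x q →
      IsPt V (fun s => C s B c x q) (fun k => X k B c x q) fun k => R k B c x q) :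
    IsRepN U N fun B c x q => evalAt F (fun s => C s B c x q) (fun k => X k B c x q)
      fun k => R k B c x q := by
  refine RepN.comp hU hV hF (y := fun a => (X (.even a)).toPtFun)
    (w := fun s B e v => varVal (fun s => (C s).toPtFun B e v) (fun k => (X k).toPtFun B e v)
      (fun k => (R k).toPtFun B e v) s) (fun a => hX _) (vars_cases hC (fun b => hX _) hR) ?_
  intro B e v h
  exact (hp B _ _ _ h.isPt).vpt

theorem SmoothCoef.isRepN {F : Coef n P m Q} (hF : SmoothCoef U F) (N : ℕ) :
    IsRepN U N fun _ c x q => evalAt F c x q :=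
  (SmoothCoef.repN hF N).congr fun B _ e v _ => by
    simp only [ValFun.toPtFun]
    rw [evalAt_eq_evalV, varVal_coordOf]
    rfl

theorem coordOf_varVal (c : P → B) (x : Ix n m → B) (q : Q → B) :
    coordOf (fun a => x (.even a)) (varVal c x q) = x := by
  funext k
  cases k <;> rfl

theorem gr_inf {a : B} {p : ZMod 2} (h : a ∈ B.gr p) (h' : a ∈ B.gr (p + 1)) : a = 0 := by
  have h1 := B.proj_of_mem h
  rw [B.proj_of_mem_ne h' (by rcases zmod_two_cases p with rfl | rfl <;> decide)] at h1
  exact h1.symm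

-- A representing family may contain monomials of the wrong parity and is arbitrary off U, so both
-- are cut off. The discarded monomials on U contribute an element of parity p + 1. It is also a
-- difference of two elements of parity p, hence zero.
open Classical in
theorem exists_superfunction (hU : IsOpen U) (hT : ∀ N, IsRepN U N T) {p : ZMod 2}
    (hp : ∀ (B : SuperWeil) (c : P → B) (x : Ix n m → B) (q : Q → B), IsPt U c x q →
      T B c x q ∈ B.gr p) :
    ∃ F : Coef n P m Q, IsSmoothOn U F ∧ IsHomog p F ∧
      ∀ (B : SuperWeil) (c : P → B) (x : Ix n m → B) (q : Q → B), IsPt U c x q →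
        evalAt F c x q = T B c x q := by
  obtain ⟨F, hF, hFT⟩ := rep_of_repN hU hT
  let π : (Vars P m Q → ℕ) → ZMod 2 := fun α => ∑ s, (α s : ZMod 2) * Parity.par s
  let G : Coef n P m Q := fun α x => if π α = p ∧ x ∈ U then F α x else 0
  have hG1 : ∀ α, π α = p → ∀ x ∈ U, G α x = F α x := fun α h x hx => if_pos ⟨h, hx⟩
  have hG0 : ∀ α, π α ≠ p → G α = fun _ => 0 := fun α h => funext fun x => if_neg fun h' => h h'.1
  refine ⟨G, ⟨fun α => ?_, fun α x hx => if_neg fun h => hx h.2, fun α s hs h2 => ?_⟩, ?_, ?_⟩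
  · by_cases hα : π α = p
    · exact (hF.1 α).congr (hG1 α hα)
    · rw [hG0 α hα]
      exact contDiffOn_const
  · funext x
    by_cases h : π α = p ∧ x ∈ U
    · exact (if_pos h).trans (hF.2 α s hs h2 x h.2)
    · exact if_neg h
  · intro α x h
    by_contra hα
    exact h (congrFun (hG0 α hα) x)
  · intro B c x q h
    have hT0 : T B c x q = evalAt F c x q := by
      have := hFT B _ _ h.vpt
      rw [← evalAt_eq_evalV] at this
      rw [← this]
      unfold ValFun.toPtFun
      rw [coordOf_varVal]
      rfl
    have hv := h.vpt
    have hterm : ∀ α, evalSmooth B (F α) (fun a => x (.even a)) * mono (varVal c x q) α ∈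
        B.gr (π α) := fun α =>
      B.mul_mem_even (evalSmooth_mem _ _ hv.even) (mono_mem (fun s => (hv.formal s).1) α)
    have hsum : evalAt F c x q = evalAt G c x q +
        ∑ α ∈ (box (Vars P m Q) B.order).filter (fun α => ¬ π α = p),
          evalSmooth B (F α) (fun a => x (.even a)) * mono (varVal c x q) α := by
      rw [evalAt_eq_evalV, evalAt_eq_evalV, evalV_eq_sum_box F _ hv.aug_zero le_rfl,
        evalV_eq_sum_box G _ hv.aug_zero le_rfl,
        ← Finset.sum_filter_add_sum_filter_not (box (Vars P m Q) B.order) (fun α => π α = p)]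
      congr 1
      rw [Finset.sum_filter]
      refine Finset.sum_congr rfl fun α _ => ?_
      split_ifs with hα
      · rw [evalSmooth_congr _ (Filter.eventually_of_mem (hU.mem_nhds hv.body) (hG1 α hα))]
      · rw [hG0 α hα, evalSmooth_zero, zero_mul]
    have hGmem : evalAt G c x q ∈ B.gr p := by
      refine evalV_mem hU ?_ hv.even hv.body fun s => (hv.formal s).1
      intro α x _ h
      by_contra hα
      exact h (congrFun (hG0 α hα) x)
    have hz : ∑ α ∈ (box (Vars P m Q) B.order).filter (fun α => ¬ π α = p),
          evalSmooth B (F α) (fun a => x (.even a)) * mono (varVal c x q) α = 0 := by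
      refine gr_inf (p := p) ?_ ?_
      · have := Submodule.sub_mem _ (hp B c x q h) hGmem
        rwa [hT0, hsum, add_sub_cancel_left] at this
      · refine Submodule.sum_mem _ fun α hα => ?_
        have h1 := (Finset.mem_filter.1 hα).2
        have : π α = p + 1 := by
          rcases zmod_two_cases (π α) with e | e <;> rcases zmod_two_cases p with rfl | rfl <;>
            rw [e] at h1 ⊢ <;> revert h1 <;> decide
        rw [← this]
        exact hterm α
    rw [hT0, hsum, hz, add_zero]

end Values

/-! ## Powers of the augmentation ideal -/

section Nil

variable {B : SuperWeil}

/-- The augmentation ideal. -/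
def SuperWeil.nil (B : SuperWeil) : Submodule ℝ B := LinearMap.ker B.aug.toLinearMap

theorem SuperWeil.mem_nil {b : B} : b ∈ B.nil ↔ B.aug b = 0 := Iff.rfl

theorem SuperWeil.nil_twoSided (B : SuperWeil) : TwoSided B.nil := by
  intro a b hb
  rw [SuperWeil.mem_nil] at hb
  simp [SuperWeil.mem_nil, hb]

/-- The powers of the augmentation ideal. -/
def SuperWeil.nilPow (B : SuperWeil) (k : ℕ) : Submodule ℝ B :=
  Submodule.span ℝ {b | ∃ l : List B, k ≤ l.length ∧ (∀ a ∈ l, B.aug a = 0) ∧ l.prod = b}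

theorem SuperWeil.nilPow_eq_bot (B : SuperWeil) {k : ℕ} (hk : B.order ≤ k) : B.nilPow k = ⊥ := by
  refine Submodule.span_eq_bot.2 ?_
  rintro b ⟨l, hl, h, rfl⟩
  exact B.nilp l (hk.trans hl) h

theorem SuperWeil.nil_mul_nilPow (B : SuperWeil) {k : ℕ} {a b : B} (ha : a ∈ B.nil)
    (hb : b ∈ B.nilPow k) : a * b ∈ B.nilPow (k + 1) ∧ b * a ∈ B.nilPow (k + 1) := by
  induction hb using Submodule.span_induction with
  | mem b hb =>
    obtain ⟨l, hl, h, rfl⟩ := hb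
    refine ⟨Submodule.subset_span ⟨a :: l, by simp; omega, ?_, by simp⟩,
      Submodule.subset_span ⟨l ++ [a], by simp; omega, ?_, by simp⟩⟩
    · intro b hb
      rcases List.mem_cons.1 hb with rfl | hb
      · exact ha
      · exact h b hb
    · intro b hb
      rcases List.mem_append.1 hb with hb | hb
      · exact h b hb
      · rw [List.mem_singleton.1 hb]
        exact ha
  | zero => simp
  | add x y _ _ hx hy =>
    rw [mul_add, add_mul]
    exact ⟨Submodule.add_mem _ hx.1 hy.1, Submodule.add_mem _ hx.2 hy.2⟩
  | smul r x _ hx =>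
    rw [mul_smul_comm, smul_mul_assoc]
    exact ⟨Submodule.smul_mem _ _ hx.1, Submodule.smul_mem _ _ hx.2⟩

theorem SuperWeil.nilPow_succ_le (B : SuperWeil) (k : ℕ) : B.nilPow (k + 1) ≤ B.nilPow k :=
  Submodule.span_mono fun _b ⟨l, hl, h⟩ => ⟨l, (Nat.le_succ k).trans hl, h⟩

theorem SuperWeil.nilPow_twoSided (B : SuperWeil) (k : ℕ) : TwoSided (B.nilPow k) := by
  intro a b hb
  have ha : a = algebraMap ℝ B (B.aug a) + (a - algebraMap ℝ B (B.aug a)) := by abel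
  have hn := B.nil_mul_nilPow (B.mem_nil.2 (SuperWeil.aug_nil a)) hb
  rw [ha, add_mul, mul_add, ← Algebra.smul_def, ← Algebra.commutes, ← Algebra.smul_def]
  exact ⟨Submodule.add_mem _ (Submodule.smul_mem _ _ hb) (B.nilPow_succ_le k hn.1),
    Submodule.add_mem _ (Submodule.smul_mem _ _ hb) (B.nilPow_succ_le k hn.2)⟩

theorem SuperWeil.mem_nilPow_one {b : B} (hb : b ∈ B.nil) : b ∈ B.nilPow 1 :=
  Submodule.subset_span ⟨[b], by simp, by simpa using SuperWeil.mem_nil.1 hb, by simp⟩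

theorem SuperWeil.nilPow_le_nil (B : SuperWeil) (k : ℕ) : B.nilPow (k + 1) ≤ B.nil := by
  refine Submodule.span_le.2 ?_
  rintro b ⟨l, hl, h, rfl⟩
  cases l with
  | nil => simp at hl
  | cons a l =>
    change B.aug (List.prod (a :: l)) = 0
    rw [List.prod_cons, map_mul, h a (by simp), zero_mul]

theorem TwoSided.sup {I K : Submodule ℝ B} (hI : TwoSided I) (hK : TwoSided K) :
    TwoSided (I ⊔ K) := by
  intro a b hb
  obtain ⟨i, hi, k, hk, rfl⟩ := Submodule.mem_sup.1 hb
  rw [mul_add, add_mul]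
  exact ⟨Submodule.add_mem_sup (hI a i hi).1 (hK a k hk).1,
    Submodule.add_mem_sup (hI a i hi).2 (hK a k hk).2⟩

variable {σ : Type} [Parity σ]

theorem sgn_mul_self (k : σ) : sgn B k * sgn B k = 1 := by
  unfold sgn
  rw [← pow_add]
  exact Even.neg_one_pow ⟨_, rfl⟩

theorem sgn_mul_sgn_mul (k : σ) (a : B) : sgn B k * (sgn B k * a) = a := by
  rw [← mul_assoc, sgn_mul_self, one_mul]

theorem sgn_mul_mem (k : σ) {p : ZMod 2} {a : B} (ha : a ∈ B.gr p) : sgn B k * a ∈ B.gr p := by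
  unfold sgn
  rcases neg_one_pow_eq_or B (Parity.par k : ZMod 2).val with h | h <;> rw [h]
  · rwa [one_mul]
  · rw [neg_one_mul]
    exact Submodule.neg_mem _ ha

theorem sgn_mul_mem_of_mem {K : Submodule ℝ B} (k : σ) {a : B} (ha : a ∈ K) : sgn B k * a ∈ K := by
  unfold sgn
  rcases neg_one_pow_eq_or B (Parity.par k : ZMod 2).val with h | h <;> rw [h]
  · rwa [one_mul]
  · rw [neg_one_mul]
    exact Submodule.neg_mem _ ha

theorem sgn_mul_comm (k : σ) {a b : B} (ha : a ∈ B.gr (Parity.par k))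
    (hb : b ∈ B.gr (Parity.par k)) : a * b = sgn B k * (b * a) := by
  rw [B.supercomm _ _ _ _ ha hb]
  unfold sgn
  rcases zmod_two_cases (Parity.par k : ZMod 2) with h | h <;> rw [h] <;> rfl

theorem sgn_comm (k : σ) (a : B) : a * sgn B k = sgn B k * a := by
  unfold sgn
  rcases neg_one_pow_eq_or B (Parity.par k : ZMod 2).val with h | h <;> rw [h] <;> simp

/-- For y = ±∂S/∂q this turns the increment δq ∂S/∂q into y δq, in the order in which it occurs in
the variation of yq. -/
theorem mul_sgn_mul (k : σ) {a b : B} (ha : a ∈ B.gr (Parity.par k))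
    (hb : b ∈ B.gr (Parity.par k)) : a * (sgn B k * b) = b * a := by
  rw [← mul_assoc, sgn_comm, mul_assoc, sgn_mul_comm k ha hb, sgn_mul_sgn_mul]

end Nil

/-! ## The system for the composition in coordinates -/

section Local

variable {n₁ m₁ n₂ m₂ : ℕ} {P Q : Type} [Fintype P] [LinearOrder P] [Parity P]
  [Fintype Q] [LinearOrder Q] [Parity Q]

/-- `(y, q)` solves `q = ∂F₃₂/∂y (y, r)`, `y = ±∂F₂₁/∂q (x, q)`. -/
def LSol (F₃₂ : Coef n₂ P m₂ Q) (F₂₁ : Coef n₁ P m₁ (Ix n₂ m₂)) {B : SuperWeil} (c : P → B)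
    (x : Ix n₁ m₁ → B) (r : Q → B) (y q : Ix n₂ m₂ → B) : Prop :=
  B.IsFormal q ∧ (∀ k, q k = evalAt (dCoord k F₃₂) c y r) ∧
    ∀ k, y k = sgn B k * evalAt (dMom k F₂₁) c x q

/-- Composable superfunctions over `V` and `U`. -/
structure LocalPair (U : Set (Fin n₁ → ℝ)) (V : Set (Fin n₂ → ℝ)) (F₃₂ : Coef n₂ P m₂ Q)
    (F₂₁ : Coef n₁ P m₁ (Ix n₂ m₂)) : Prop where
  openU : IsOpen U
  openV : IsOpen V
  smooth₃₂ : SmoothCoef V F₃₂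
  smooth₂₁ : SmoothCoef U F₂₁
  even₃₂ : IsHomog 0 F₃₂
  even₂₁ : IsHomog 0 F₂₁
  formal : FormalOn V F₃₂
  maps : ∀ x ∈ U, (fun a => F₂₁ (Pi.single (varMom P m₁ (Ix.even a)) 1) x) ∈ V

variable {U : Set (Fin n₁ → ℝ)} {V : Set (Fin n₂ → ℝ)} {F₃₂ : Coef n₂ P m₂ Q}
  {F₂₁ : Coef n₁ P m₁ (Ix n₂ m₂)} {B : SuperWeil} {c : P → B} {x : Ix n₁ m₁ → B} {r : Q → B}
  {y q : Ix n₂ m₂ → B}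

theorem IsPt.withMom {n m : ℕ} {U : Set (Fin n → ℝ)} {Q' : Type} [Fintype Q'] [LinearOrder Q']
    [Parity Q'] {x : Ix n m → B} (h : IsPt U c x r) {q : Q' → B} (hq : B.IsFormal q) :
    IsPt U c x q := ⟨h.param, h.par, h.body, hq⟩

theorem aug_sgn_dMom_even (h : IsPt U c x q) (a : Fin n₂) :
    B.aug (sgn B (Ix.even (m := m₂) a) * evalAt (dMom (Ix.even a) F₂₁) c x q) =
      F₂₁ (Pi.single (varMom P m₁ (Ix.even a)) 1) fun a => B.aug (x (.even a)) := by
  have : sgn B (Ix.even (m := m₂) a) = 1 := pow_zero _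
  rw [this, one_mul, aug_evalAt_dMom F₂₁ h]

/-- Whatever the nilpotent q, the body of an even coordinate of y is the linear coefficient of
`F₂₁`, so y stays over V. -/
theorem LocalPair.target (L : LocalPair U V F₃₂ F₂₁) (h : IsPt U c x r) (hq : B.IsFormal q)
    (hy : ∀ k, y k = sgn B k * evalAt (dMom k F₂₁) c x q) : IsPt V c y r where
  param := h.param
  par k := by
    rw [hy]
    have := evalAt_mem L.openU (L.even₂₁.dMom k) (h.withMom hq)
    rw [zero_add] at this
    exact sgn_mul_mem k this
  body := by
    have : (fun a => B.aug (y (.even a))) = _ :=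
      funext fun a => (congrArg B.aug (hy (.even a))).trans (aug_sgn_dMom_even (h.withMom hq) a)
    rw [this]
    exact L.maps _ h.body
  mom := h.mom

theorem LSol.target (L : LocalPair U V F₃₂ F₂₁) (h : IsPt U c x r)
    (s : LSol F₃₂ F₂₁ c x r y q) : IsPt V c y r := L.target h s.1 s.2.2

/-- Nilpotency of the new momenta is where formality of `F₃₂` enters: each monomial of the
derivative has a nilpotent factor. -/
theorem LocalPair.dCoord_isFormal (L : LocalPair U V F₃₂ F₂₁) (h : IsPt V c y r) :
    B.IsFormal fun k => evalAt (dCoord k F₃₂) c y r := fun k =>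
  ⟨by simpa using evalAt_dCoord_mem L.openV L.even₃₂ h k,
    evalAt_mem_of_formal L.openV B.nil_twoSided (L.formal.dCoord L.openV k) h.body
      (fun s => (h.param s).2) fun k => (h.mom k).2⟩

/-- By the contraction, the difference of two solutions q lies in I plus the k-th power of the
augmentation ideal for every k ≥ 1, hence in I. For I = 0 this is uniqueness. For I of square zero
it says that an infinitesimal change of the data moves the solution only infinitesimally. -/
theorem LSol.sub_mem (L : LocalPair U V F₃₂ F₂₁) {I : Submodule ℝ B} (hI : TwoSided I)
    (hI0 : I ≤ B.nil) (h : IsPt U c x r) (s : LSol F₃₂ F₂₁ c x r y q)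
    {x' : Ix n₁ m₁ → B} {r' : Q → B} {y' q' : Ix n₂ m₂ → B}
    (h' : IsPt U c x' r') (s' : LSol F₃₂ F₂₁ c x' r' y' q') (hx : ∀ k, x k - x' k ∈ I)
    (hr : ∀ k, r k - r' k ∈ I) : (∀ k, y k - y' k ∈ I) ∧ ∀ k, q k - q' k ∈ I := by
  -- The equation for y gains no order in the filtration. The gain comes from the equation for q
  -- alone.
  have hy : ∀ K : Submodule ℝ B, TwoSided K → K ≤ B.nil → I ≤ K → (∀ k, q k - q' k ∈ K) →
      ∀ k, y k - y' k ∈ K := by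
    intro K hK hK0 hIK hq k
    rw [s.2.2, s'.2.2, ← mul_sub]
    exact sgn_mul_mem_of_mem k (evalAt_sub_mem hK hK0 _ (fun k => hIK (hx k)) hq)
  have hq : ∀ N : ℕ, ∀ k, q k - q' k ∈ I ⊔ B.nilPow (N + 1) := by
    intro N
    induction N with
    | zero =>
      intro k
      refine Submodule.mem_sup_right (SuperWeil.mem_nilPow_one ?_)
      exact Submodule.sub_mem _ (s.1 k).2 (s'.1 k).2
    | succ N ih =>
      intro k
      have hK := hI.sup (B.nilPow_twoSided (N + 1))
      have hK0 : I ⊔ B.nilPow (N + 1) ≤ B.nil := sup_le hI0 (B.nilPow_le_nil N)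
      rw [s.2.1, s'.2.1]
      refine evalAt_sub_mem_of_formal L.openV B.nil_twoSided hK
        (hI.sup (B.nilPow_twoSided (N + 1 + 1))) ?_ hK0 (L.formal.dCoord L.openV k)
        (s.target L h).body (fun s => (h.param s).2) (hy _ hK hK0 le_sup_left ih)
        (fun k => Submodule.mem_sup_left (hr k)) (fun k => (h.mom k).2) (fun k => (h'.mom k).2)
        (fun k => Submodule.mem_sup_left (hr k))
      -- A product of a nilpotent element with I + nil^(N+1) lies in I + nil^(N+2).
      intro a ha b hb
      obtain ⟨i, hi, j, hj, rfl⟩ := Submodule.mem_sup.1 hb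
      rw [mul_add, add_mul]
      have h1 := B.nil_mul_nilPow ha hj
      exact ⟨Submodule.add_mem_sup (hI a i hi).1 h1.1, Submodule.add_mem_sup (hI a i hi).2 h1.2⟩
  have hq' : ∀ k, q k - q' k ∈ I := by
    intro k
    have := hq B.order k
    rwa [B.nilPow_eq_bot (Nat.le_succ _), sup_bot_eq] at this
  exact ⟨hy I hI hI0 le_rfl hq', hq'⟩

theorem LSol.unique (L : LocalPair U V F₃₂ F₂₁) (h : IsPt U c x r) (s : LSol F₃₂ F₂₁ c x r y q)
    {y' q' : Ix n₂ m₂ → B} (s' : LSol F₃₂ F₂₁ c x r y' q') : y = y' ∧ q = q' := by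
  have := s.sub_mem L twoSided_bot bot_le h h s' (by simp) (by simp)
  exact ⟨funext fun k => sub_eq_zero.1 (this.1 k), funext fun k => sub_eq_zero.1 (this.2 k)⟩

/-! ### Existence -/

/-- The value of `y` determined by `q`. -/
def yOf (F₂₁ : Coef n₁ P m₁ (Ix n₂ m₂)) (c : P → B) (x : Ix n₁ m₁ → B) (q : Ix n₂ m₂ → B) :
    Ix n₂ m₂ → B := fun k => sgn B k * evalAt (dMom k F₂₁) c x q

/-- Successive approximations of `q`. -/
def qIter (F₃₂ : Coef n₂ P m₂ Q) (F₂₁ : Coef n₁ P m₁ (Ix n₂ m₂)) (c : P → B) (x : Ix n₁ m₁ → B)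
    (r : Q → B) : ℕ → Ix n₂ m₂ → B
  | 0 => 0
  | N + 1 => fun k => evalAt (dCoord k F₃₂) c (yOf F₂₁ c x (qIter F₃₂ F₂₁ c x r N)) r

theorem LocalPair.qIter_isFormal (L : LocalPair U V F₃₂ F₂₁) (h : IsPt U c x r) (N : ℕ) :
    B.IsFormal (qIter F₃₂ F₂₁ c x r N) := by
  induction N with
  | zero => exact SuperWeil.isFormal_zero
  | succ N ih => exact L.dCoord_isFormal (L.target h ih fun _ => rfl)

/-- Successive approximations agree to one more order at each step. The first step only needs that
both terms are nilpotent. -/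
theorem LocalPair.qIter_sub_mem (L : LocalPair U V F₃₂ F₂₁) (h : IsPt U c x r) (N : ℕ) :
    ∀ k, qIter F₃₂ F₂₁ c x r (N + 1) k - qIter F₃₂ F₂₁ c x r N k ∈ B.nilPow (N + 1) := by
  induction N with
  | zero =>
    intro k
    exact SuperWeil.mem_nilPow_one
      (Submodule.sub_mem _ (L.qIter_isFormal h _ k).2 (L.qIter_isFormal h _ k).2)
  | succ N ih =>
    intro k
    refine evalAt_sub_mem_of_formal L.openV B.nil_twoSided (B.nilPow_twoSided (N + 1))
      (B.nilPow_twoSided (N + 1 + 1)) (fun a ha b hb => B.nil_mul_nilPow ha hb)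
      (B.nilPow_le_nil N) (L.formal.dCoord L.openV k)
      (L.target h (L.qIter_isFormal h _) fun _ => rfl).body (fun s => (h.param s).2) ?_ ?_
      (fun k => (h.mom k).2) (fun k => (h.mom k).2) ?_
    · intro k
      unfold yOf
      rw [← mul_sub]
      refine sgn_mul_mem_of_mem k (evalAt_sub_mem (B.nilPow_twoSided (N + 1))
        (B.nilPow_le_nil N) _ ?_ ih)
      intro k
      rw [sub_self]
      exact Submodule.zero_mem _
    · intro k
      rw [sub_self]
      exact Submodule.zero_mem _
    · intro k
      rw [sub_self]
      exact Submodule.zero_mem _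

theorem LocalPair.qIter_eq (L : LocalPair U V F₃₂ F₂₁) (h : IsPt U c x r) {N : ℕ}
    (hN : B.order ≤ N) : qIter F₃₂ F₂₁ c x r N = qIter F₃₂ F₂₁ c x r B.order := by
  induction N, hN using Nat.le_induction with
  | base => rfl
  | succ N hN ih =>
    rw [← ih]
    funext k
    have := L.qIter_sub_mem h N k
    rw [B.nilPow_eq_bot (by omega)] at this
    exact sub_eq_zero.1 this

theorem LocalPair.lsol_qIter (L : LocalPair U V F₃₂ F₂₁) (h : IsPt U c x r) :
    LSol F₃₂ F₂₁ c x r (yOf F₂₁ c x (qIter F₃₂ F₂₁ c x r B.order))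
      (qIter F₃₂ F₂₁ c x r B.order) :=
  ⟨L.qIter_isFormal h _, fun k => congrFun (L.qIter_eq h (Nat.le_succ B.order)).symm k,
    fun _ => rfl⟩

theorem LocalPair.isRepN_yOf (L : LocalPair U V F₃₂ F₂₁) (N : ℕ)
    {q : Ix n₂ m₂ → ValFun n₁ P m₁ Q} (hq : ∀ k, IsRepN U N (q k))
    (hf : ∀ (B : SuperWeil) (c : P → B) (x : Ix n₁ m₁ → B) (r : Q → B), IsPt U c x r →
      B.IsFormal fun k => q k B c x r) (k : Ix n₂ m₂) :
    IsRepN U N fun B c x r => yOf F₂₁ c x (fun k => q k B c x r) k :=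
  IsRepN.sgn_mul L.openU k (IsRepN.comp L.openU L.openU (L.smooth₂₁.dMom k)
    (C := fun s _ c _ _ => c s) (X := fun k _ _ x _ => x k) (R := q) (isRepN_param N)
    (isRepN_coord N) hq fun B c x r h => h.withMom (hf B c x r h))

theorem LocalPair.isRepN_qIter (L : LocalPair U V F₃₂ F₂₁) (N K : ℕ) (k : Ix n₂ m₂) :
    IsRepN U N fun _B c x r => qIter F₃₂ F₂₁ c x r K k := by
  induction K generalizing k with
  | zero => exact isRepN_zero N
  | succ K ih =>
    exact IsRepN.comp L.openU L.openV (L.smooth₃₂.dCoord L.openV k)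
      (C := fun s _ c _ _ => c s) (X := fun k _ c x r => yOf F₂₁ c x (qIter F₃₂ F₂₁ c x r K) k)
      (R := fun k _ _ _ r => r k) (isRepN_param N)
      (L.isRepN_yOf N ih fun B c x r h => L.qIter_isFormal h K) (isRepN_mom N)
      fun B c x r h => L.target h (L.qIter_isFormal h K) fun _ => rfl

/-- The number of iterations depends on the algebra. On algebras of order at most N, however, the
fixed iterate N is already the solution, and a fixed iterate is a composition of superfunctions. -/
theorem LocalPair.isRepN_q (L : LocalPair U V F₃₂ F₂₁) (N : ℕ) (k : Ix n₂ m₂) :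
    IsRepN U N fun B c x r => qIter F₃₂ F₂₁ c x r B.order k :=
  (L.isRepN_qIter N N k).congr fun _B hB _e _v h => (congrFun (L.qIter_eq h.isPt hB) k).symm

theorem LocalPair.isRepN_y (L : LocalPair U V F₃₂ F₂₁) (N : ℕ) (k : Ix n₂ m₂) :
    IsRepN U N fun B c x r => yOf F₂₁ c x (qIter F₃₂ F₂₁ c x r B.order) k :=
  L.isRepN_yOf N (L.isRepN_q N) (fun _B _c _x _r h => L.qIter_isFormal h _) k

/-- The system has a solution by superfunctions. -/
theorem LocalPair.exists_series (L : LocalPair U V F₃₂ F₂₁) :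
    ∃ Y R : Ix n₂ m₂ → Coef n₁ P m₁ Q, (∀ k, IsSmoothOn U (Y k)) ∧ (∀ k, IsSmoothOn U (R k)) ∧
      ∀ (B : SuperWeil) (c : P → B) (x : Ix n₁ m₁ → B) (r : Q → B), IsPt U c x r →
        LSol F₃₂ F₂₁ c x r (fun k => evalAt (Y k) c x r) fun k => evalAt (R k) c x r := by
  have hY := fun k => exists_superfunction L.openU (fun N => L.isRepN_y N k) (p := Parity.par k)
    fun B c x r h => (L.target h (L.qIter_isFormal h _) fun _ => rfl).par k
  have hR := fun k => exists_superfunction L.openU (fun N => L.isRepN_q N k) (p := Parity.par k)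
    fun B c x r h => (L.qIter_isFormal h _ k).1
  choose Y hY1 hY2 hY3 using hY
  choose R hR1 hR2 hR3 using hR
  refine ⟨Y, R, hY1, hR1, fun B c x r h => ?_⟩
  rw [show (fun k => evalAt (Y k) c x r) = _ from funext fun k => hY3 k B c x r h,
    show (fun k => evalAt (R k) c x r) = _ from funext fun k => hR3 k B c x r h]
  exact L.lsol_qIter h

theorem LocalPair.exists_sol (L : LocalPair U V F₃₂ F₂₁) (h : IsPt U c x r) :
    ∃ y q, LSol F₃₂ F₂₁ c x r y q := ⟨_, _, L.lsol_qIter h⟩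

/-- `G` is the generating function of the composition. -/
def IsCompGen (U : Set (Fin n₁ → ℝ)) (F₃₂ : Coef n₂ P m₂ Q) (F₂₁ : Coef n₁ P m₁ (Ix n₂ m₂))
    (G : Coef n₁ P m₁ Q) : Prop :=
  ∀ (B : SuperWeil) (c : P → B) (x : Ix n₁ m₁ → B) (r : Q → B) (y q : Ix n₂ m₂ → B),
    IsPt U c x r → LSol F₃₂ F₂₁ c x r y q →
      evalAt G c x r = evalAt F₃₂ c y r + evalAt F₂₁ c x q - ∑ k, y k * q k

/-- The expression is representable at the solution found by iteration, and uniqueness of solutions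
extends the formula to any (y, q). -/
theorem LocalPair.exists_gen (L : LocalPair U V F₃₂ F₂₁) :
    ∃ G : Coef n₁ P m₁ Q, IsSmoothOn U G ∧ IsHomog 0 G ∧ IsCompGen U F₃₂ F₂₁ G := by
  have hsol := fun (B : SuperWeil) (c : P → B) (x : Ix n₁ m₁ → B) (r : Q → B)
    (h : IsPt U c x r) => L.lsol_qIter h
  obtain ⟨G, h1, h2, h3⟩ := exists_superfunction L.openU (p := 0)
    (T := fun B c x r => evalAt F₃₂ c (yOf F₂₁ c x (qIter F₃₂ F₂₁ c x r B.order)) r +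
      evalAt F₂₁ c x (qIter F₃₂ F₂₁ c x r B.order) -
      ∑ k, yOf F₂₁ c x (qIter F₃₂ F₂₁ c x r B.order) k * qIter F₃₂ F₂₁ c x r B.order k)
    (fun N => by
      refine IsRepN.sub L.openU (IsRepN.add ?_ ?_)
        (IsRepN.sum _ fun k _ => (L.isRepN_y N k).mul L.openU (L.isRepN_q N k))
      · exact IsRepN.comp L.openU L.openV L.smooth₃₂ (C := fun s _ c _ _ => c s)
          (X := fun k B c x r => yOf F₂₁ c x (qIter F₃₂ F₂₁ c x r B.order) k)
          (R := fun k _ _ _ r => r k) (isRepN_param N) (L.isRepN_y N) (isRepN_mom N)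
          fun B c x r h => (hsol B c x r h).target L h
      · exact IsRepN.comp L.openU L.openU L.smooth₂₁ (C := fun s _ c _ _ => c s)
          (X := fun k _ _ x _ => x k) (R := fun k B c x r => qIter F₃₂ F₂₁ c x r B.order k)
          (isRepN_param N) (isRepN_coord N) (L.isRepN_q N)
          fun B c x r h => h.withMom (hsol B c x r h).1)
    (fun B c x r h => by
      have hs := hsol B c x r h
      refine Submodule.sub_mem _ (Submodule.add_mem _
        (evalAt_mem L.openV L.even₃₂ (hs.target L h))
        (evalAt_mem L.openU L.even₂₁ (h.withMom hs.1))) (Submodule.sum_mem _ fun k _ => ?_)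
      have := B.mul_mem ((hs.target L h).par k) (hs.1 k).1
      rwa [CharTwo.add_self_eq_zero] at this)
  refine ⟨G, h1, h2, fun B c x r y q h hs => ?_⟩
  obtain ⟨rfl, rfl⟩ := hs.unique L h (hsol B c x r h)
  exact h3 B c x r h

/-! ### Stationarity -/

/-- The increments of y and q lie in I by `LSol.sub_mem`. By the equations of the system the
expansion of `F₃₂` contributes δy q and that of `F₂₁` contributes y δq. Together they cancel the
variation of yq, whose remaining term δy δq vanishes because I has square zero. Only the explicit
increments of x and r survive. -/
theorem LocalPair.stationary (L : LocalPair U V F₃₂ F₂₁) {I : Submodule ℝ B} (hI : TwoSided I)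
    (h2 : ∀ a ∈ I, ∀ b ∈ I, a * b = 0) (h : IsPt U c x r) (s : LSol F₃₂ F₂₁ c x r y q)
    {δx : Ix n₁ m₁ → B} {δr : Q → B} {y' q' : Ix n₂ m₂ → B}
    (hx : ∀ k, δx k ∈ B.gr (Parity.par k)) (hxI : ∀ k, δx k ∈ I)
    (hr : ∀ k, δr k ∈ B.gr (Parity.par k)) (hrI : ∀ k, δr k ∈ I)
    (s' : LSol F₃₂ F₂₁ c (fun k => x k + δx k) (fun k => r k + δr k) y' q') :
    evalAt F₃₂ c y' (fun k => r k + δr k) + evalAt F₂₁ c (fun k => x k + δx k) q' -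
        ∑ k, y' k * q' k =
      evalAt F₃₂ c y r + evalAt F₂₁ c x q - ∑ k, y k * q k +
        (∑ k, δx k * evalAt (dCoord k F₂₁) c x q + ∑ k, δr k * evalAt (dMom k F₃₂) c y r) := by
  have hI0 : I ≤ B.nil := fun b hb => by
    have := congrArg B.aug (h2 _ hb _ hb)
    rw [map_mul, map_zero] at this
    exact mul_self_eq_zero.1 this
  have h' : IsPt U c (fun k => x k + δx k) fun k => r k + δr k := h.add hI0 hx hxI hr hrI
  obtain ⟨hy, hq⟩ := s'.sub_mem L hI hI0 h' h s (by simpa using hxI) (by simpa using hrI)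
  have ht := s.target L h
  have ht' := s'.target L h'
  have hy' : y' = fun k => y k + (y' k - y k) := funext fun k => by abel
  have hq' : q' = fun k => q k + (q' k - q k) := funext fun k => by abel
  have e1 := evalAt_expand L.openV L.smooth₃₂ hI h2 ht (δx := fun k => y' k - y k) (δq := δr)
    (fun k => Submodule.sub_mem _ (ht'.par k) (ht.par k)) hy hr hrI
  have e2 := evalAt_expand L.openU L.smooth₂₁ hI h2 (h.withMom s.1) (δx := δx)
    (δq := fun k => q' k - q k) hx hxI
    (fun k => Submodule.sub_mem _ (s'.1 k).1 (s.1 k).1) hq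
  rw [← hy'] at e1
  rw [← hq'] at e2
  rw [e1, e2]
  have e3 : ∑ k, (y' k - y k) * evalAt (dCoord k F₃₂) c y r = ∑ k, (y' k - y k) * q k :=
    Finset.sum_congr rfl fun k _ => by rw [← s.2.1]
  have e4 : ∑ k, (q' k - q k) * evalAt (dMom k F₂₁) c x q = ∑ k, y k * (q' k - q k) := by
    refine Finset.sum_congr rfl fun k _ => ?_
    have : evalAt (dMom k F₂₁) c x q = sgn B k * y k := by
      rw [s.2.2, sgn_mul_sgn_mul]
    rw [this, mul_sgn_mul k (Submodule.sub_mem _ (s'.1 k).1 (s.1 k).1) (ht.par k)]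
  have e5 : ∑ k, y' k * q' k = ∑ k, y k * q k + ∑ k, (y' k - y k) * q k +
      ∑ k, y k * (q' k - q k) := by
    rw [← Finset.sum_add_distrib, ← Finset.sum_add_distrib]
    refine Finset.sum_congr rfl fun k _ => ?_
    have : (y' k - y k) * (q' k - q k) = 0 := h2 _ (hy k) _ (hq k)
    have e : y' k * q' k = y k * q k + (y' k - y k) * q k + y k * (q' k - q k) +
        (y' k - y k) * (q' k - q k) := by noncomm_ring
    rw [e, this, add_zero]
  rw [e3, e4, e5]
  abel

theorem LSol.map (L : LocalPair U V F₃₂ F₂₁) (h : IsPt U c x r) (s : LSol F₃₂ F₂₁ c x r y q)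
    (p : ZMod 2) : LSol F₃₂ F₂₁ (fun s => B.epsInl p (c s)) (fun k => B.epsInl p (x k))
      (fun k => B.epsInl p (r k)) (fun k => B.epsInl p (y k)) fun k => B.epsInl p (q k) := by
  refine ⟨fun k => ⟨SuperWeil.epsInl_mem (s.1 k).1, (s.1 k).2⟩, fun k => ?_, fun k => ?_⟩
  · rw [evalAt_map _ (s.target L h), ← s.2.1]
  · dsimp only
    rw [evalAt_map _ (h.withMom s.1), s.2.2, map_mul]
    congr 1
    simp [sgn]

/-- Derivatives of the generating function of a composition. -/
theorem LocalPair.envelope (L : LocalPair U V F₃₂ F₂₁) {G : Coef n₁ P m₁ Q}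
    (hG : SmoothCoef U G) (hval : IsCompGen U F₃₂ F₂₁ G) (h : IsPt U c x r)
    (s : LSol F₃₂ F₂₁ c x r y q) :
    (∀ k, evalAt (dMom k G) c x r = evalAt (dMom k F₃₂) c y r) ∧
      ∀ k, evalAt (dCoord k G) c x r = evalAt (dCoord k F₂₁) c x q := by
  constructor
  · intro k
    refine evalAt_dMom_eq L.openU hG h k ?_
    have h0 : ∀ t : Ix n₁ m₁, (0 : B.eps (Parity.par k)) ∈
      (B.eps (Parity.par k)).gr (Parity.par t) := fun _ => Submodule.zero_mem _
    have hm := h.map (Parity.par k)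
    have hs := s.map L h (Parity.par k)
    have hp := hm.add (epsIdeal_le (B := B) (Parity.par k)) (δx := 0) (δq := epsSingle B k)
      h0 (fun _ => Submodule.zero_mem _) (epsSingle_mem k) (epsSingle_mem_ideal k)
    -- A solution over B[ε] for the perturbed data is needed, but not its form: by stationarity only
    -- the increment of r is visible in the value of G.
    obtain ⟨y', q', s'⟩ := L.exists_sol hp
    have hst := L.stationary SuperWeil.epsIdeal_twoSided SuperWeil.epsIdeal_sq hm hs
      (δx := 0) (δr := epsSingle B k)
      h0 (fun _ => Submodule.zero_mem _) (epsSingle_mem k) (epsSingle_mem_ideal k) s'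
    rw [← hval _ _ _ _ _ _ hp s', ← hval _ _ _ _ _ _ hm hs] at hst
    simp only [Pi.zero_apply, add_zero, zero_mul, Finset.sum_const_zero, zero_add, epsSingle,
      ite_mul, Finset.sum_ite_eq', Finset.mem_univ, if_true] at hst
    rw [evalAt_map _ h, evalAt_map _ (s.target L h)] at hst
    exact hst
  · intro k
    refine evalAt_dCoord_eq L.openU hG h k ?_
    have h0 : ∀ t : Q, (0 : B.eps (Parity.par k)) ∈
      (B.eps (Parity.par k)).gr (Parity.par t) := fun _ => Submodule.zero_mem _
    have hm := h.map (Parity.par k)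
    have hs := s.map L h (Parity.par k)
    have hp := hm.add (epsIdeal_le (B := B) (Parity.par k)) (δx := epsSingle B k) (δq := 0)
      (epsSingle_mem k) (epsSingle_mem_ideal k) h0 (fun _ => Submodule.zero_mem _)
    obtain ⟨y', q', s'⟩ := L.exists_sol hp
    have hst := L.stationary SuperWeil.epsIdeal_twoSided SuperWeil.epsIdeal_sq hm hs
      (δx := epsSingle B k) (δr := 0) (epsSingle_mem k) (epsSingle_mem_ideal k)
      h0 (fun _ => Submodule.zero_mem _) s'
    rw [← hval _ _ _ _ _ _ hp s', ← hval _ _ _ _ _ _ hm hs] at hst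
    simp only [Pi.zero_apply, add_zero, zero_mul, Finset.sum_const_zero, epsSingle,
      ite_mul, Finset.sum_ite_eq', Finset.mem_univ, if_true] at hst
    rw [evalAt_map _ h, evalAt_map _ (h.withMom s.1)] at hst
    exact hst

end Local

/-! ## Points of supermanifolds -/

section Points

variable {n m : ℕ} {M : SuperManifold.{u} n m} {B : SuperWeil} {i j l : M.ι} {b : M.carrier}
  {x : Ix n m → B}

/-- The domain of a coordinate change. -/
def SuperManifold.dom (M : SuperManifold.{u} n m) (i j : M.ι) : Set (Fin n → ℝ) :=
  ((M.chart i).symm.trans (M.chart j)).source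

theorem SuperManifold.isOpen_dom (M : SuperManifold.{u} n m) (i j : M.ι) : IsOpen (M.dom i j) :=
  ((M.chart i).symm.trans (M.chart j)).open_source

theorem SuperManifold.mem_dom (hi : b ∈ (M.chart i).source) (hj : b ∈ (M.chart j).source) :
    M.chart i b ∈ M.dom i j := by
  unfold SuperManifold.dom
  rw [OpenPartialHomeomorph.trans_source]
  refine ⟨(M.chart i).map_source hi, ?_⟩
  change (M.chart i).symm (M.chart i b) ∈ (M.chart j).source
  rwa [(M.chart i).left_inv hi]

theorem SuperManifold.smooth_trans (M : SuperManifold.{u} n m) (i j : M.ι) (k : Ix n m) :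
    SmoothCoef (M.dom i j) (M.trans i j k) := (M.trans_smooth i j k).smoothCoef

theorem SuperManifold.IsPoint.body_eq (h : M.IsPoint B i b x) :
    (fun a => B.aug (x (.even a))) = M.chart i b := funext h.2.2

theorem SuperManifold.IsPoint.isPt (h : M.IsPoint B i b x) {P Q : Type} [Fintype P]
    [LinearOrder P] [Parity P] [Fintype Q] [LinearOrder Q] [Parity Q] {U : Set (Fin n → ℝ)}
    (hU : M.chart i b ∈ U) {c : P → B} {q : Q → B} (hc : B.IsFormal c) (hq : B.IsFormal q) :
    IsPt U c x q := ⟨hc, h.2.1, h.body_eq ▸ hU, hq⟩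

theorem SuperManifold.IsPoint.isPt_dom (h : M.IsPoint B i b x) (hj : b ∈ (M.chart j).source) :
    IsPt (M.dom i j) (0 : Ix 0 0 → B) x (0 : Ix 0 0 → B) :=
  h.isPt (M.mem_dom h.1 hj) SuperWeil.isFormal_zero SuperWeil.isFormal_zero

theorem SuperManifold.IsPoint.tr (h : M.IsPoint B i b x) (hj : b ∈ (M.chart j).source) :
    M.IsPoint B j b (M.tr i j x) := by
  refine ⟨hj, fun k => evalAt_mem (M.isOpen_dom i j) (M.trans_par i j k) (h.isPt_dom hj),
    fun a => ?_⟩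
  unfold SuperManifold.tr
  rw [aug_evalAt _ (h.isPt_dom hj), h.body_eq]
  exact M.trans_body i j b h.1 hj a

theorem SuperManifold.IsPoint.tr_self (h : M.IsPoint B i b x) : M.tr i i x = x :=
  funext (M.trans_refl i b h.1 B x h.2.1 h.2.2)

theorem SuperManifold.IsPoint.tr_tr (h : M.IsPoint B i b x) (hj : b ∈ (M.chart j).source)
    (hl : b ∈ (M.chart l).source) : M.tr j l (M.tr i j x) = M.tr i l x :=
  funext (M.trans_cocycle i j l b h.1 hj hl B x h.2.1 h.2.2)

theorem SuperManifold.IsPoint.tr_inv (h : M.IsPoint B i b x) (hj : b ∈ (M.chart j).source) :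
    M.tr j i (M.tr i j x) = x := (h.tr_tr hj h.1).trans h.tr_self

/-- The Jacobian matrix `∂x^{k'}/∂x^k` of a coordinate change. -/
def SuperManifold.jac (M : SuperManifold.{u} n m) (i j : M.ι) (x : Ix n m → B) (k k' : Ix n m) :
    B := evalAt (dCoord k (M.trans i j k')) 0 x 0

/-- The momenta in chart `i` corresponding to the momenta `q` in chart `j`. -/
def SuperManifold.mtr (M : SuperManifold.{u} n m) (i j : M.ι) (x q : Ix n m → B) : Ix n m → B :=
  fun k => ∑ k', M.jac i j x k k' * q k'

theorem SuperManifold.IsPoint.jac_mem (h : M.IsPoint B i b x) (hj : b ∈ (M.chart j).source)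
    (k k' : Ix n m) : M.jac i j x k k' ∈ B.gr (Parity.par k' + Parity.par k) :=
  evalAt_dCoord_mem (M.isOpen_dom i j) (M.trans_par i j k') (h.isPt_dom hj) k

theorem SuperManifold.IsPoint.mtr_isFormal (h : M.IsPoint B i b x) (hj : b ∈ (M.chart j).source)
    {q : Ix n m → B} (hq : B.IsFormal q) : B.IsFormal (M.mtr i j x q) := by
  intro k
  refine ⟨Submodule.sum_mem _ fun k' _ => ?_, ?_⟩
  · have := B.mul_mem (h.jac_mem hj k k') (hq k').1
    rwa [add_right_comm, CharTwo.add_self_eq_zero, zero_add] at this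
  · unfold SuperManifold.mtr
    rw [map_sum]
    exact Finset.sum_eq_zero fun k' _ => by rw [map_mul, (hq k').2, mul_zero]

theorem SuperManifold.IsPoint.map (h : M.IsPoint B i b x) (p : ZMod 2) :
    M.IsPoint (B.eps p) i b fun k => B.epsInl p (x k) :=
  ⟨h.1, fun k => SuperWeil.epsInl_mem (h.2.1 k), h.2.2⟩

theorem SuperManifold.IsPoint.add (h : M.IsPoint B i b x) {δ : Ix n m → B}
    (hδ : ∀ k, δ k ∈ B.gr (Parity.par k)) (hδ0 : ∀ k, δ k ∈ B.nil) :
    M.IsPoint B i b fun k => x k + δ k :=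
  ⟨h.1, fun k => Submodule.add_mem _ (h.2.1 k) (hδ k), fun a => by
    rw [map_add, SuperWeil.mem_nil.1 (hδ0 _), add_zero, h.2.2]⟩

theorem SuperManifold.IsPoint.map_add (h : M.IsPoint B i b x) (k : Ix n m) :
    M.IsPoint (B.eps (Parity.par k)) i b
      fun t => B.epsInl (Parity.par k) (x t) + epsSingle B k t :=
  (h.map _).add (epsSingle_mem k) fun t => epsIdeal_le _ (epsSingle_mem_ideal k t)

theorem zero_map {σ : Type} (p : ZMod 2) :
    (fun s => B.epsInl p ((0 : σ → B) s)) = (0 : σ → B.eps p) := funext fun _ => map_zero _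

theorem epsInl_sgn {σ : Type} [Parity σ] (p : ZMod 2) (k : σ) :
    B.epsInl p (sgn B k) = sgn (B.eps p) k := by
  simp [sgn]

theorem SuperManifold.IsPoint.tr_map (h : M.IsPoint B i b x) (hj : b ∈ (M.chart j).source)
    (p : ZMod 2) : (M.tr i j fun k => B.epsInl p (x k)) = fun k => B.epsInl p (M.tr i j x k) := by
  funext k
  have := evalAt_map (M.trans i j k) (h.isPt_dom hj) p
  rw [zero_map] at this
  exact this

theorem SuperManifold.IsPoint.jac_map (h : M.IsPoint B i b x) (hj : b ∈ (M.chart j).source)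
    (p : ZMod 2) (k k' : Ix n m) :
    M.jac i j (fun k => B.epsInl p (x k)) k k' = B.epsInl p (M.jac i j x k k') := by
  have := evalAt_map (dCoord k (M.trans i j k')) (h.isPt_dom hj) p
  rw [zero_map] at this
  exact this

theorem SuperManifold.IsPoint.tr_add (h : M.IsPoint B i b x) (hj : b ∈ (M.chart j).source)
    {I : Submodule ℝ B} (hI : TwoSided I) (h2 : ∀ a ∈ I, ∀ b ∈ I, a * b = 0)
    {δ : Ix n m → B} (hδ : ∀ k, δ k ∈ B.gr (Parity.par k)) (hδI : ∀ k, δ k ∈ I) (k' : Ix n m) :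
    M.tr i j (fun k => x k + δ k) k' = M.tr i j x k' + ∑ k, δ k * M.jac i j x k k' := by
  have := evalAt_expand (M.isOpen_dom i j) (M.smooth_trans i j k') hI h2 (h.isPt_dom hj)
    (δx := δ) (δq := 0) hδ hδI (fun _ => Submodule.zero_mem _) (fun _ => Submodule.zero_mem _)
  simp only [Pi.zero_apply, add_zero, zero_mul, Finset.sum_const_zero] at this
  exact this

theorem SuperManifold.IsPoint.tr_eps (h : M.IsPoint B i b x) (hj : b ∈ (M.chart j).source)
    (k k' : Ix n m) :
    M.tr i j (fun t => B.epsInl (Parity.par k) (x t) + epsSingle B k t) k' =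
      B.epsInl (Parity.par k) (M.tr i j x k') +
        B.epsGen (Parity.par k) * B.epsInl (Parity.par k) (M.jac i j x k k') := by
  rw [(h.map _).tr_add hj SuperWeil.epsIdeal_twoSided SuperWeil.epsIdeal_sq (epsSingle_mem k)
    (epsSingle_mem_ideal k), h.tr_map hj]
  simp only [epsSingle, ite_mul, zero_mul, Finset.sum_ite_eq', Finset.mem_univ, if_true,
    h.jac_map hj]

theorem SuperManifold.IsPoint.jac_self (h : M.IsPoint B i b x) (k k' : Ix n m) :
    M.jac i i x k k' = if k' = k then 1 else 0 := by
  have h1 := h.tr_eps h.1 k k'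
  rw [(h.map_add k).tr_self, h.tr_self] at h1
  have h2 := add_left_cancel h1
  refine (SuperWeil.epsGen_mul_inl_injective (p := Parity.par k) ?_).symm
  rw [← h2]
  unfold epsSingle
  split_ifs
  · rw [map_one, mul_one]
  · rw [map_zero, mul_zero]

/-- The cocycle condition is assumed at all points in all test algebras. Applied to x with an
infinitesimal increment, and compared in the coefficient of ε, it becomes the chain rule. -/
theorem SuperManifold.IsPoint.jac_jac (h : M.IsPoint B i b x) (hj : b ∈ (M.chart j).source)
    (hl : b ∈ (M.chart l).source) (k k'' : Ix n m) :
    ∑ k', M.jac i j x k k' * M.jac j l (M.tr i j x) k' k'' = M.jac i l x k k'' := by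
  have h1 := h.tr_eps hl k k''
  rw [← (h.map_add k).tr_tr hj hl, show M.tr i j (fun t => B.epsInl (Parity.par k) (x t) +
    epsSingle B k t) = _ from funext (h.tr_eps hj k), ← h.tr_tr hj hl,
    (((h.tr hj).map (Parity.par k))).tr_add hl SuperWeil.epsIdeal_twoSided SuperWeil.epsIdeal_sq
      _ _, (h.tr hj).tr_map hl] at h1
  · have h2 := add_left_cancel h1
    refine SuperWeil.epsGen_mul_inl_injective (p := Parity.par k) ?_
    rw [← h2, map_sum, Finset.mul_sum]
    refine Finset.sum_congr rfl fun k' _ => ?_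
    rw [(h.tr hj).jac_map hl, map_mul, mul_assoc]
  · intro k'
    have := (B.eps (Parity.par k)).mul_mem SuperWeil.epsGen_mem
      (SuperWeil.epsInl_mem (p := Parity.par k) (h.jac_mem hj k k'))
    rwa [add_left_comm, CharTwo.add_self_eq_zero, add_zero] at this
  · intro k'
    exact (SuperWeil.epsIdeal_twoSided _ _ SuperWeil.epsGen_mem_ideal).2

theorem SuperManifold.IsPoint.mtr_self (h : M.IsPoint B i b x) (q : Ix n m → B) :
    M.mtr i i x q = q := by
  funext k
  simp [SuperManifold.mtr, h.jac_self]

theorem SuperManifold.IsPoint.mtr_mtr (h : M.IsPoint B i b x) (hj : b ∈ (M.chart j).source)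
    (hl : b ∈ (M.chart l).source) (q : Ix n m → B) :
    M.mtr i j x (M.mtr j l (M.tr i j x) q) = M.mtr i l x q := by
  funext k
  simp only [SuperManifold.mtr, Finset.mul_sum, ← h.jac_jac hj hl, Finset.sum_mul]
  rw [Finset.sum_comm]
  simp only [mul_assoc]

theorem SuperManifold.IsPoint.mtr_inv (h : M.IsPoint B i b x) (hj : b ∈ (M.chart j).source)
    (q : Ix n m → B) : M.mtr i j x (M.mtr j i (M.tr i j x) q) = q :=
  (h.mtr_mtr hj h.1 q).trans (h.mtr_self q)

/-! ### The generating function of a coordinate change -/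

variable {P : Type} [Fintype P] [LinearOrder P] [Parity P]

theorem SmoothCoef.mono {n : ℕ} {S : Type} [Parity S] {F : (S → ℕ) → (Fin n → ℝ) → ℝ}
    {U U' : Set (Fin n → ℝ)} (hF : SmoothCoef U F) (h : U' ⊆ U) : SmoothCoef U' F :=
  ⟨fun α => (hF.1 α).mono h, fun α s hs h2 x hx => hF.2 α s hs h2 x (h hx)⟩

theorem IsPt.mono {n m : ℕ} {P Q : Type} [Parity P] [Parity Q] [Fintype P] [LinearOrder P]
    [Fintype Q] [LinearOrder Q] {U U' : Set (Fin n → ℝ)} {c : P → B}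
    {x : Ix n m → B} {q : Q → B} (h : IsPt U c x q) (hU : U ⊆ U') : IsPt U' c x q :=
  ⟨h.param, h.par, hU h.body, h.mom⟩

theorem IsPt.param_zero {n m : ℕ} {P Q P' Q' : Type} [Parity P] [Parity Q] [Fintype P]
    [LinearOrder P] [Fintype Q] [LinearOrder Q] [Parity P'] [Parity Q'] [Fintype P']
    [LinearOrder P'] [Fintype Q'] [LinearOrder Q'] {U : Set (Fin n → ℝ)} {c : P → B}
    {x : Ix n m → B} {q : Q → B} (h : IsPt U c x q) : IsPt U (0 : P' → B) x (0 : Q' → B) :=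
  ⟨SuperWeil.isFormal_zero, h.par, h.body, SuperWeil.isFormal_zero⟩

theorem isRepN_const_zero {n m : ℕ} {Q σ : Type} [Fintype Q] [LinearOrder Q] [Parity Q]
    {U : Set (Fin n → ℝ)} (N : ℕ) (s : σ) :
    IsRepN (P := P) (m := m) (Q := Q) U N fun B _ _ _ => (0 : σ → B) s := isRepN_zero N

theorem exists_changeGen (M : SuperManifold.{u} n m) (i j : M.ι) :
    ∃ T : Coef n P m (Ix n m), IsSmoothOn (M.dom i j) T ∧ IsHomog 0 T ∧
      ∀ (B : SuperWeil) (c : P → B) (x q : Ix n m → B), IsPt (M.dom i j) c x q →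
        evalAt T c x q = ∑ k, M.tr i j x k * q k := by
  refine exists_superfunction (M.isOpen_dom i j) (fun N => ?_) fun B c x q h => ?_
  · refine IsRepN.sum _ fun k _ => IsRepN.mul (M.isOpen_dom i j) ?_ (isRepN_mom N k)
    exact IsRepN.comp (M.isOpen_dom i j) (M.isOpen_dom i j) (M.smooth_trans i j k)
      (C := fun s B _ _ _ => (0 : Ix 0 0 → B) s) (X := fun k _ _ x _ => x k)
      (R := fun s B _ _ _ => (0 : Ix 0 0 → B) s) (fun s => isRepN_const_zero N s) (isRepN_coord N)
      (fun s => isRepN_const_zero N s) fun B c x q h => h.param_zero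
  · refine Submodule.sum_mem _ fun k _ => ?_
    have := B.mul_mem (evalAt_mem (M.isOpen_dom i j) (M.trans_par i j k)
      (h.param_zero (P' := Ix 0 0) (Q' := Ix 0 0))) (h.mom k).1
    rwa [CharTwo.add_self_eq_zero] at this

/-- The generating function `x^{k'}(x) q_{k'}` of a coordinate change. -/
def SuperManifold.changeGen (M : SuperManifold.{u} n m) (P : Type) [Fintype P] [LinearOrder P]
    [Parity P] (i j : M.ι) : Coef n P m (Ix n m) := (exists_changeGen (P := P) M i j).choose

theorem SuperManifold.changeGen_smooth (M : SuperManifold.{u} n m) (i j : M.ι) :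
    IsSmoothOn (M.dom i j) (M.changeGen P i j) := (exists_changeGen (P := P) M i j).choose_spec.1

theorem SuperManifold.changeGen_even (M : SuperManifold.{u} n m) (i j : M.ι) :
    IsHomog 0 (M.changeGen P i j) := (exists_changeGen (P := P) M i j).choose_spec.2.1

theorem SuperManifold.evalAt_changeGen (M : SuperManifold.{u} n m) (i j : M.ι) {c : P → B}
    {x q : Ix n m → B} (h : IsPt (M.dom i j) c x q) :
    evalAt (M.changeGen P i j) c x q = ∑ k, M.tr i j x k * q k :=
  (exists_changeGen (P := P) M i j).choose_spec.2.2 B c x q h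

/-- A superfunction whose values vanish at zero parameters and momenta is formal. -/
theorem formalOn_of_evalAt {n m : ℕ} {P Q : Type} [Parity P] [Parity Q] [Fintype P]
    [LinearOrder P] [Fintype Q] [LinearOrder Q] {U : Set (Fin n → ℝ)} (hU : IsOpen U)
    {F : Coef n P m Q} (hF : SmoothCoef U F)
    (h : ∀ (B : SuperWeil) (x : Ix n m → B), IsPt U (0 : P → B) x (0 : Q → B) →
      evalAt F (0 : P → B) x (0 : Q → B) = 0) : FormalOn U F := by
  classical
  let E : (Vars P m Q → ℕ) → Prop := fun α =>
    (∀ s, α (varPar m Q s) = 0) ∧ ∀ k, α (varMom P m k) = 0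
  -- G keeps the coefficients whose monomials contain no parameters and no momenta. Its values are
  -- those of F with parameters and momenta set to zero, hence vanish, and then so do its
  -- coefficients.
  let G : Coef n P m Q := fun α => if E α then F α else fun _ => 0
  have hG : SmoothCoef U G := by
    refine ⟨fun α => ?_, fun α s hs h2 x hx => ?_⟩
    · simp only [G]
      split_ifs
      · exact hF.1 α
      · exact contDiffOn_const
    · simp only [G]
      split_ifs
      · exact hF.2 α s hs h2 x hx
      · rfl
  have hval : ∀ (B : SuperWeil) (e : Fin n → B) (v : Vars P m Q → B), VPt U e v →
      evalV G e v = evalV (fun _ _ => 0) e v := by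
    intro B e v hv
    have hp := hv.isPt
    have h0 := h B (coordOf e v) hp.param_zero
    have hz : evalV (S := Vars P m Q) (fun _ (_ : Fin n → ℝ) => 0) e v = 0 :=
      Finset.sum_eq_zero fun α _ => by
        rw [evalSmooth_zero, zero_mul]
    rw [hz, ← h0, evalAt_eq_evalV]
    refine Finset.sum_congr rfl fun α _ => ?_
    simp only [G]
    split_ifs with hE
    · congr 1
      unfold mono
      congr 1
      refine List.map_congr_left fun s _ => ?_
      exact vars_cases (C := fun s => v s ^ α s =
        varVal (0 : P → B) (coordOf e v) (0 : Q → B) s ^ α s)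
        (fun s => by rw [hE.1, pow_zero, pow_zero]) (fun _ => rfl)
        (fun k => by rw [hE.2, pow_zero, pow_zero]) s
    · rw [evalSmooth_zero, zero_mul]
      have : mono (varVal (0 : P → B) (coordOf e v) (0 : Q → B)) α = 0 := by
        have hs : ∃ s, varVal (0 : P → B) (coordOf e v) (0 : Q → B) s = 0 ∧ α s ≠ 0 := by
          simp only [E, not_and_or, not_forall] at hE
          rcases hE with ⟨s, hs⟩ | ⟨k, hk⟩
          · exact ⟨_, rfl, hs⟩
          · exact ⟨_, rfl, hk⟩
        obtain ⟨s, hs, hne⟩ := hs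
        unfold mono
        exact List.prod_eq_zero (List.mem_map.2 ⟨s, by simp, by rw [hs, zero_pow hne]⟩)
      rw [this, mul_zero]
  intro α h1 h2 x hx
  have := coef_ext hU hG (G := fun _ _ => 0) ⟨fun _ => contDiffOn_const, fun _ _ _ _ _ _ => rfl⟩
    hval α hx
  simp only [G] at this
  rwa [if_pos ⟨h1, h2⟩] at this

/-- Formality allows a coordinate change to play the role of the outer factor in a `LocalPair`. -/
theorem SuperManifold.changeGen_formal (M : SuperManifold.{u} n m) (i j : M.ι) :
    FormalOn (M.dom i j) (M.changeGen P i j) :=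
  formalOn_of_evalAt (M.isOpen_dom i j) (M.changeGen_smooth i j).smoothCoef fun B x h => by
    rw [M.evalAt_changeGen i j h]
    simp

theorem IsPt.tr_map {c : P → B} {q : Ix n m → B} (h : IsPt (M.dom i j) c x q) (p : ZMod 2)
    (k' : Ix n m) : M.tr i j (fun k => B.epsInl p (x k)) k' = B.epsInl p (M.tr i j x k') := by
  have := evalAt_map (M.trans i j k') (h.param_zero (P' := Ix 0 0) (Q' := Ix 0 0)) p
  rw [zero_map] at this
  exact this

theorem SuperManifold.evalAt_dMom_changeGen (M : SuperManifold.{u} n m) (i j : M.ι) {c : P → B}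
    {x q : Ix n m → B} (h : IsPt (M.dom i j) c x q) (k : Ix n m) :
    evalAt (dMom k (M.changeGen P i j)) c x q = sgn B k * M.tr i j x k := by
  refine evalAt_dMom_eq (M.isOpen_dom i j) (M.changeGen_smooth i j).smoothCoef h k ?_
  have hp := (h.map (Parity.par k)).add (epsIdeal_le (B := B) (Parity.par k)) (δx := 0)
    (δq := epsSingle B k) (fun _ => Submodule.zero_mem _) (fun _ => Submodule.zero_mem _)
    (epsSingle_mem k) (epsSingle_mem_ideal k)
  simp only [Pi.zero_apply, add_zero] at hp
  rw [M.evalAt_changeGen i j hp, M.evalAt_changeGen i j h]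
  simp only [h.tr_map, mul_add, Finset.sum_add_distrib, map_sum, map_mul]
  congr 1
  simp only [epsSingle, mul_ite, mul_zero, Finset.sum_ite_eq', Finset.mem_univ, if_true]
  have hk : M.tr i j x k ∈ B.gr (Parity.par k) :=
    evalAt_mem (M.isOpen_dom i j) (M.trans_par i j k)
      (h.param_zero (P' := Ix 0 0) (Q' := Ix 0 0))
  rw [sgn_mul_comm k (SuperWeil.epsInl_mem hk) SuperWeil.epsGen_mem, ← mul_assoc, ← mul_assoc,
    epsInl_sgn, sgn_comm]

theorem SuperManifold.evalAt_dCoord_changeGen (M : SuperManifold.{u} n m) (i j : M.ι) {c : P → B}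
    {x q : Ix n m → B} (h : IsPt (M.dom i j) c x q) (k : Ix n m) :
    evalAt (dCoord k (M.changeGen P i j)) c x q = M.mtr i j x q k := by
  refine evalAt_dCoord_eq (M.isOpen_dom i j) (M.changeGen_smooth i j).smoothCoef h k ?_
  have hp := (h.map (Parity.par k)).add (epsIdeal_le (B := B) (Parity.par k))
    (δx := epsSingle B k) (δq := 0) (epsSingle_mem k) (epsSingle_mem_ideal k)
    (fun _ => Submodule.zero_mem _) (fun _ => Submodule.zero_mem _)
  simp only [Pi.zero_apply, add_zero] at hp
  rw [M.evalAt_changeGen i j hp, M.evalAt_changeGen i j h]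
  have htr : ∀ k', M.tr i j (fun t => B.epsInl (Parity.par k) (x t) + epsSingle B k t) k' =
      B.epsInl (Parity.par k) (M.tr i j x k') +
        B.epsGen (Parity.par k) * B.epsInl (Parity.par k) (M.jac i j x k k') := by
    intro k'
    have := evalAt_eps_coord (M.isOpen_dom i j) (M.smooth_trans i j k')
      (h.param_zero (P' := Ix 0 0) (Q' := Ix 0 0)) k
    rw [zero_map] at this
    exact this
  simp only [htr, add_mul, Finset.sum_add_distrib, map_sum, map_mul, SuperManifold.mtr,
    Finset.mul_sum, mul_assoc]

end Points

/-! ## Thick morphisms on points -/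

section ThickPoints

variable {n₁ m₁ n₂ m₂ : ℕ} {P : Type} [Fintype P] [LinearOrder P] [Parity P]
  {M₁ : SuperManifold.{u} n₁ m₁} {M₂ : SuperManifold.{u} n₂ m₂}

theorem ThickMorphism.ext' {Φ Ψ : ThickMorphism P M₁ M₂} (h1 : Φ.base = Ψ.base)
    (h2 : Φ.gen = Ψ.gen) : Φ = Ψ := by
  cases Φ
  cases Ψ
  cases h1
  cases h2
  rfl

/-- The points in chart `i` that are mapped to an open set. -/
def chartDom (M : SuperManifold.{u} n₁ m₁) (i : M.ι) (W : Set M.carrier) : Set (Fin n₁ → ℝ) :=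
  {x | x ∈ (M.chart i).target ∧ (M.chart i).symm x ∈ W}

theorem isOpen_chartDom (M : SuperManifold.{u} n₁ m₁) (i : M.ι) {W : Set M.carrier}
    (hW : IsOpen W) : IsOpen (chartDom M i W) :=
  (M.chart i).symm.continuousOn.isOpen_inter_preimage (M.chart i).open_target hW

theorem mem_chartDom {M : SuperManifold.{u} n₁ m₁} {i : M.ι} {W : Set M.carrier} {b : M.carrier}
    (hi : b ∈ (M.chart i).source) (hb : b ∈ W) : M.chart i b ∈ chartDom M i W :=
  ⟨(M.chart i).map_source hi, by rwa [(M.chart i).left_inv hi]⟩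

theorem IsPt.exists_isPoint {Q : Type} [Fintype Q] [LinearOrder Q] [Parity Q] {B : SuperWeil}
    {i : M₁.ι} {W : Set M₁.carrier} {c : P → B} {x : Ix n₁ m₁ → B} {q : Q → B}
    (h : IsPt (chartDom M₁ i W) c x q) : ∃ b ∈ W, M₁.IsPoint B i b x :=
  ⟨(M₁.chart i).symm fun a => B.aug (x (.even a)), h.body.2,
    (M₁.chart i).map_target h.body.1, h.par, fun a =>
      (congrFun ((M₁.chart i).right_inv h.body.1) a).symm⟩

/-- The domain of the generating function in the charts `i`, `j`. -/
def ThickMorphism.dom (Φ : ThickMorphism P M₁ M₂) (i : M₁.ι) (j : M₂.ι) : Set (Fin n₁ → ℝ) :=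
  chartDom M₁ i (Φ.base ⁻¹' (M₂.chart j).source)

variable (Φ : ThickMorphism P M₁ M₂) {i i' : M₁.ι} {j j' : M₂.ι} {B : SuperWeil}
  {b : M₁.carrier} {c : P → B} {x : Ix n₁ m₁ → B} {y q : Ix n₂ m₂ → B}

theorem ThickMorphism.isOpen_dom (i : M₁.ι) (j : M₂.ι) : IsOpen (Φ.dom i j) :=
  isOpen_chartDom M₁ i ((M₂.chart j).open_source.preimage Φ.base_continuous)

theorem ThickMorphism.smooth (i : M₁.ι) (j : M₂.ι) : IsSmoothOn (Φ.dom i j) (Φ.gen i j) :=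
  Φ.gen_smooth i j

theorem ThickMorphism.isPt {P' Q : Type} [Fintype P'] [LinearOrder P'] [Parity P'] [Fintype Q]
    [LinearOrder Q] [Parity Q] {c : P' → B} {q : Q → B}
    (hx : M₁.IsPoint B i b x) (hj : Φ.base b ∈ (M₂.chart j).source) (hc : B.IsFormal c)
    (hq : B.IsFormal q) : IsPt (Φ.dom i j) c x q :=
  hx.isPt (mem_chartDom hx.1 hj) hc hq

theorem ThickMorphism.isPoint_yOf (hx : M₁.IsPoint B i b x)
    (hj : Φ.base b ∈ (M₂.chart j).source) (hc : B.IsFormal c) (hq : B.IsFormal q) :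
    M₂.IsPoint B j (Φ.base b) (yOf (Φ.gen i j) c x q) := by
  refine ⟨hj, fun k => ?_, fun a => ?_⟩
  · have := evalAt_mem (Φ.isOpen_dom i j) ((Φ.gen_even i j).dMom k) (Φ.isPt hx hj hc hq)
    rw [zero_add] at this
    exact sgn_mul_mem k this
  · refine (aug_sgn_dMom_even (Φ.isPt hx hj hc hq) a).trans ?_
    rw [hx.body_eq]
    exact Φ.gen_base i j b hx.1 hj a

/-- The transformation law with the target chart fixed: q is unchanged and the two terms yq cancel.
The complementary case, with the source chart fixed, is the next statement. -/
theorem ThickMorphism.evalAt_gen_tr (hx : M₁.IsPoint B i' b x) (hi : b ∈ (M₁.chart i).source)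
    (hj : Φ.base b ∈ (M₂.chart j).source) (hc : B.IsFormal c) (hq : B.IsFormal q) :
    evalAt (Φ.gen i' j) c x q = evalAt (Φ.gen i j) c (M₁.tr i' i x) q := by
  have hy := Φ.isPoint_yOf (hx.tr hi) hj hc hq
  have := Φ.gen_law i i' j j b B c x _ q q hi hx hy hj hc hq hq
    (fun k => (congrFun (hy.mtr_self q) k).symm) fun _ => rfl
  rw [hy.tr_self] at this
  rw [this]
  abel

theorem ThickMorphism.evalAt_gen_mtr {q' : Ix n₂ m₂ → B} (hx : M₁.IsPoint B i b x)
    (hj : Φ.base b ∈ (M₂.chart j).source) (hj' : Φ.base b ∈ (M₂.chart j').source)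
    (hc : B.IsFormal c) (hq' : B.IsFormal q') (hq : q = M₂.mtr j j' y q')
    (hqf : B.IsFormal q) (hy : y = yOf (Φ.gen i j) c x q) :
    evalAt (Φ.gen i j') c x q' =
      evalAt (Φ.gen i j) c x q - ∑ k, y k * q k + ∑ k, M₂.tr j j' y k * q' k := by
  have hyp : M₂.IsPoint B j (Φ.base b) y := hy ▸ Φ.isPoint_yOf hx hj hc hqf
  have := Φ.gen_law i i j j' b B c x y q q' hx.1 hx hyp hj' hc hqf hq'
    (fun k => congrFun hq k) (fun k => by rw [hx.tr_self]; exact congrFun hy k)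
  rw [hx.tr_self] at this
  exact this

theorem isFormal_iff_formalOn :
    Φ.IsFormal ↔ ∀ i j, FormalOn (Φ.dom i j) (Φ.gen i j) := by
  constructor
  · intro h i j α h1 h2 x _
    exact congrFun (h i j α h1 h2) x
  · intro h i j α h1 h2
    funext x
    by_cases hx : x ∈ Φ.dom i j
    · exact h i j α h1 h2 x hx
    · exact (Φ.smooth i j).2.1 α x hx

/-! ### Derivatives in different charts -/

theorem IsFormal.map {σ : Type} [Parity σ] {v : σ → B} (hv : B.IsFormal v) (p : ZMod 2) :
    (B.eps p).IsFormal fun s => B.epsInl p (v s) :=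
  fun s => ⟨SuperWeil.epsInl_mem (hv s).1, (hv s).2⟩

theorem IsFormal.map_add {σ : Type} [DecidableEq σ] [Parity σ] {v : σ → B} (hv : B.IsFormal v)
    (k : σ) : (B.eps (Parity.par k)).IsFormal
      fun s => B.epsInl (Parity.par k) (v s) + epsSingle B k s :=
  fun s => ⟨Submodule.add_mem _ (SuperWeil.epsInl_mem (hv s).1) (epsSingle_mem k s), by
    have h0 : (B.eps (Parity.par k)).aug (epsSingle B k s) = 0 :=
      epsIdeal_le _ (epsSingle_mem_ideal k s)
    rw [_root_.map_add, h0, add_zero]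
    exact (hv s).2⟩

theorem ThickMorphism.dMom_gen_tr (hx : M₁.IsPoint B i' b x) (hi : b ∈ (M₁.chart i).source)
    (hj : Φ.base b ∈ (M₂.chart j).source) (hc : B.IsFormal c) (hq : B.IsFormal q)
    (k : Ix n₂ m₂) :
    evalAt (dMom k (Φ.gen i' j)) c x q = evalAt (dMom k (Φ.gen i j)) c (M₁.tr i' i x) q := by
  refine evalAt_dMom_eq (Φ.isOpen_dom i' j) (Φ.smooth i' j).smoothCoef (Φ.isPt hx hj hc hq) k ?_
  rw [Φ.evalAt_gen_tr (hx.map _) hi hj (IsFormal.map hc _) (IsFormal.map_add hq k), hx.tr_map hi,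
    evalAt_eps_mom (Φ.isOpen_dom i j) (Φ.smooth i j).smoothCoef (Φ.isPt (hx.tr hi) hj hc hq) k,
    Φ.evalAt_gen_tr hx hi hj hc hq]

theorem ThickMorphism.dCoord_gen_tr (hx : M₁.IsPoint B i' b x) (hi : b ∈ (M₁.chart i).source)
    (hj : Φ.base b ∈ (M₂.chart j).source) (hc : B.IsFormal c) (hq : B.IsFormal q)
    (k : Ix n₁ m₁) :
    evalAt (dCoord k (Φ.gen i' j)) c x q =
      M₁.mtr i' i x (fun t => evalAt (dCoord t (Φ.gen i j)) c (M₁.tr i' i x) q) k := by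
  refine evalAt_dCoord_eq (Φ.isOpen_dom i' j) (Φ.smooth i' j).smoothCoef (Φ.isPt hx hj hc hq) k ?_
  have hp := Φ.isPt (hx.tr hi) hj hc hq
  rw [Φ.evalAt_gen_tr (hx.map_add k) hi hj (IsFormal.map hc _) (IsFormal.map hq _),
    Φ.evalAt_gen_tr hx hi hj hc hq,
    show M₁.tr i' i (fun t => B.epsInl (Parity.par k) (x t) + epsSingle B k t) = _ from
      funext (hx.tr_eps hi k)]
  have := evalAt_expand (Φ.isOpen_dom i j) (Φ.smooth i j).smoothCoef SuperWeil.epsIdeal_twoSided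
    SuperWeil.epsIdeal_sq (hp.map (Parity.par k))
    (δx := fun k' => B.epsGen (Parity.par k) * B.epsInl (Parity.par k) (M₁.jac i' i x k k'))
    (δq := 0)
    (fun k' => by
      have := (B.eps (Parity.par k)).mul_mem SuperWeil.epsGen_mem
        (SuperWeil.epsInl_mem (p := Parity.par k) (hx.jac_mem hi k k'))
      rwa [add_left_comm, CharTwo.add_self_eq_zero, add_zero] at this)
    (fun k' => (SuperWeil.epsIdeal_twoSided _ _ SuperWeil.epsGen_mem_ideal).2)
    (fun _ => Submodule.zero_mem _) (fun _ => Submodule.zero_mem _)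
  simp only [Pi.zero_apply, add_zero, zero_mul, Finset.sum_const_zero] at this
  rw [this, evalAt_map _ hp]
  congr 1
  simp only [SuperManifold.mtr, map_sum, map_mul, Finset.mul_sum, evalAt_map _ hp, mul_assoc]

/-- For a fixed source chart the transformation law says that the generating function in the chart
j' is the composition of the one in j with the generating function of the coordinate change. The
envelope identities then give its derivatives, although q depends on q' only implicitly. -/
theorem ThickMorphism.gen_mtr {q' : Ix n₂ m₂ → B} (hx : M₁.IsPoint B i b x)
    (hj : Φ.base b ∈ (M₂.chart j).source) (hj' : Φ.base b ∈ (M₂.chart j').source)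
    (hc : B.IsFormal c) (hq' : B.IsFormal q') (hq : q = M₂.mtr j j' y q')
    (hqf : B.IsFormal q) (hy : y = yOf (Φ.gen i j) c x q) :
    yOf (Φ.gen i j') c x q' = M₂.tr j j' y ∧
      ∀ k, evalAt (dCoord k (Φ.gen i j')) c x q' = evalAt (dCoord k (Φ.gen i j)) c x q := by
  let U : Set (Fin n₁ → ℝ) :=
    chartDom M₁ i (Φ.base ⁻¹' ((M₂.chart j).source ∩ (M₂.chart j').source))
  have hU1 : U ⊆ Φ.dom i j := fun x h => ⟨h.1, h.2.1⟩
  have hU2 : U ⊆ Φ.dom i j' := fun x h => ⟨h.1, h.2.2⟩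
  have L : LocalPair U (M₂.dom j j') (M₂.changeGen P j j') (Φ.gen i j) :=
    { openU := isOpen_chartDom M₁ i (((M₂.chart j).open_source.inter
        (M₂.chart j').open_source).preimage Φ.base_continuous)
      openV := M₂.isOpen_dom j j'
      smooth₃₂ := (M₂.changeGen_smooth j j').smoothCoef
      smooth₂₁ := (Φ.smooth i j).smoothCoef.mono hU1
      even₃₂ := M₂.changeGen_even j j'
      even₂₁ := Φ.gen_even i j
      formal := M₂.changeGen_formal j j'
      maps := by
        intro x hx
        have hs := (M₁.chart i).map_target hx.1
        have := fun a => Φ.gen_base i j _ hs hx.2.1 a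
        rw [(M₁.chart i).right_inv hx.1] at this
        rw [show (fun a => Φ.gen i j (Pi.single (varMom P m₁ (Ix.even a)) 1) x) = _ from
          funext this]
        exact M₂.mem_dom hx.2.1 hx.2.2 }
  have hval : IsCompGen U (M₂.changeGen P j j') (Φ.gen i j) (Φ.gen i j') := by
    intro B c x r y q h s
    obtain ⟨b, hb, hx⟩ := h.exists_isPoint
    have ht := s.target L h
    have hq : q = M₂.mtr j j' y r :=
      funext fun k => (s.2.1 k).trans (M₂.evalAt_dCoord_changeGen j j' ht k)
    rw [Φ.evalAt_gen_mtr hx hb.1 hb.2 h.param h.mom hq s.1 (funext s.2.2),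
      M₂.evalAt_changeGen j j' ht]
    abel
  have hp : IsPt U c x q' := hx.isPt (mem_chartDom
    (W := Φ.base ⁻¹' ((M₂.chart j).source ∩ (M₂.chart j').source)) hx.1 ⟨hj, hj'⟩) hc hq'
  have hyp : M₂.IsPoint B j (Φ.base b) y := hy ▸ Φ.isPoint_yOf hx hj hc hqf
  have hyt : IsPt (M₂.dom j j') c y q' := hyp.isPt (M₂.mem_dom hj hj') hc hq'
  have s : LSol (M₂.changeGen P j j') (Φ.gen i j) c x q' y q :=
    ⟨hqf, fun k => (congrFun hq k).trans (M₂.evalAt_dCoord_changeGen j j' hyt k).symm,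
      fun k => congrFun hy k⟩
  obtain ⟨h1, h2⟩ := L.envelope ((Φ.smooth i j').smoothCoef.mono hU2) hval hp s
  refine ⟨funext fun k => ?_, h2⟩
  unfold yOf
  rw [h1, M₂.evalAt_dMom_changeGen j j' hyt, sgn_mul_sgn_mul]

end ThickPoints

/-! ## Gluing -/

section Glue

variable {n m : ℕ} {P Q : Type} [Fintype P] [LinearOrder P] [Parity P]
  [Fintype Q] [LinearOrder Q] [Parity Q]

-- Equality of values forces equality of coefficients on overlaps, so the coefficients can be chosen
-- pointwise. Smoothness is local.
open Classical in
theorem exists_glue {ι : Type u} {U : ι → Set (Fin n → ℝ)} (hU : ∀ j, IsOpen (U j))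
    {G : ι → Coef n P m Q} (hG : ∀ j, IsSmoothOn (U j) (G j)) {p : ZMod 2}
    (hp : ∀ j, IsHomog p (G j))
    (h : ∀ (j j' : ι) (B : SuperWeil) (c : P → B) (x : Ix n m → B) (q : Q → B),
      IsPt (U j) c x q → IsPt (U j') c x q → evalAt (G j) c x q = evalAt (G j') c x q) :
    ∃ F : Coef n P m Q, IsSmoothOn (⋃ j, U j) F ∧ IsHomog p F ∧
      ∀ (j : ι) (B : SuperWeil) (c : P → B) (x : Ix n m → B) (q : Q → B),
        IsPt (U j) c x q → evalAt F c x q = evalAt (G j) c x q := by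
  have hagree : ∀ j j' α, ∀ x ∈ U j, x ∈ U j' → G j α x = G j' α x := by
    intro j j' α x hx hx'
    refine coef_ext ((hU j).inter (hU j')) ((hG j).smoothCoef.mono Set.inter_subset_left)
      ((hG j').smoothCoef.mono Set.inter_subset_right) (fun B e v hv => ?_) α ⟨hx, hx'⟩
    have := h j j' B _ _ _ (hv.isPt.mono Set.inter_subset_left)
      (hv.isPt.mono Set.inter_subset_right)
    rw [evalAt_eq_evalV, evalAt_eq_evalV, varVal_coordOf] at this
    exact this
  let F : Coef n P m Q := fun α x => if hx : ∃ j, x ∈ U j then G hx.choose α x else 0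
  have hF : ∀ j α, ∀ x ∈ U j, F α x = G j α x := by
    intro j α x hx
    have hx' : ∃ j, x ∈ U j := ⟨j, hx⟩
    exact (dif_pos hx').trans (hagree _ _ α x hx'.choose_spec hx)
  have hF0 : ∀ α x, (¬ ∃ j, x ∈ U j) → F α x = 0 := fun α x hx => dif_neg hx
  refine ⟨F, ⟨fun α x hx => ?_, fun α x hx => hF0 α x (by simpa using hx), fun α s hs h2 => ?_⟩,
    fun α x hne => ?_, fun j B c x q hpt => evalAt_congr (hU j) hpt (hF j)⟩
  · obtain ⟨j, hj⟩ := Set.mem_iUnion.1 hx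
    have h1 : ContDiffAt ℝ ∞ (G j α) x := ((hG j).1 α).contDiffAt ((hU j).mem_nhds hj)
    exact (h1.congr_of_eventuallyEq (Filter.eventually_of_mem ((hU j).mem_nhds hj)
      (hF j α))).contDiffWithinAt
  · funext x
    by_cases hx : ∃ j, x ∈ U j
    · obtain ⟨j, hj⟩ := hx
      rw [hF j α x hj, (hG j).2.2 α s hs h2]
    · exact hF0 α x hx
  · by_cases hx : ∃ j, x ∈ U j
    · obtain ⟨j, hj⟩ := hx
      rw [hF j α x hj] at hne
      exact hp j α x hne
    · exact absurd (hF0 α x hx) hne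

end Glue

/-! ## Composition -/

section Composition

variable {n₁ m₁ n₂ m₂ n₃ m₃ : ℕ} {P : Type} [Fintype P] [LinearOrder P] [Parity P]
  {M₁ : SuperManifold.{u} n₁ m₁} {M₂ : SuperManifold.{u} n₂ m₂} {M₃ : SuperManifold.{u} n₃ m₃}
  {Φ₃₂ : ThickMorphism P M₂ M₃} {Φ₂₁ : ThickMorphism P M₁ M₂}

/-- The domain of the generating function of a composition in the charts `i`, `j`, `l`. -/
def compDom (Φ₃₂ : ThickMorphism P M₂ M₃) (Φ₂₁ : ThickMorphism P M₁ M₂) (i : M₁.ι) (j : M₂.ι)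
    (l : M₃.ι) : Set (Fin n₁ → ℝ) :=
  chartDom M₁ i {b | Φ₂₁.base b ∈ (M₂.chart j).source ∧
    Φ₃₂.base (Φ₂₁.base b) ∈ (M₃.chart l).source}

theorem localPair (hf : Φ₃₂.IsFormal) (i : M₁.ι) (j : M₂.ι) (l : M₃.ι) :
    LocalPair (compDom Φ₃₂ Φ₂₁ i j l) (Φ₃₂.dom j l) (Φ₃₂.gen j l) (Φ₂₁.gen i j) where
  openU := isOpen_chartDom M₁ i (((M₂.chart j).open_source.preimage Φ₂₁.base_continuous).inter
    ((M₃.chart l).open_source.preimage (Φ₃₂.base_continuous.comp Φ₂₁.base_continuous)))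
  openV := Φ₃₂.isOpen_dom j l
  smooth₃₂ := (Φ₃₂.smooth j l).smoothCoef
  smooth₂₁ := (Φ₂₁.smooth i j).smoothCoef.mono fun x h => ⟨h.1, h.2.1⟩
  even₃₂ := Φ₃₂.gen_even j l
  even₂₁ := Φ₂₁.gen_even i j
  formal := (isFormal_iff_formalOn Φ₃₂).1 hf j l
  maps := by
    intro x hx
    have hs := (M₁.chart i).map_target hx.1
    have := fun a => Φ₂₁.gen_base i j _ hs hx.2.1 a
    rw [(M₁.chart i).right_inv hx.1] at this
    rw [show (fun a => Φ₂₁.gen i j (Pi.single (varMom P m₁ (Ix.even a)) 1) x) = _ from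
      funext this]
    exact mem_chartDom hx.2.1 hx.2.2

variable {B : SuperWeil} {c : P → B} {i i' : M₁.ι} {j j' : M₂.ι} {l l' : M₃.ι} {b : M₁.carrier}
  {x : Ix n₁ m₁ → B} {r : Ix n₃ m₃ → B} {y q : Ix n₂ m₂ → B}

theorem Admissible.isPt (h : Admissible Φ₃₂ Φ₂₁ c i j l b x r) :
    IsPt (compDom Φ₃₂ Φ₂₁ i j l) c x r :=
  h.2.1.isPt (mem_chartDom (W := {b | Φ₂₁.base b ∈ (M₂.chart j).source ∧
    Φ₃₂.base (Φ₂₁.base b) ∈ (M₃.chart l).source}) h.2.1.1 ⟨h.2.2.1, h.2.2.2.1⟩) h.1 h.2.2.2.2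

theorem IsPt.exists_admissible (h : IsPt (compDom Φ₃₂ Φ₂₁ i j l) c x r) :
    ∃ b, Admissible Φ₃₂ Φ₂₁ c i j l b x r := by
  obtain ⟨b, hb, hx⟩ := h.exists_isPoint
  exact ⟨b, h.param, hx, hb.1, hb.2, h.mom⟩

/-- The condition that y lies over the image point follows from the second equation, since the
linear coefficients of the generating function reduce to the underlying map. -/
theorem solves_iff (h : Admissible Φ₃₂ Φ₂₁ c i j l b x r) :
    Solves Φ₃₂ Φ₂₁ c i j l b x r y q ↔ LSol (Φ₃₂.gen j l) (Φ₂₁.gen i j) c x r y q := by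
  refine ⟨fun s => s.2, fun s => ⟨?_, s⟩⟩
  have : y = yOf (Φ₂₁.gen i j) c x q := funext s.2.2
  rw [this]
  exact Φ₂₁.isPoint_yOf h.2.1 h.2.2.1 h.1 s.1

theorem Solves.y_eq (s : Solves Φ₃₂ Φ₂₁ c i j l b x r y q) : y = yOf (Φ₂₁.gen i j) c x q :=
  funext s.2.2.2

theorem Solves.q_eq (s : Solves Φ₃₂ Φ₂₁ c i j l b x r y q) :
    q = fun k => evalAt (dCoord k (Φ₃₂.gen j l)) c y r := funext s.2.2.1

theorem existsUnique_solves (hf : Φ₃₂.IsFormal) (h : Admissible Φ₃₂ Φ₂₁ c i j l b x r) :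
    ∃! yq : (Ix n₂ m₂ → B) × (Ix n₂ m₂ → B), Solves Φ₃₂ Φ₂₁ c i j l b x r yq.1 yq.2 := by
  obtain ⟨y, q, s⟩ := (localPair hf i j l).exists_sol h.isPt
  refine ⟨(y, q), (solves_iff h).2 s, ?_⟩
  rintro ⟨y', q'⟩ s'
  obtain ⟨rfl, rfl⟩ := ((solves_iff h).1 s').unique (localPair hf i j l) h.isPt s
  rfl

theorem Solves.unique (hf : Φ₃₂.IsFormal) (h : Admissible Φ₃₂ Φ₂₁ c i j l b x r)
    (s : Solves Φ₃₂ Φ₂₁ c i j l b x r y q) {y' q' : Ix n₂ m₂ → B}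
    (s' : Solves Φ₃₂ Φ₂₁ c i j l b x r y' q') : y = y' ∧ q = q' :=
  LSol.unique (localPair hf i j l) h.isPt ((solves_iff h).1 s) ((solves_iff h).1 s')

/-- Uniqueness of the series follows from uniqueness at points, because superfunctions are
determined by their values. -/
theorem existsUnique_series (hf : Φ₃₂.IsFormal) (i : M₁.ι) (j : M₂.ι) (l : M₃.ι) :
    ∃! YQ : (Ix n₂ m₂ → Coef n₁ P m₁ (Ix n₃ m₃)) × (Ix n₂ m₂ → Coef n₁ P m₁ (Ix n₃ m₃)),
      IsSeriesSolution Φ₃₂ Φ₂₁ i j l YQ.1 YQ.2 := by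
  have L := localPair (Φ₂₁ := Φ₂₁) hf i j l
  obtain ⟨Y, R, hY, hR, hsol⟩ := L.exists_series
  refine ⟨(Y, R), ⟨hY, hR, fun B c b x r h => (solves_iff h).2 (hsol B c x r h.isPt)⟩, ?_⟩
  rintro ⟨Y', R'⟩ ⟨hY', hR', hsol'⟩
  have key : ∀ (B : SuperWeil) (c : P → B) (x : Ix n₁ m₁ → B) (r : Ix n₃ m₃ → B),
      IsPt (compDom Φ₃₂ Φ₂₁ i j l) c x r →
      (fun k => evalAt (Y' k) c x r) = (fun k => evalAt (Y k) c x r) ∧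
        (fun k => evalAt (R' k) c x r) = fun k => evalAt (R k) c x r := by
    intro B c x r h
    obtain ⟨b, hb⟩ := h.exists_admissible
    exact LSol.unique L h ((solves_iff hb).1 (hsol' B c b x r hb)) (hsol B c x r h)
  refine Prod.ext (funext fun k => ?_) (funext fun k => ?_)
  · exact (hY' k).ext (hY k) L.openU fun B c x r h => congrFun (key B c x r h).1 k
  · exact (hR' k).ext (hR k) L.openU fun B c x r h => congrFun (key B c x r h).2 k

/-! ### Solutions in different charts -/

/-- The pair (y, q) transforms as a point of the cotangent bundle of the middle manifold. The first
equation is carried over by the source law of `Φ₃₂`, the second by the target law of `Φ₂₁`. -/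
theorem Solves.change_middle (h : Admissible Φ₃₂ Φ₂₁ c i j l b x r)
    (s : Solves Φ₃₂ Φ₂₁ c i j l b x r y q) (hj' : Φ₂₁.base b ∈ (M₂.chart j').source) :
    Solves Φ₃₂ Φ₂₁ c i j' l b x r (M₂.tr j j' y) (M₂.mtr j' j (M₂.tr j j' y) q) := by
  have hf := (s.1.tr hj').mtr_isFormal h.2.2.1 s.2.1
  have hq : q = M₂.mtr j j' y (M₂.mtr j' j (M₂.tr j j' y) q) := (s.1.mtr_inv hj' q).symm
  refine ⟨s.1.tr hj', hf, fun k => ?_, fun k => ?_⟩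
  · rw [Φ₃₂.dCoord_gen_tr (s.1.tr hj') h.2.2.1 h.2.2.2.1 h.1 h.2.2.2.2, s.1.tr_inv hj', ← s.q_eq]
  · exact (congrFun (Φ₂₁.gen_mtr h.2.1 h.2.2.1 hj' h.1 hf hq s.2.1 s.y_eq).1 k).symm

/-- The correction terms in the target law of `Φ₂₁` are exactly the difference of the two terms yq,
so the composite value does not see the middle chart. -/
theorem Solves.value_middle (h : Admissible Φ₃₂ Φ₂₁ c i j l b x r)
    (s : Solves Φ₃₂ Φ₂₁ c i j l b x r y q) (hj' : Φ₂₁.base b ∈ (M₂.chart j').source)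
    {y' q' : Ix n₂ m₂ → B} (hy' : y' = M₂.tr j j' y)
    (hq' : q' = M₂.mtr j' j (M₂.tr j j' y) q) :
    evalAt (Φ₃₂.gen j' l) c y' r + evalAt (Φ₂₁.gen i j') c x q' - ∑ k, y' k * q' k =
      evalAt (Φ₃₂.gen j l) c y r + evalAt (Φ₂₁.gen i j) c x q - ∑ k, y k * q k := by
  subst hy' hq'
  have hf := (s.1.tr hj').mtr_isFormal h.2.2.1 s.2.1
  have hq : q = M₂.mtr j j' y (M₂.mtr j' j (M₂.tr j j' y) q) := (s.1.mtr_inv hj' q).symm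
  rw [Φ₃₂.evalAt_gen_tr (s.1.tr hj') h.2.2.1 h.2.2.2.1 h.1 h.2.2.2.2, s.1.tr_inv hj',
    Φ₂₁.evalAt_gen_mtr h.2.1 h.2.2.1 hj' h.1 hf hq s.2.1 s.y_eq]
  abel

/-- For each middle chart j there is a local generating function. They agree on overlaps by
`Solves.value_middle`, and the middle charts cover the image, so they glue to one function for the
pair (i, l). -/
theorem exists_compGen (hf : Φ₃₂.IsFormal) (i : M₁.ι) (l : M₃.ι) :
    ∃ F : Coef n₁ P m₁ (Ix n₃ m₃),
      IsSmoothOn (chartDom M₁ i (Φ₃₂.base ∘ Φ₂₁.base ⁻¹' (M₃.chart l).source)) F ∧ IsHomog 0 F ∧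
      ∀ j, IsCompGen (compDom Φ₃₂ Φ₂₁ i j l) (Φ₃₂.gen j l) (Φ₂₁.gen i j) F := by
  choose G hG1 hG2 hG3 using fun j => (localPair (Φ₂₁ := Φ₂₁) hf i j l).exists_gen
  obtain ⟨F, hF1, hF2, hF3⟩ := exists_glue (fun j => (localPair (Φ₂₁ := Φ₂₁) hf i j l).openU) hG1
    hG2 (by
      intro j j' B c x r h h'
      obtain ⟨b, hb, hx⟩ := h.exists_isPoint
      have ha : Admissible Φ₃₂ Φ₂₁ c i j l b x r := ⟨h.param, hx, hb.1, hb.2, h.mom⟩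
      have hb' : Φ₂₁.base b ∈ (M₂.chart j').source := by
        have := h'.body.2.1
        rwa [hx.body_eq, (M₁.chart i).left_inv hx.1] at this
      obtain ⟨y, q, s⟩ := (localPair hf i j l).exists_sol h
      have s1 := (solves_iff ha).2 s
      have s2 := s1.change_middle ha hb'
      rw [hG3 j B c x r _ _ h s, hG3 j' B c x r _ _ h' s2.2, s1.value_middle ha hb' rfl rfl])
  refine ⟨F, ?_, hF2, fun j B c x r y q h s => ?_⟩
  · have : chartDom M₁ i (Φ₃₂.base ∘ Φ₂₁.base ⁻¹' (M₃.chart l).source) =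
        ⋃ j, compDom Φ₃₂ Φ₂₁ i j l := by
      ext x
      rw [Set.mem_iUnion]
      constructor
      · rintro ⟨h1, h2⟩
        obtain ⟨j, hj⟩ := M₂.cover (Φ₂₁.base ((M₁.chart i).symm x))
        exact ⟨j, h1, hj, h2⟩
      · rintro ⟨j, h1, h2, h3⟩
        exact ⟨h1, h3⟩
    rwa [this]
  · rw [hF3 j B c x r h, hG3 j B c x r y q h s]

end Composition

/-! ## The composition law -/

section Composite

variable {n₁ m₁ n₂ m₂ n₃ m₃ : ℕ} {P : Type} [Fintype P] [LinearOrder P] [Parity P]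
  {M₁ : SuperManifold.{u} n₁ m₁} {M₂ : SuperManifold.{u} n₂ m₂} {M₃ : SuperManifold.{u} n₃ m₃}
  {Φ₃₂ : ThickMorphism P M₂ M₃} {Φ₂₁ : ThickMorphism P M₁ M₂} {Φ₃₁ : ThickMorphism P M₁ M₃}
  {B : SuperWeil} {c : P → B} {i i' : M₁.ι} {j j' : M₂.ι} {l l' : M₃.ι} {b : M₁.carrier}
  {x x' : Ix n₁ m₁ → B} {r r' : Ix n₃ m₃ → B} {y q : Ix n₂ m₂ → B}

/-- Changing the charts of x and r leaves (y, q) untouched: the derivatives of `Φ₃₂` in y and of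
`Φ₂₁` in q are the same in the new charts, provided r transforms at the point z determined by (y,
r). -/
theorem Solves.change_outer (h : Admissible Φ₃₂ Φ₂₁ c i j l b (M₁.tr i' i x') r)
    (s : Solves Φ₃₂ Φ₂₁ c i j l b (M₁.tr i' i x') r y q) (hx' : M₁.IsPoint B i' b x')
    (hl' : Φ₃₂.base (Φ₂₁.base b) ∈ (M₃.chart l').source) (hr' : B.IsFormal r')
    (hr : r = M₃.mtr l l' (yOf (Φ₃₂.gen j l) c y r) r') :
    Solves Φ₃₂ Φ₂₁ c i' j l' b x' r' y q := by
  refine ⟨s.1, s.2.1, fun k => ?_, fun k => ?_⟩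
  · rw [(Φ₃₂.gen_mtr s.1 h.2.2.2.1 hl' h.1 hr' hr h.2.2.2.2 rfl).2 k]
    exact s.2.2.1 k
  · rw [Φ₂₁.dMom_gen_tr hx' h.2.1.1 h.2.2.1 h.1 s.2.1]
    exact s.2.2.2 k

theorem Solves.value_outer (h : Admissible Φ₃₂ Φ₂₁ c i j l b (M₁.tr i' i x') r)
    (s : Solves Φ₃₂ Φ₂₁ c i j l b (M₁.tr i' i x') r y q) (hx' : M₁.IsPoint B i' b x')
    (hl' : Φ₃₂.base (Φ₂₁.base b) ∈ (M₃.chart l').source) (hr' : B.IsFormal r')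
    {z : Ix n₃ m₃ → B} (hz : z = yOf (Φ₃₂.gen j l) c y r) (hr : r = M₃.mtr l l' z r') :
    evalAt (Φ₃₂.gen j l') c y r' + evalAt (Φ₂₁.gen i' j) c x' q - ∑ k, y k * q k =
      evalAt (Φ₃₂.gen j l) c y r + evalAt (Φ₂₁.gen i j) c (M₁.tr i' i x') q - ∑ k, y k * q k -
        ∑ k, z k * r k + ∑ k, M₃.tr l l' z k * r' k := by
  rw [Φ₃₂.evalAt_gen_mtr s.1 h.2.2.2.1 hl' h.1 hr' hr h.2.2.2.2 hz,
    Φ₂₁.evalAt_gen_tr hx' h.2.1.1 h.2.2.1 h.1 s.2.1]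
  abel

theorem Solves.envelope (hf : Φ₃₂.IsFormal) {F : Coef n₁ P m₁ (Ix n₃ m₃)}
    (hF : SmoothCoef (compDom Φ₃₂ Φ₂₁ i j l) F)
    (hval : IsCompGen (compDom Φ₃₂ Φ₂₁ i j l) (Φ₃₂.gen j l) (Φ₂₁.gen i j) F)
    (h : Admissible Φ₃₂ Φ₂₁ c i j l b x r) (s : Solves Φ₃₂ Φ₂₁ c i j l b x r y q) :
    yOf F c x r = yOf (Φ₃₂.gen j l) c y r ∧
      ∀ k, evalAt (dCoord k F) c x r = evalAt (dCoord k (Φ₂₁.gen i j)) c x q := by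
  have := (localPair hf i j l).envelope hF hval h.isPt ((solves_iff h).1 s)
  exact ⟨funext fun k => congrArg (sgn B k * ·) (this.1 k), this.2⟩

theorem exists_realPoint {n m : ℕ} (M : SuperManifold.{u} n m) {i : M.ι} {b : M.carrier}
    (hi : b ∈ (M.chart i).source) : ∃ x : Ix n m → realWeil, M.IsPoint realWeil i b x := by
  refine ⟨fun k => match k with
    | .even a => (M.chart i b a : ℝ)
    | .odd _ => (0 : ℝ), hi, fun k => ?_, fun a => rfl⟩
  match k with
  | .even a => exact realWeil_mem _
  | .odd _ => exact Submodule.zero_mem _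

/-- This translates the condition on linear coefficients into a condition on points: the body of the
derivative in an even momentum is the linear coefficient. -/
theorem base_of_isPoint_yOf {F : Coef n₁ P m₁ (Ix n₂ m₂)} {U : Set (Fin n₁ → ℝ)}
    (h : IsPt U c x q) (hx : M₁.IsPoint B i b x) {b' : M₂.carrier}
    (hy : M₂.IsPoint B j b' (yOf F c x q)) (a : Fin n₂) :
    F (Pi.single (Sum.inrₗ (Sum.inrₗ (Ix.even a))) 1) (M₁.chart i b) = M₂.chart j b' a := by
  rw [← hy.2.2 a, ← hx.body_eq]
  exact (aug_sgn_dMom_even h a).symm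

theorem compDom_subset : compDom Φ₃₂ Φ₂₁ i j l ⊆
    chartDom M₁ i (Φ₃₂.base ∘ Φ₂₁.base ⁻¹' (M₃.chart l).source) := fun _ h => ⟨h.1, h.2.2⟩

/-- The composition of thick morphisms. -/
def ThickMorphism.comp (Φ₃₂ : ThickMorphism P M₂ M₃) (Φ₂₁ : ThickMorphism P M₁ M₂)
    (hf : Φ₃₂.IsFormal) : ThickMorphism P M₁ M₃ where
  base := Φ₃₂.base ∘ Φ₂₁.base
  base_continuous := Φ₃₂.base_continuous.comp Φ₂₁.base_continuous
  gen i l := (exists_compGen (Φ₂₁ := Φ₂₁) hf i l).choose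
  gen_smooth i l := (exists_compGen (Φ₂₁ := Φ₂₁) hf i l).choose_spec.1
  gen_even i l := (exists_compGen (Φ₂₁ := Φ₂₁) hf i l).choose_spec.2.1
  gen_base := by
    intro i l b hi hl a
    obtain ⟨h1, h2, h3⟩ := (exists_compGen (Φ₂₁ := Φ₂₁) hf i l).choose_spec
    obtain ⟨j, hj⟩ := M₂.cover (Φ₂₁.base b)
    obtain ⟨x, hx⟩ := exists_realPoint M₁ hi
    have ha : Admissible Φ₃₂ Φ₂₁ (0 : P → realWeil) i j l b x 0 :=
      ⟨SuperWeil.isFormal_zero, hx, hj, hl, SuperWeil.isFormal_zero⟩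
    obtain ⟨⟨y, q⟩, s, -⟩ := existsUnique_solves hf ha
    -- The derivative of S₃₁ in r is that of S₃₂ at the intermediate point, which lies over the
    -- image under both maps.
    have := (Solves.envelope hf (h1.smoothCoef.mono compDom_subset) (h3 j) ha s).1
    refine base_of_isPoint_yOf ha.isPt hx (j := l) (b' := Φ₃₂.base (Φ₂₁.base b)) ?_ a
    rw [this]
    exact Φ₃₂.isPoint_yOf s.1 hl SuperWeil.isFormal_zero SuperWeil.isFormal_zero
  gen_law := by
    intro i i' l l' b B c x' z r r' hi hx' hzp hl' hc hr hr' hrz hz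
    obtain ⟨h1, h2, h3⟩ := (exists_compGen (Φ₂₁ := Φ₂₁) hf i l).choose_spec
    obtain ⟨h1', h2', h3'⟩ := (exists_compGen (Φ₂₁ := Φ₂₁) hf i' l').choose_spec
    obtain ⟨j, hj⟩ := M₂.cover (Φ₂₁.base b)
    have hx := hx'.tr hi
    have ha : Admissible Φ₃₂ Φ₂₁ c i j l b (M₁.tr i' i x') r := ⟨hc, hx, hj, hzp.1, hr⟩
    have ha' : Admissible Φ₃₂ Φ₂₁ c i' j l' b x' r' := ⟨hc, hx', hj, hl', hr'⟩
    obtain ⟨⟨y, q⟩, s, -⟩ := existsUnique_solves hf ha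
    -- The law is stated with z computed from S₃₁. By the envelope identity it is also the z
    -- computed from S₃₂, to which the laws of the two factors apply.
    have he := (Solves.envelope hf (h1.smoothCoef.mono compDom_subset) (h3 j) ha s).1
    have hz' : z = yOf (Φ₃₂.gen j l) c y r := (funext hz).trans he
    have hrz' : r = M₃.mtr l l' z r' := funext hrz
    have s' := s.change_outer ha hx' hl' hr' (hz' ▸ hrz')
    rw [h3' j B c x' r' y q ha'.isPt ((solves_iff ha').1 s'),
      s.value_outer ha hx' hl' hr' hz' hrz', h3 j B c _ r y q ha.isPt ((solves_iff ha).1 s)]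

theorem hasCompositeGen_iff : HasCompositeGen Φ₃₂ Φ₂₁ Φ₃₁ ↔ Φ₃₁.base = Φ₃₂.base ∘ Φ₂₁.base ∧
    ∀ i j l, IsCompGen (compDom Φ₃₂ Φ₂₁ i j l) (Φ₃₂.gen j l) (Φ₂₁.gen i j) (Φ₃₁.gen i l) := by
  refine and_congr_right fun _ => ⟨fun h i j l B c x r y q hp s => ?_, fun h => ?_⟩
  · obtain ⟨b, hb⟩ := hp.exists_admissible
    exact h B c i j l b x r y q hb ((solves_iff hb).2 s)
  · intro B c i j l b x r y q hb s
    exact h i j l B c x r y q hb.isPt ((solves_iff hb).1 s)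

theorem hasCompositeGen_comp (hf : Φ₃₂.IsFormal) :
    HasCompositeGen Φ₃₂ Φ₂₁ (Φ₃₂.comp Φ₂₁ hf) :=
  hasCompositeGen_iff.2 ⟨rfl, fun i j l =>
    (exists_compGen (Φ₂₁ := Φ₂₁) hf i l).choose_spec.2.2 j⟩

/-- Thick morphisms with equal values of the generating functions are equal. -/
theorem ThickMorphism.ext_values {Φ Ψ : ThickMorphism P M₁ M₂} (h1 : Φ.base = Ψ.base)
    (h2 : ∀ (B : SuperWeil) (c : P → B) (i : M₁.ι) (j : M₂.ι) (b : M₁.carrier)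
      (x : Ix n₁ m₁ → B) (q : Ix n₂ m₂ → B), B.IsFormal c → M₁.IsPoint B i b x →
      Φ.base b ∈ (M₂.chart j).source → B.IsFormal q →
      evalAt (Φ.gen i j) c x q = evalAt (Ψ.gen i j) c x q) : Φ = Ψ := by
  refine ThickMorphism.ext' h1 (funext fun i => funext fun j => ?_)
  have hdom : Ψ.dom i j = Φ.dom i j := by
    unfold ThickMorphism.dom
    rw [h1]
  refine (Φ.smooth i j).ext (hdom ▸ Ψ.smooth i j) (Φ.isOpen_dom i j) fun B c x q h => ?_
  obtain ⟨b, hb, hx⟩ := h.exists_isPoint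
  exact h2 B c i j b x q h.param hx hb h.mom

theorem HasCompositeGen.unique (hf : Φ₃₂.IsFormal) {Φ Ψ : ThickMorphism P M₁ M₃}
    (hΦ : HasCompositeGen Φ₃₂ Φ₂₁ Φ) (hΨ : HasCompositeGen Φ₃₂ Φ₂₁ Ψ) : Φ = Ψ := by
  refine ThickMorphism.ext_values (hΦ.1.trans hΨ.1.symm) fun B c i l b x r hc hx hl hr => ?_
  obtain ⟨j, hj⟩ := M₂.cover (Φ₂₁.base b)
  rw [hΦ.1] at hl
  have ha : Admissible Φ₃₂ Φ₂₁ c i j l b x r := ⟨hc, hx, hj, hl, hr⟩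
  obtain ⟨⟨y, q⟩, s, -⟩ := existsUnique_solves hf ha
  rw [hΦ.2 B c i j l b x r y q ha s, hΨ.2 B c i j l b x r y q ha s]

theorem HasCompositeGen.envelope (hf : Φ₃₂.IsFormal) (hΦ : HasCompositeGen Φ₃₂ Φ₂₁ Φ₃₁)
    (h : Admissible Φ₃₂ Φ₂₁ c i j l b x r) (s : Solves Φ₃₂ Φ₂₁ c i j l b x r y q) :
    yOf (Φ₃₁.gen i l) c x r = yOf (Φ₃₂.gen j l) c y r ∧
      ∀ k, evalAt (dCoord k (Φ₃₁.gen i l)) c x r = evalAt (dCoord k (Φ₂₁.gen i j)) c x q := by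
  refine Solves.envelope hf ?_ ((hasCompositeGen_iff.1 hΦ).2 i j l) h s
  refine (Φ₃₁.smooth i l).smoothCoef.mono ?_
  unfold ThickMorphism.dom
  rw [hΦ.1]
  exact compDom_subset

/-! ### Formal canonical relations -/

theorem ThickMorphism.Rel.coord_eq {Φ : ThickMorphism P M₁ M₂} {u : CotangentPoint M₁ B}
    {v : CotangentPoint M₂ B} (h : Φ.Rel c u v) (hi : u.base ∈ (M₁.chart i).source)
    (hj : v.base ∈ (M₂.chart j).source) :
    v.coord j hj = yOf (Φ.gen i j) c (u.coord i hi) (v.mom j hj) :=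
  funext (h.2.2 i hi j hj).1

theorem CotangentPoint.mom_eq {M : SuperManifold.{u} n₁ m₁} (u : CotangentPoint M B) {i j : M.ι}
    (hi : u.base ∈ (M.chart i).source) (hj : u.base ∈ (M.chart j).source) :
    u.mom i hi = M.mtr i j (u.coord i hi) (u.mom j hj) :=
  funext (u.mom_compat i j hi hj)

/-- Given related points u and w, the intermediate point is assembled from the solutions (y, q) in
all middle charts. Conversely, the coordinates and momenta of any intermediate point solve the
system. In both directions the envelope identities match z and p with the derivatives of S₃₁. -/
theorem isRelComposite_of_gen (hf : Φ₃₂.IsFormal) (hΦ : HasCompositeGen Φ₃₂ Φ₂₁ Φ₃₁) :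
    IsRelComposite Φ₃₂ Φ₂₁ Φ₃₁ := by
  intro B c hc u w
  constructor
  · intro hR
    obtain ⟨hbase, hnil, hrel⟩ := id hR
    rw [hΦ.1] at hbase
    have hbase' : w.base = Φ₃₂.base (Φ₂₁.base u.base) := hbase
    have hwf : ∀ l hl, B.IsFormal (w.mom l hl) := fun l hl k => ⟨w.mom_par l hl k, hnil l hl k⟩
    obtain ⟨i₀, hi₀⟩ := M₁.cover u.base
    obtain ⟨l₀, hl₀⟩ := M₃.cover w.base
    have hadm : ∀ i (hi : u.base ∈ (M₁.chart i).source) j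
        (hj : Φ₂₁.base u.base ∈ (M₂.chart j).source) l (hl : w.base ∈ (M₃.chart l).source),
        Admissible Φ₃₂ Φ₂₁ c i j l u.base (u.coord i hi) (w.mom l hl) :=
      fun i hi j hj l hl => ⟨hc, u.isPoint i hi, hj, hbase' ▸ hl, hwf l hl⟩
    choose yq hyq using fun j (hj : Φ₂₁.base u.base ∈ (M₂.chart j).source) =>
      (existsUnique_solves hf (hadm i₀ hi₀ j hj l₀ hl₀)).exists
    -- The solutions are chosen in fixed charts i₀, l₀ of the outer manifolds. They solve the system
    -- in all other charts as well, because w transforms at the z given by the envelope.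
    have hall : ∀ i hi j hj l hl, Solves Φ₃₂ Φ₂₁ c i j l u.base (u.coord i hi) (w.mom l hl)
        (yq j hj).1 (yq j hj).2 := by
      intro i hi j hj l hl
      have hx : u.coord i₀ hi₀ = M₁.tr i i₀ (u.coord i hi) := u.coord_compat i i₀ hi hi₀
      have hs := hyq j hj
      have ha := hadm i₀ hi₀ j hj l₀ hl₀
      have hz : w.coord l₀ hl₀ = yOf (Φ₃₂.gen j l₀) c (yq j hj).1 (w.mom l₀ hl₀) :=
        (hR.coord_eq hi₀ hl₀).trans (hΦ.envelope hf ha hs).1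
      rw [hx] at hs ha
      refine hs.change_outer ha (u.isPoint i hi) (hbase' ▸ hl) (hwf l hl) ?_
      rw [← hz]
      exact w.mom_eq hl₀ hl
    -- Transporting the solution from j to j' gives a solution in j'. By uniqueness it is the chosen
    -- one, which is the compatibility required of a cotangent point.
    have htr : ∀ j j' hj hj', (yq j' hj').1 = M₂.tr j j' (yq j hj).1 ∧
        (yq j' hj').2 = M₂.mtr j' j (M₂.tr j j' (yq j hj).1) (yq j hj).2 := by
      intro j j' hj hj'
      exact (hyq j' hj').unique hf (hadm i₀ hi₀ j' hj' l₀ hl₀)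
        ((hyq j hj).change_middle (hadm i₀ hi₀ j hj l₀ hl₀) hj')
    refine ⟨{ base := Φ₂₁.base u.base
              coord := fun j hj => (yq j hj).1
              mom := fun j hj => (yq j hj).2
              isPoint := fun j hj => (hyq j hj).1
              mom_par := fun j hj k => ((hyq j hj).2.1 k).1
              coord_compat := fun j j' hj hj' => (htr j j' hj hj').1
              mom_compat := fun j j' hj hj' k => ?_ }, ⟨rfl, fun j hj k => ((hyq j hj).2.1 k).2,
        fun i hi j hj => ⟨(hall i hi j hj l₀ hl₀).2.2.2, fun k => ?_⟩⟩,
      ⟨hbase', hnil, fun j hj l hl => ⟨fun k => ?_, (hall i₀ hi₀ j hj l hl).2.2.1⟩⟩⟩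
    · have := (htr j' j hj' hj)
      change (yq j hj).2 k = M₂.mtr j j' (yq j hj).1 (yq j' hj').2 k
      rw [this.2, ← this.1]
    · rw [← (hΦ.envelope hf (hadm i hi j hj l₀ hl₀) (hall i hi j hj l₀ hl₀)).2 k]
      exact (hrel i hi l₀ hl₀).2 k
    · exact congrFun ((hR.coord_eq hi₀ hl).trans
        (hΦ.envelope hf (hadm i₀ hi₀ j hj l hl) (hall i₀ hi₀ j hj l hl)).1) k
  · rintro ⟨v, h1, h2⟩
    have hv : v.base = Φ₂₁.base u.base := h1.1
    have hw : w.base = Φ₃₂.base (Φ₂₁.base u.base) := by rw [h2.1, hv]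
    refine ⟨by rw [hw, hΦ.1]; rfl, h2.2.1, fun i hi l hl => ?_⟩
    obtain ⟨j, hj⟩ := M₂.cover v.base
    have ha : Admissible Φ₃₂ Φ₂₁ c i j l u.base (u.coord i hi) (w.mom l hl) :=
      ⟨hc, u.isPoint i hi, hv ▸ hj, hw ▸ hl, fun k => ⟨w.mom_par l hl k, h2.2.1 l hl k⟩⟩
    have s : Solves Φ₃₂ Φ₂₁ c i j l u.base (u.coord i hi) (w.mom l hl) (v.coord j hj)
        (v.mom j hj) :=
      ⟨hv ▸ v.isPoint j hj, fun k => ⟨v.mom_par j hj k, h1.2.1 j hj k⟩, (h2.2.2 j hj l hl).2,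
        (h1.2.2 i hi j hj).1⟩
    obtain ⟨e1, e2⟩ := hΦ.envelope hf ha s
    refine ⟨fun k => ?_, fun k => ?_⟩
    · exact congrFun ((h2.coord_eq hj hl).trans e1.symm) k
    · rw [e2]
      exact (h1.2.2 i hi j hj).2 k

theorem isComposite_iff (hf : Φ₃₂.IsFormal) :
    IsComposite Φ₃₂ Φ₂₁ Φ₃₁ ↔ HasCompositeGen Φ₃₂ Φ₂₁ Φ₃₁ :=
  ⟨fun h => h.2, fun h => ⟨isRelComposite_of_gen hf h, h⟩⟩

/-! ### Formality and the first-order part -/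

theorem ThickMorphism.isFormal_of_evalAt {Φ : ThickMorphism P M₁ M₂}
    (h : ∀ (B : SuperWeil) (i : M₁.ι) (j : M₂.ι) (b : M₁.carrier) (x : Ix n₁ m₁ → B),
      M₁.IsPoint B i b x → Φ.base b ∈ (M₂.chart j).source →
      evalAt (Φ.gen i j) (0 : P → B) x (0 : Ix n₂ m₂ → B) = 0) : Φ.IsFormal := by
  refine (isFormal_iff_formalOn Φ).2 fun i j => formalOn_of_evalAt (Φ.isOpen_dom i j)
    (Φ.smooth i j).smoothCoef fun B x hp => ?_
  obtain ⟨b, hb, hx⟩ := hp.exists_isPoint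
  exact h B i j b x hx hb

theorem ThickMorphism.IsFormal.evalAt_zero {Φ : ThickMorphism P M₁ M₂} (hf : Φ.IsFormal)
    (hx : M₁.IsPoint B i b x) (hj : Φ.base b ∈ (M₂.chart j).source) :
    evalAt (Φ.gen i j) (0 : P → B) x (0 : Ix n₂ m₂ → B) = 0 :=
  ((isFormal_iff_formalOn Φ).1 hf i j).evalAt_zero (Φ.isOpen_dom i j)
    (Φ.isPt hx hj (SuperWeil.isFormal_zero (σ := P))
      (SuperWeil.isFormal_zero (σ := Ix n₂ m₂))).body

/-- At zero parameters and zero r, formality of `Φ₃₂` gives q = 0 and a zero value of S₃₂. What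
remains is S₂₁(x, 0) at zero parameters. -/
theorem HasCompositeGen.isFormal (hf : Φ₃₂.IsFormal) (hf' : Φ₂₁.IsFormal)
    (hΦ : HasCompositeGen Φ₃₂ Φ₂₁ Φ₃₁) : Φ₃₁.IsFormal := by
  refine ThickMorphism.isFormal_of_evalAt fun B i l b x hx hl => ?_
  rw [hΦ.1] at hl
  obtain ⟨j, hj⟩ := M₂.cover (Φ₂₁.base b)
  have ha : Admissible Φ₃₂ Φ₂₁ (0 : P → B) i j l b x 0 :=
    ⟨SuperWeil.isFormal_zero, hx, hj, hl, SuperWeil.isFormal_zero⟩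
  obtain ⟨⟨y, q⟩, s, -⟩ := existsUnique_solves hf ha
  dsimp only at s
  have hq : q = 0 := by
    rw [s.q_eq]
    funext k
    exact (((isFormal_iff_formalOn Φ₃₂).1 hf j l).dCoord (Φ₃₂.isOpen_dom j l) k).evalAt_zero
      (Φ₃₂.isOpen_dom j l) (Φ₃₂.isPt s.1 hl (SuperWeil.isFormal_zero (σ := P))
        (SuperWeil.isFormal_zero (σ := Ix n₃ m₃))).body
  rw [hΦ.2 B 0 i j l b x 0 y q ha s, hq, hf.evalAt_zero s.1 hl, hf'.evalAt_zero hx hj]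
  simp

/-- The right ideal generated by a family. -/
def idealOf {κ : Type} (v : κ → B) : Submodule ℝ B :=
  Submodule.span ℝ {b | ∃ s a, v s * a = b}

theorem mem_idealOf {κ : Type} (v : κ → B) (s : κ) : v s ∈ idealOf v :=
  Submodule.subset_span ⟨s, 1, mul_one _⟩

/-- Homogeneous generators can be moved past any element at the cost of a twist. -/
theorem idealOf_twoSided {κ : Type} {v : κ → B} (hv : ∀ s, ∃ p, v s ∈ B.gr p) :
    TwoSided (idealOf v) := by
  intro a b hb
  induction hb using Submodule.span_induction with
  | mem b hb =>
    obtain ⟨s, d, rfl⟩ := hb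
    obtain ⟨p, hp⟩ := hv s
    refine ⟨Submodule.subset_span ⟨s, B.twist p a * d, ?_⟩, Submodule.subset_span ⟨s, d * a, ?_⟩⟩
    · rw [← mul_assoc, ← B.mul_eq_mul_twist hp, mul_assoc]
    · rw [mul_assoc]
  | zero => simp
  | add x y _ _ hx hy =>
    rw [mul_add, add_mul]
    exact ⟨Submodule.add_mem _ hx.1 hy.1, Submodule.add_mem _ hx.2 hy.2⟩
  | smul r x _ hx =>
    rw [mul_smul_comm, smul_mul_assoc]
    exact ⟨Submodule.smul_mem _ _ hx.1, Submodule.smul_mem _ _ hx.2⟩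

theorem idealOf_sq {κ : Type} {v : κ → B} (hv : ∀ s, ∃ p, v s ∈ B.gr p)
    (h : ∀ s t, v s * v t = 0) : ∀ a ∈ idealOf v, ∀ b ∈ idealOf v, a * b = 0 := by
  intro a ha b hb
  induction ha using Submodule.span_induction with
  | zero => rw [zero_mul]
  | add x y _ _ hx hy => rw [add_mul, hx, hy, add_zero]
  | smul r x _ hx => rw [smul_mul_assoc, hx, smul_zero]
  | mem a ha =>
    obtain ⟨s, d, rfl⟩ := ha
    induction hb using Submodule.span_induction with
    | zero => rw [mul_zero]
    | add x y _ _ hx hy => rw [mul_add, hx, hy, add_zero]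
    | smul r x _ hx => rw [mul_smul_comm, hx, smul_zero]
    | mem b hb =>
      obtain ⟨t, e, rfl⟩ := hb
      obtain ⟨p, hp⟩ := hv t
      rw [mul_assoc, ← mul_assoc d, B.mul_eq_mul_twist hp, mul_assoc, ← mul_assoc, h, zero_mul]

/-- Under the hypotheses, the values of the parameters and of r generate an ideal of square zero. By
formality it contains q, and hence also the difference between the solution y and its value at q =
0. First-order expansions of both generating functions are therefore exact. -/
theorem HasCompositeGen.firstOrderPart (hf : Φ₃₂.IsFormal) (hΦ : HasCompositeGen Φ₃₂ Φ₂₁ Φ₃₁) :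
    HasFirstOrderPart Φ₃₂ Φ₂₁ Φ₃₁ := by
  intro B c i j l b x r y z ha hcc hcr hrr hy hz
  have hy : y = yOf (Φ₂₁.gen i j) c x 0 := funext hy
  have hz : z = yOf (Φ₃₂.gen j l) c y 0 := funext hz
  obtain ⟨⟨Y, R⟩, s, -⟩ := existsUnique_solves hf ha
  dsimp only at s
  rw [hΦ.2 B c i j l b x r Y R ha s]
  let v : P ⊕ Ix n₃ m₃ → B := Sum.elim c r
  have hv : ∀ s, ∃ p, v s ∈ B.gr p := by
    rintro (s | k)
    · exact ⟨_, (ha.1 s).1⟩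
    · exact ⟨_, (ha.2.2.2.2 k).1⟩
  have hv2 : ∀ s t, v s * v t = 0 := by
    rintro (s | k) (t | k')
    · exact hcc s t
    · exact hcr s k'
    · change r k * c t = 0
      rw [B.supercomm _ _ _ _ (ha.2.2.2.2 k).1 (ha.1 t).1, hcr, mul_zero]
    · exact hrr k k'
  have hI := idealOf_twoSided hv
  have h2 := idealOf_sq hv hv2
  have hI0 : idealOf v ≤ B.nil := fun b hb => by
    have := congrArg B.aug (h2 _ hb _ hb)
    rw [map_mul, map_zero] at this
    exact mul_self_eq_zero.1 this
  have hc : ∀ s, c s ∈ idealOf v := fun s => mem_idealOf v (Sum.inl s)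
  have hr : ∀ k, r k ∈ idealOf v := fun k => mem_idealOf v (Sum.inr k)
  have h0 : B.IsFormal (0 : Ix n₂ m₂ → B) := SuperWeil.isFormal_zero
  have h0' : B.IsFormal (0 : Ix n₃ m₃ → B) := SuperWeil.isFormal_zero
  have hyp : M₂.IsPoint B j (Φ₂₁.base b) y := hy ▸ Φ₂₁.isPoint_yOf ha.2.1 ha.2.2.1 ha.1 h0
  have hYt := Φ₃₂.isPt s.1 ha.2.2.2.1 ha.1 ha.2.2.2.2
  have hyt := Φ₃₂.isPt hyp ha.2.2.2.1 ha.1 h0'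
  have hxt := Φ₂₁.isPt ha.2.1 ha.2.2.1 ha.1 h0
  have hform := fun k => ((isFormal_iff_formalOn Φ₃₂).1 hf j l).dCoord (Φ₃₂.isOpen_dom j l) k
  have hR : ∀ k, R k ∈ idealOf v := fun k => by
    rw [s.2.2.1]
    exact evalAt_mem_of_formal (Φ₃₂.isOpen_dom j l) hI (hform k) hYt.body hc hr
  have hYy : ∀ k, Y k - y k ∈ idealOf v := fun k => by
    rw [s.y_eq, hy]
    unfold yOf
    rw [← mul_sub]
    exact sgn_mul_mem_of_mem k (evalAt_sub_mem hI hI0 _ (by simp) (by simpa using hR))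
  have e1 := evalAt_expand (Φ₂₁.isOpen_dom i j) (Φ₂₁.smooth i j).smoothCoef hI h2 hxt (δx := 0)
    (δq := R) (fun _ => Submodule.zero_mem _) (fun _ => Submodule.zero_mem _)
    (fun k => (s.2.1 k).1) hR
  have e2 := evalAt_expand (Φ₃₂.isOpen_dom j l) (Φ₃₂.smooth j l).smoothCoef hI h2 hyt
    (δx := fun k => Y k - y k) (δq := r) (fun k => Submodule.sub_mem _ (s.1.2.1 k) (hyp.2.1 k)) hYy
    (fun k => (ha.2.2.2.2 k).1) hr
  simp only [Pi.zero_apply, add_zero, zero_add, zero_mul, Finset.sum_const_zero,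
    add_sub_cancel] at e1 e2
  -- The derivative ∂S₃₂/∂y is in the ideal by formality, so shifting y has no effect on S₃₂.
  have e3 : ∑ k, (Y k - y k) * evalAt (dCoord k (Φ₃₂.gen j l)) c y 0 = 0 :=
    Finset.sum_eq_zero fun k _ => h2 _ (hYy k) _
      (evalAt_mem_of_formal (Φ₃₂.isOpen_dom j l) hI (hform k) hyt.body hc
        fun _ => Submodule.zero_mem _)
  -- The linear term of S₂₁ is the sum of the `Y k * R k`, which cancels the subtracted term of S₃₁.
  have e4 : ∑ k, R k * evalAt (dMom k (Φ₂₁.gen i j)) c x 0 = ∑ k, Y k * R k := by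
    refine Finset.sum_congr rfl fun k _ => ?_
    have e : evalAt (dMom k (Φ₂₁.gen i j)) c x 0 = sgn B k * y k := by
      rw [hy]
      exact (sgn_mul_sgn_mul k _).symm
    rw [e, mul_sgn_mul k (s.2.1 k).1 (hyp.2.1 k)]
    have := h2 _ (hYy k) _ (hR k)
    rw [sub_mul, sub_eq_zero] at this
    exact this.symm
  have e5 : ∑ k, r k * evalAt (dMom k (Φ₃₂.gen j l)) c y 0 = ∑ k, z k * r k := by
    refine Finset.sum_congr rfl fun k _ => ?_
    have e : evalAt (dMom k (Φ₃₂.gen j l)) c y 0 = sgn B k * z k := by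
      rw [hz]
      exact (sgn_mul_sgn_mul k _).symm
    rw [e, mul_sgn_mul k (ha.2.2.2.2 k).1]
    rw [hz]
    exact (Φ₃₂.isPoint_yOf hyp ha.2.2.2.1 ha.1 h0').2.1 k
  rw [e1, e2, e3, e4, e5]
  abel

end Composite

/-! ## Associativity -/

section Associativity

variable {n₁ m₁ n₂ m₂ n₃ m₃ n₄ m₄ : ℕ} {P : Type} [Fintype P] [LinearOrder P] [Parity P]
  {M₁ : SuperManifold.{u} n₁ m₁} {M₂ : SuperManifold.{u} n₂ m₂} {M₃ : SuperManifold.{u} n₃ m₃}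
  {M₄ : SuperManifold.{u} n₄ m₄} {Φ₂₁ : ThickMorphism P M₁ M₂} {Φ₃₂ : ThickMorphism P M₂ M₃}
  {Φ₄₃ : ThickMorphism P M₃ M₄} {Φ₃₁ : ThickMorphism P M₁ M₃} {Φ₄₂ : ThickMorphism P M₂ M₄}
  {Φ₄₁ : ThickMorphism P M₁ M₄}

/-- Both bracketings lead to one joint system in (y, q, z, r) and to the value S₄₃ + S₃₂ + S₂₁ - zr
- yq. The envelope identities for `Φ₃₁` and `Φ₄₂` translate a solution for one bracketing into a
solution for the other. -/
theorem hasCompositeGen_assoc (h32 : Φ₃₂.IsFormal) (h43 : Φ₄₃.IsFormal)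
    (h31 : HasCompositeGen Φ₃₂ Φ₂₁ Φ₃₁) (h42 : HasCompositeGen Φ₄₃ Φ₃₂ Φ₄₂) :
    HasCompositeGen Φ₄₃ Φ₃₁ Φ₄₁ ↔ HasCompositeGen Φ₄₂ Φ₂₁ Φ₄₁ := by
  have h42f := h42.isFormal h43 h32
  have b31 : ∀ b, Φ₃₁.base b = Φ₃₂.base (Φ₂₁.base b) := fun b => congrFun h31.1 b
  have b42 : ∀ b, Φ₄₂.base b = Φ₄₃.base (Φ₃₂.base b) := fun b => congrFun h42.1 b
  have hbase : Φ₄₃.base ∘ Φ₃₁.base = Φ₄₂.base ∘ Φ₂₁.base := by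
    funext b
    simp only [Function.comp_apply, b31, b42]
  constructor
  · intro h
    refine ⟨h.1.trans hbase, fun B c i j t b x s y q ha hs => ?_⟩
    obtain ⟨hc, hx, hj, ht, hsf⟩ := id ha
    rw [b42] at ht
    obtain ⟨k, hk⟩ := M₃.cover (Φ₃₂.base (Φ₂₁.base b))
    have ha1 : Admissible Φ₄₃ Φ₃₂ c j k t (Φ₂₁.base b) y s := ⟨hc, hs.1, hk, ht, hsf⟩
    obtain ⟨⟨z, r⟩, s1, -⟩ := existsUnique_solves h43 ha1
    dsimp only at s1
    have ha2 : Admissible Φ₃₂ Φ₂₁ c i j k b x r := ⟨hc, hx, hj, hk, s1.2.1⟩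
    -- The momentum q is given as ∂S₄₂/∂y. By the envelope for `Φ₄₂` it equals ∂S₃₂/∂y at the
    -- auxiliary r. Likewise, the envelope for `Φ₃₁` lets z be computed from S₃₁ below.
    have s2 : Solves Φ₃₂ Φ₂₁ c i j k b x r y q :=
      ⟨hs.1, hs.2.1, fun a => (hs.2.2.1 a).trans ((h42.envelope h43 ha1 s1).2 a), hs.2.2.2⟩
    have ha3 : Admissible Φ₄₃ Φ₃₁ c i k t b x s :=
      ⟨hc, hx, by rwa [b31], by rwa [b31], hsf⟩
    have s3 : Solves Φ₄₃ Φ₃₁ c i k t b x s z r :=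
      ⟨by rw [b31]; exact s1.1, s1.2.1, s1.2.2.1,
        fun a => congrFun (s1.y_eq.trans (h31.envelope h32 ha2 s2).1.symm) a⟩
    rw [h.2 B c i k t b x s z r ha3 s3, h42.2 B c j k t _ y s z r ha1 s1,
      h31.2 B c i j k b x r y q ha2 s2]
    abel
  · intro h
    refine ⟨h.1.trans hbase.symm, fun B c i k t b x s z r ha hs => ?_⟩
    obtain ⟨hc, hx, hk, ht, hsf⟩ := id ha
    rw [b31] at hk ht
    obtain ⟨j, hj⟩ := M₂.cover (Φ₂₁.base b)
    have ha2 : Admissible Φ₃₂ Φ₂₁ c i j k b x r := ⟨hc, hx, hj, hk, hs.2.1⟩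
    obtain ⟨⟨y, q⟩, s2, -⟩ := existsUnique_solves h32 ha2
    dsimp only at s2
    have ha1 : Admissible Φ₄₃ Φ₃₂ c j k t (Φ₂₁.base b) y s := ⟨hc, s2.1, hk, ht, hsf⟩
    have s1 : Solves Φ₄₃ Φ₃₂ c j k t (Φ₂₁.base b) y s z r :=
      ⟨by rw [← b31]; exact hs.1, hs.2.1, hs.2.2.1,
        fun a => congrFun (hs.y_eq.trans (h31.envelope h32 ha2 s2).1) a⟩
    have ha3 : Admissible Φ₄₂ Φ₂₁ c i j t b x s := ⟨hc, hx, hj, by rwa [b42], hsf⟩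
    have s3 : Solves Φ₄₂ Φ₂₁ c i j t b x s y q :=
      ⟨s2.1, s2.2.1, fun a => (s2.2.2.1 a).trans ((h42.envelope h43 ha1 s1).2 a).symm, s2.2.2.2⟩
    rw [h.2 B c i j t b x s y q ha3 s3, h42.2 B c j k t _ y s z r ha1 s1,
      h31.2 B c i j k b x r y q ha2 s2]
    abel

end Associativity

/-! ## Identities -/

section Identity

variable {n m n₁ m₁ n₂ m₂ : ℕ} {P : Type} [Fintype P] [LinearOrder P] [Parity P]
  {M : SuperManifold.{u} n m} {M₁ : SuperManifold.{u} n₁ m₁} {M₂ : SuperManifold.{u} n₂ m₂}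
  {B : SuperWeil} {c : P → B} {i j : M.ι} {b : M.carrier} {x q : Ix n m → B}

theorem SuperManifold.yOf_changeGen (hx : M.IsPoint B i b x) (hj : b ∈ (M.chart j).source)
    (hc : B.IsFormal c) (hq : B.IsFormal q) :
    yOf (M.changeGen P i j) c x q = M.tr i j x := by
  funext k
  unfold yOf
  rw [M.evalAt_dMom_changeGen i j (hx.isPt (M.mem_dom hx.1 hj) hc hq), sgn_mul_sgn_mul]

theorem SuperManifold.dom_eq (M : SuperManifold.{u} n m) (i j : M.ι) :
    M.dom i j = {x | x ∈ (M.chart i).target ∧ id ((M.chart i).symm x) ∈ (M.chart j).source} := by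
  unfold SuperManifold.dom
  rw [OpenPartialHomeomorph.trans_source]
  rfl

/-- The identity thick morphism. -/
def identityMorphism (P : Type) [Fintype P] [LinearOrder P] [Parity P] (M : SuperManifold.{u} n m) :
    ThickMorphism P M M where
  base := id
  base_continuous := continuous_id
  gen i j := M.changeGen P i j
  gen_smooth i j := M.dom_eq i j ▸ M.changeGen_smooth i j
  gen_even i j := M.changeGen_even i j
  gen_base := by
    intro i j b hi hj a
    obtain ⟨x, hx⟩ := exists_realPoint M hi
    have h0 : realWeil.IsFormal (0 : P → realWeil) := SuperWeil.isFormal_zero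
    have h0' : realWeil.IsFormal (0 : Ix n m → realWeil) := SuperWeil.isFormal_zero
    refine base_of_isPoint_yOf (hx.isPt (M.mem_dom hi hj) h0 h0') hx (j := j) (b' := b) ?_ a
    rw [M.yOf_changeGen hx hj h0 h0']
    exact hx.tr hj
  gen_law := by
    intro i i' j j' b B c x' y q q' hi hx' hyp hj' hc hq hq' hqq hy
    have hi' := hx'.1
    have hj : b ∈ (M.chart j).source := hyp.1
    have hj'' : b ∈ (M.chart j').source := hj'
    have hx := hx'.tr hi
    have hy : y = M.tr i' j x' := by
      rw [← hx'.tr_tr hi hj, ← M.yOf_changeGen hx hj hc hq]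
      exact funext hy
    rw [M.evalAt_changeGen i' j' (hx'.isPt (M.mem_dom hi' hj'') hc hq'),
      M.evalAt_changeGen i j (hx.isPt (M.mem_dom hi hj) hc hq), hx'.tr_tr hi hj, hy,
      hx'.tr_tr hj hj'']
    abel

theorem identityMorphism_isIdentity : IsIdentity (identityMorphism P M) := by
  refine ⟨rfl, fun B c i b x q hc hx hq => ?_⟩
  change evalAt (M.changeGen P i i) c x q = _
  rw [M.evalAt_changeGen i i (hx.isPt (M.mem_dom hx.1 hx.1) hc hq), hx.tr_self]

theorem IsIdentity.yOf_eq {I : ThickMorphism P M M} (hI : IsIdentity I) (hx : M.IsPoint B i b x)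
    (hc : B.IsFormal c) (hq : B.IsFormal q) : yOf (I.gen i i) c x q = x := by
  have hb : I.base b ∈ (M.chart i).source := by
    rw [hI.1]
    exact hx.1
  funext k
  have : evalAt (dMom k (I.gen i i)) c x q = sgn B k * x k := by
    refine evalAt_dMom_eq (I.isOpen_dom i i) (I.smooth i i).smoothCoef (I.isPt hx hb hc hq) k ?_
    rw [hI.2 _ _ i b _ _ (IsFormal.map hc _) (hx.map _) (IsFormal.map_add hq k),
      hI.2 B c i b x q hc hx hq]
    simp only [mul_add, Finset.sum_add_distrib, map_sum, map_mul]
    congr 1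
    simp only [epsSingle, mul_ite, mul_zero, Finset.sum_ite_eq', Finset.mem_univ, if_true]
    rw [sgn_mul_comm k (SuperWeil.epsInl_mem (hx.2.1 k)) SuperWeil.epsGen_mem, ← mul_assoc,
      ← mul_assoc, epsInl_sgn, sgn_comm]
  unfold yOf
  rw [this, sgn_mul_sgn_mul]

/-- The definition prescribes the generating function only for equal source and target charts. The
target transformation law determines it for all other pairs, which gives uniqueness. -/
theorem IsIdentity.evalAt_gen {I : ThickMorphism P M M} (hI : IsIdentity I)
    (hx : M.IsPoint B i b x) (hj : b ∈ (M.chart j).source) (hc : B.IsFormal c)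
    (hq : B.IsFormal q) : evalAt (I.gen i j) c x q = ∑ k, M.tr i j x k * q k := by
  have hb : ∀ l, b ∈ (M.chart l).source → I.base b ∈ (M.chart l).source := fun l hl => by
    rw [hI.1]
    exact hl
  have hqf := hx.mtr_isFormal hj hq
  rw [I.evalAt_gen_mtr hx (hb i hx.1) (hb j hj) hc hq (y := x) (q := M.mtr i j x q) rfl hqf
    (hI.yOf_eq hx hc hqf).symm, hI.2 B c i b x _ hc hx hqf]
  abel

theorem IsIdentity.unique {I I' : ThickMorphism P M M} (hI : IsIdentity I)
    (hI' : IsIdentity I') : I = I' := by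
  refine ThickMorphism.ext_values (hI.1.trans hI'.1.symm) fun B c i j b x q hc hx hj hq => ?_
  rw [hI.1] at hj
  rw [hI.evalAt_gen hx hj hc hq, hI'.evalAt_gen hx hj hc hq]

theorem IsIdentity.isFormal {I : ThickMorphism P M M} (hI : IsIdentity I) : I.IsFormal := by
  refine ThickMorphism.isFormal_of_evalAt fun B i j b x hx hj => ?_
  rw [hI.1] at hj
  rw [hI.evalAt_gen hx hj SuperWeil.isFormal_zero SuperWeil.isFormal_zero]
  simp

theorem IsIdentity.eq {I : ThickMorphism P M M} (hI : IsIdentity I) :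
    I = identityMorphism P M := hI.unique identityMorphism_isIdentity

/-- Composition with the identity after Φ is the target half of the transformation law of Φ, with
the middle chart as the old one. The source half serves in the same way for the identity before Φ.
-/
theorem isComposite_identity_left {I₂ : ThickMorphism P M₂ M₂} (hI : IsIdentity I₂)
    (Φ : ThickMorphism P M₁ M₂) : IsComposite I₂ Φ Φ := by
  refine (isComposite_iff hI.isFormal).2 ⟨by rw [hI.1]; rfl, fun B c i j l b x r y q ha s => ?_⟩
  obtain ⟨hc, hx, hj, hl, hr⟩ := ha
  rw [hI.1] at hl
  have hq : q = M₂.mtr j l y r := by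
    rw [s.q_eq, hI.eq]
    exact funext fun k => M₂.evalAt_dCoord_changeGen j l (s.1.isPt (M₂.mem_dom hj hl) hc hr) k
  rw [Φ.evalAt_gen_mtr hx hj hl hc hr hq s.2.1 s.y_eq, hI.evalAt_gen s.1 hl hc hr]
  abel

theorem isComposite_identity_right {I₁ : ThickMorphism P M₁ M₁} (hI : IsIdentity I₁)
    {Φ : ThickMorphism P M₁ M₂} (hf : Φ.IsFormal) : IsComposite Φ I₁ Φ := by
  refine (isComposite_iff hf).2 ⟨by rw [hI.1]; rfl, fun B c i j l b x r y q ha s => ?_⟩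
  obtain ⟨hc, hx, hj, hl, hr⟩ := ha
  rw [hI.1] at hj hl
  have hy : y = M₁.tr i j x := by
    rw [s.y_eq, hI.eq]
    exact M₁.yOf_changeGen hx hj hc s.2.1
  rw [Φ.evalAt_gen_tr hx hj hl hc hr, hI.evalAt_gen hx hj hc s.2.1, hy]
  abel

end Identity

/-! ## Dependence on parameters -/

section Parameters

variable {n₁ m₁ n₂ m₂ : ℕ} {P : Type} [Fintype P] [LinearOrder P] [Parity P]
  {M₁ : SuperManifold.{u} n₁ m₁} {M₂ : SuperManifold.{u} n₂ m₂}

theorem exists_constGen (Φ : ThickMorphism (Ix 0 0) M₁ M₂) (i : M₁.ι) (j : M₂.ι) :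
    ∃ F : Coef n₁ P m₁ (Ix n₂ m₂), IsSmoothOn (Φ.dom i j) F ∧ IsHomog 0 F ∧
      ∀ (B : SuperWeil) (c : P → B) (x : Ix n₁ m₁ → B) (q : Ix n₂ m₂ → B),
        IsPt (Φ.dom i j) c x q → evalAt F c x q = evalAt (Φ.gen i j) 0 x q := by
  have hU := Φ.isOpen_dom i j
  have h0 : ∀ (B : SuperWeil) (c : P → B) (x : Ix n₁ m₁ → B) (q : Ix n₂ m₂ → B),
      IsPt (Φ.dom i j) c x q → IsPt (Φ.dom i j) (0 : Ix 0 0 → B) x q :=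
    fun B c x q h => ⟨SuperWeil.isFormal_zero, h.par, h.body, h.mom⟩
  refine exists_superfunction hU (fun N => ?_) fun B c x q h =>
    evalAt_mem hU (Φ.gen_even i j) (h0 B c x q h)
  exact IsRepN.comp hU hU (Φ.smooth i j).smoothCoef (C := fun s B _ _ _ => (0 : Ix 0 0 → B) s)
    (X := fun k _ _ x _ => x k) (R := fun k _ _ _ q => q k) (fun s => isRepN_const_zero N s)
    (isRepN_coord N) (isRepN_mom N) h0

/-- Two superfunctions whose values differ by a function independent of the momenta have equal
derivatives in the momenta. -/
theorem yOf_congr {P' : Type} [Fintype P'] [LinearOrder P'] [Parity P'] {U : Set (Fin n₁ → ℝ)}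
    (hU : IsOpen U) {F : Coef n₁ P m₁ (Ix n₂ m₂)} {G : Coef n₁ P' m₁ (Ix n₂ m₂)}
    (hF : SmoothCoef U F) (hG : SmoothCoef U G) {B : SuperWeil} {c : P → B} {c' : P' → B}
    {x : Ix n₁ m₁ → B} {q : Ix n₂ m₂ → B} (h : IsPt U c x q) (h' : IsPt U c' x q)
    (hval : ∀ p : ZMod 2, ∃ a : B.eps p, ∀ q' : Ix n₂ m₂ → B.eps p, (B.eps p).IsFormal q' →
      evalAt F (fun s => B.epsInl p (c s)) (fun k => B.epsInl p (x k)) q' =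
        evalAt G (fun s => B.epsInl p (c' s)) (fun k => B.epsInl p (x k)) q' + a) :
    yOf F c x q = yOf G c' x q := by
  funext k
  unfold yOf
  congr 1
  refine evalAt_dMom_eq hU hF h k ?_
  obtain ⟨a, ha⟩ := hval (Parity.par k)
  rw [ha _ (IsFormal.map_add h.mom k), evalAt_eps_mom hU hG h' k, ← evalAt_map F h (Parity.par k),
    ha _ (IsFormal.map h.mom _), evalAt_map G h']
  abel

/-- A parameter-free thick morphism as one with parameters. -/
def constantExtension (P : Type) [Fintype P] [LinearOrder P] [Parity P]
    (Φ : ThickMorphism (Ix 0 0) M₁ M₂) : ThickMorphism P M₁ M₂ where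
  base := Φ.base
  base_continuous := Φ.base_continuous
  gen i j := (exists_constGen Φ i j).choose
  gen_smooth i j := (exists_constGen Φ i j).choose_spec.1
  gen_even i j := (exists_constGen Φ i j).choose_spec.2.1
  gen_base := by
    intro i j b hi hj a
    obtain ⟨h1, h2, h3⟩ := (exists_constGen (P := P) Φ i j).choose_spec
    obtain ⟨x, hx⟩ := exists_realPoint M₁ hi
    have h0 : realWeil.IsFormal (0 : P → realWeil) := SuperWeil.isFormal_zero
    have h0' : realWeil.IsFormal (0 : Ix n₂ m₂ → realWeil) := SuperWeil.isFormal_zero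
    have h0'' : realWeil.IsFormal (0 : Ix 0 0 → realWeil) := SuperWeil.isFormal_zero
    refine base_of_isPoint_yOf (Φ.isPt hx hj h0 h0') hx (j := j) (b' := Φ.base b) ?_ a
    rw [yOf_congr (Φ.isOpen_dom i j) h1.smoothCoef (Φ.smooth i j).smoothCoef (Φ.isPt hx hj h0 h0')
      (Φ.isPt hx hj h0'' h0') fun p => ⟨0, fun q' hq' => by
        rw [h3 _ _ _ _ (Φ.isPt (hx.map p) hj (IsFormal.map h0 p) hq'), zero_map, add_zero]⟩]
    exact Φ.isPoint_yOf hx hj h0'' h0'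
  gen_law := by
    intro i i' j j' b B c x' y q q' hi hx' hyp hj' hc hq hq' hqq hy
    obtain ⟨h1, h2, h3⟩ := (exists_constGen (P := P) Φ i j).choose_spec
    obtain ⟨h1', h2', h3'⟩ := (exists_constGen (P := P) Φ i' j').choose_spec
    have h0 : B.IsFormal (0 : Ix 0 0 → B) := SuperWeil.isFormal_zero
    have hx := hx'.tr hi
    have hd := yOf_congr (Φ.isOpen_dom i j) h1.smoothCoef (Φ.smooth i j).smoothCoef
      (Φ.isPt hx hyp.1 hc hq) (Φ.isPt hx hyp.1 h0 hq) fun p => ⟨0, fun q' hq' => by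
        rw [h3 _ _ _ _ (Φ.isPt (hx.map p) hyp.1 (IsFormal.map hc p) hq'), zero_map, add_zero]⟩
    rw [h3' _ _ _ _ (Φ.isPt hx' hj' hc hq'), h3 _ _ _ _ (Φ.isPt hx hyp.1 hc hq)]
    exact Φ.gen_law i i' j j' b B 0 x' y q q' hi hx' hyp hj' h0 hq hq' hqq
      fun k => (hy k).trans (congrFun hd k)

theorem constantExtension_spec (Φ : ThickMorphism (Ix 0 0) M₁ M₂) :
    IsConstantExtension Φ (constantExtension P Φ) :=
  ⟨rfl, fun B c i j _b x q hc hx hj hq =>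
    (exists_constGen (P := P) Φ i j).choose_spec.2.2 B c x q (Φ.isPt hx hj hc hq)⟩

theorem existsUnique_constantExtension (Φ : ThickMorphism (Ix 0 0) M₁ M₂) :
    ∃! Φ' : ThickMorphism P M₁ M₂, IsConstantExtension Φ Φ' := by
  refine ⟨_, constantExtension_spec Φ, fun Φ' h => ?_⟩
  have h' := constantExtension_spec (P := P) Φ
  refine ThickMorphism.ext_values (h.1.trans h'.1.symm) fun B c i j b x q hc hx hj hq => ?_
  rw [h.1] at hj
  rw [h.2 B c i j b x q hc hx hj hq, h'.2 B c i j b x q hc hx hj hq]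

theorem exists_scaledGen {ε : P} (hε : Parity.par ε = (0 : ZMod 2)) (Φ : ThickMorphism P M₁ M₂)
    (i : M₁.ι) (j : M₂.ι) :
    ∃ F : Coef n₁ P m₁ (Ix n₂ m₂), IsSmoothOn (Φ.dom i j) F ∧ IsHomog 0 F ∧
      ∀ (B : SuperWeil) (c : P → B) (x : Ix n₁ m₁ → B) (q : Ix n₂ m₂ → B),
        IsPt (Φ.dom i j) c x q → evalAt F c x q =
          evalAt (Φ.gen i j) c x q - evalAt (Φ.gen i j) c x 0 +
            c ε * evalAt (Φ.gen i j) c x 0 := by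
  have hU := Φ.isOpen_dom i j
  have h0 : ∀ (B : SuperWeil) (c : P → B) (x : Ix n₁ m₁ → B) (q : Ix n₂ m₂ → B),
      IsPt (Φ.dom i j) c x q → IsPt (Φ.dom i j) c x (0 : Ix n₂ m₂ → B) :=
    fun B c x q h => ⟨h.param, h.par, h.body, SuperWeil.isFormal_zero⟩
  refine exists_superfunction hU (fun N => ?_) fun B c x q h => ?_
  · have hz : IsRepN (Φ.dom i j) N fun B (c : P → B) x (_ : Ix n₂ m₂ → B) =>
        evalAt (Φ.gen i j) c x 0 :=
      IsRepN.comp hU hU (Φ.smooth i j).smoothCoef (C := fun s _ c _ _ => c s)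
        (X := fun k _ _ x _ => x k) (R := fun k B _ _ _ => (0 : Ix n₂ m₂ → B) k) (isRepN_param N)
        (isRepN_coord N) (fun s => isRepN_const_zero N s) h0
    exact (((Φ.smooth i j).smoothCoef.isRepN N).sub hU hz).add ((isRepN_param N ε).mul hU hz)
  · have h1 := evalAt_mem hU (Φ.gen_even i j) h
    have h2 := evalAt_mem hU (Φ.gen_even i j) (h0 B c x q h)
    have h3 : c ε ∈ B.gr 0 := hε ▸ (h.param ε).1
    exact Submodule.add_mem _ (Submodule.sub_mem _ h1 h2) (B.mul_mem_even h3 h2)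

/-- The term of order zero in the momenta is a function. -/
theorem ThickMorphism.evalAt_gen_zero (Φ : ThickMorphism P M₁ M₂) {B : SuperWeil} {i i' : M₁.ι}
    {j j' : M₂.ι} {b : M₁.carrier} {c : P → B} {x : Ix n₁ m₁ → B} (hx : M₁.IsPoint B i' b x)
    (hi : b ∈ (M₁.chart i).source) (hj : Φ.base b ∈ (M₂.chart j).source)
    (hj' : Φ.base b ∈ (M₂.chart j').source) (hc : B.IsFormal c) :
    evalAt (Φ.gen i' j') c x 0 = evalAt (Φ.gen i j) c (M₁.tr i' i x) 0 := by
  have h0 : B.IsFormal (0 : Ix n₂ m₂ → B) := SuperWeil.isFormal_zero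
  -- Zero momenta correspond to zero momenta in every chart, so the correction terms of the law
  -- vanish and S₀ transforms as a function.
  rw [Φ.evalAt_gen_tr hx hi hj' hc h0, Φ.evalAt_gen_mtr (q := 0) (hx.tr hi) hj hj' hc h0
    (by funext k; simp [SuperManifold.mtr]) h0 rfl]
  simp

/-- Scaling alters only a term independent of q, so y is the same for the old and the new generating
function. The law for the scaled morphism is then the sum of the old law and the invariance of S₀.
-/
theorem scaled_yOf (Φ : ThickMorphism P M₁ M₂) {ε : P} {i : M₁.ι} {j : M₂.ι}
    {F : Coef n₁ P m₁ (Ix n₂ m₂)} (hF : IsSmoothOn (Φ.dom i j) F)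
    (hval : ∀ (B : SuperWeil) (c : P → B) (x : Ix n₁ m₁ → B) (q : Ix n₂ m₂ → B),
        IsPt (Φ.dom i j) c x q → evalAt F c x q =
          evalAt (Φ.gen i j) c x q - evalAt (Φ.gen i j) c x 0 + c ε * evalAt (Φ.gen i j) c x 0)
    {B : SuperWeil} {b : M₁.carrier} {c : P → B} {x : Ix n₁ m₁ → B} {q : Ix n₂ m₂ → B}
    (hx : M₁.IsPoint B i b x) (hj : Φ.base b ∈ (M₂.chart j).source) (hc : B.IsFormal c)
    (hq : B.IsFormal q) : yOf F c x q = yOf (Φ.gen i j) c x q := by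
  have hp := Φ.isPt hx hj hc hq
  refine yOf_congr (Φ.isOpen_dom i j) hF.smoothCoef (Φ.smooth i j).smoothCoef hp hp
    fun p => ⟨B.epsInl p (c ε) * evalAt (Φ.gen i j) (fun s => B.epsInl p (c s))
      (fun k => B.epsInl p (x k)) 0 - evalAt (Φ.gen i j) (fun s => B.epsInl p (c s))
      (fun k => B.epsInl p (x k)) 0, fun q' hq' => ?_⟩
  rw [hval _ _ _ _ (Φ.isPt (hx.map p) hj (IsFormal.map hc p) hq')]
  abel

/-- The thick morphism with `ε S₀` in place of `S₀`. -/
def scaling {ε : P} (hε : Parity.par ε = (0 : ZMod 2)) (Φ : ThickMorphism P M₁ M₂) :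
    ThickMorphism P M₁ M₂ where
  base := Φ.base
  base_continuous := Φ.base_continuous
  gen i j := (exists_scaledGen hε Φ i j).choose
  gen_smooth i j := (exists_scaledGen hε Φ i j).choose_spec.1
  gen_even i j := (exists_scaledGen hε Φ i j).choose_spec.2.1
  gen_base := by
    intro i j b hi hj a
    obtain ⟨h1, h2, h3⟩ := (exists_scaledGen hε Φ i j).choose_spec
    obtain ⟨x, hx⟩ := exists_realPoint M₁ hi
    have h0 : realWeil.IsFormal (0 : P → realWeil) := SuperWeil.isFormal_zero
    have h0' : realWeil.IsFormal (0 : Ix n₂ m₂ → realWeil) := SuperWeil.isFormal_zero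
    refine base_of_isPoint_yOf (Φ.isPt hx hj h0 h0') hx (j := j) (b' := Φ.base b) ?_ a
    rw [scaled_yOf Φ h1 h3 hx hj h0 h0']
    exact Φ.isPoint_yOf hx hj h0 h0'
  gen_law := by
    intro i i' j j' b B c x' y q q' hi hx' hyp hj' hc hq hq' hqq hy
    obtain ⟨h1, h2, h3⟩ := (exists_scaledGen hε Φ i j).choose_spec
    obtain ⟨h1', h2', h3'⟩ := (exists_scaledGen hε Φ i' j').choose_spec
    have hx := hx'.tr hi
    have hd := scaled_yOf Φ h1 h3 hx hyp.1 hc hq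
    rw [h3' _ _ _ _ (Φ.isPt hx' hj' hc hq'), h3 _ _ _ _ (Φ.isPt hx hyp.1 hc hq),
      Φ.evalAt_gen_zero hx' hi hyp.1 hj' hc,
      Φ.gen_law i i' j j' b B c x' y q q' hi hx' hyp hj' hc hq hq' hqq
        fun k => (hy k).trans (congrFun hd k)]
    abel

theorem scaling_spec {ε : P} (hε : Parity.par ε = (0 : ZMod 2)) (Φ : ThickMorphism P M₁ M₂) :
    IsScaling ε Φ (scaling hε Φ) :=
  ⟨rfl, fun B c i j _b x q hc hx hj hq =>
    (exists_scaledGen hε Φ i j).choose_spec.2.2 B c x q (Φ.isPt hx hj hc hq)⟩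

theorem existsUnique_scaling {ε : P} (hε : Parity.par ε = (0 : ZMod 2))
    (Φ : ThickMorphism P M₁ M₂) : ∃! Φ' : ThickMorphism P M₁ M₂, IsScaling ε Φ Φ' := by
  refine ⟨_, scaling_spec hε Φ, fun Φ' h => ?_⟩
  have h' := scaling_spec hε Φ
  refine ThickMorphism.ext_values (h.1.trans h'.1.symm) fun B c i j b x q hc hx hj hq => ?_
  rw [h.1] at hj
  rw [h.2 B c i j b x q hc hx hj hq, h'.2 B c i j b x q hc hx hj hq]

theorem IsScaling.isFormal {ε : P} {Φ Φ' : ThickMorphism P M₁ M₂} (h : IsScaling ε Φ Φ') :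
    Φ'.IsFormal := by
  refine ThickMorphism.isFormal_of_evalAt fun B i j b x hx hj => ?_
  rw [h.1] at hj
  rw [h.2 B 0 i j b x 0 SuperWeil.isFormal_zero hx hj SuperWeil.isFormal_zero]
  simp

end Parameters

/-! ## Even functions as thick morphisms to a point -/

section Functions

variable {n m n₁ m₁ n₂ m₂ n₃ m₃ : ℕ} {P : Type} [Fintype P] [LinearOrder P] [Parity P]
  {M : SuperManifold.{u} n m} {M₁ : SuperManifold.{u} n₁ m₁} {M₂ : SuperManifold.{u} n₂ m₂}
  {M₃ : SuperManifold.{u} n₃ m₃}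

instance : IsEmpty (Ix 0 0) := ⟨fun k => match k with
  | .even a => a.elim0
  | .odd b => b.elim0⟩

/-- The one-point supermanifold. -/
def pointManifold : SuperManifold.{u} 0 0 where
  carrier := PUnit
  ι := PUnit
  chart _ := (Homeomorph.homeomorphOfUnique PUnit (Fin 0 → ℝ)).toOpenPartialHomeomorph
  cover _b := ⟨PUnit.unit, trivial⟩
  trans _ _ k := isEmptyElim k
  trans_smooth _ _ k := isEmptyElim k
  trans_par _ _ k := isEmptyElim k
  trans_body _ _ _ _ _ a := a.elim0
  trans_refl _ _ _ _ _ _ _ k := isEmptyElim k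
  trans_cocycle _ _ _ _ _ _ _ _ _ _ _ k := isEmptyElim k

theorem EvenFunction.evalAt_tr (g : EvenFunction P M) {B : SuperWeil} {i i' : M.ι} {b : M.carrier}
    {c : P → B} {x : Ix n m → B} (hc : B.IsFormal c) (hx : M.IsPoint B i' b x)
    (hi : b ∈ (M.chart i).source) (q q' : Ix 0 0 → B) :
    evalAt (g.val i') c x q = evalAt (g.val i) c (M.tr i' i x) q' := by
  rw [Subsingleton.elim q 0, Subsingleton.elim q' 0]
  exact (g.compat i' i b B c x hc hx hi).symm

/-- An even function as a thick morphism to the point. -/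
def EvenFunction.toThick (g : EvenFunction P M) : ThickMorphism P M pointManifold.{u} where
  base _ := PUnit.unit
  base_continuous := continuous_const
  gen i _ := g.val i
  gen_smooth i j := by
    have : {x | x ∈ (M.chart i).target ∧ PUnit.unit ∈ ((pointManifold.{u}).chart j).source} =
        (M.chart i).target := Set.ext fun x => ⟨fun h => h.1, fun h => ⟨h, trivial⟩⟩
    exact (congrArg (fun U => IsSmoothOn U (g.val i)) this).mpr (g.smooth i)
  gen_even i _ := g.even i
  gen_base _ _ _ _ _ a := a.elim0
  gen_law := by
    intro i i' j j' b B c x' y q q' hi hx' _ _ hc _ _ _ _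
    rw [g.evalAt_tr hc hx' hi q' q]
    simp

/-- A thick morphism to the point as an even function. -/
def ThickMorphism.toFun (Φ : ThickMorphism P M pointManifold.{u}) : EvenFunction P M where
  val i := Φ.gen i PUnit.unit
  smooth i := by
    have : (M.chart i).target = {x | x ∈ (M.chart i).target ∧ Φ.base ((M.chart i).symm x) ∈
        ((pointManifold.{u}).chart PUnit.unit).source} :=
      Set.ext fun x => ⟨fun h => ⟨h, trivial⟩, fun h => h.1⟩
    rw [this]
    exact Φ.gen_smooth i PUnit.unit
  even i := Φ.gen_even i _
  compat i j b B c x hc hx hj :=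
    (Φ.evalAt_gen_tr hx hj (j := PUnit.unit) trivial hc SuperWeil.isFormal_zero).symm

theorem ThickMorphism.toThick_toFun (Φ : ThickMorphism P M pointManifold.{u}) :
    Φ.toFun.toThick = Φ := ThickMorphism.ext' (funext fun _ => rfl) rfl

theorem EvenFunction.isFormal_iff (g : EvenFunction P M) : g.IsFormal ↔ g.toThick.IsFormal :=
  ⟨fun h i _ α h1 _ => h i α h1, fun h i α h1 => h i PUnit.unit α h1 fun k => isEmptyElim k⟩

theorem solves_toThick_iff {Φ : ThickMorphism P M₁ M₂} {g : EvenFunction P M₂} {B : SuperWeil}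
    {c : P → B} {i : M₁.ι} {j : M₂.ι} {b : M₁.carrier} {x : Ix n₁ m₁ → B} {y q : Ix n₂ m₂ → B} :
    Solves g.toThick Φ c i j PUnit.unit b x 0 y q ↔ PullbackSolves Φ g c i j b x y q := Iff.rfl

/-- A point has no coordinates and no momenta, so the pullback system is literally the composition
system for the thick morphism defined by g. -/
theorem isPullback_iff {Φ : ThickMorphism P M₁ M₂} {g : EvenFunction P M₂} (hg : g.IsFormal)
    {f : EvenFunction P M₁} : IsPullback Φ g f ↔ HasCompositeGen g.toThick Φ f.toThick := by
  have hgf := g.isFormal_iff.1 hg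
  constructor
  · intro h
    refine ⟨rfl, fun B c i j l b x r y q ha s => ?_⟩
    obtain ⟨hc, hx, hj, -, -⟩ := ha
    rw [Subsingleton.elim r 0] at s ⊢
    exact (h B c i j b x hc hx hj).2 y q (solves_toThick_iff.1 s)
  · intro h B c i j b x hc hx hj
    have ha : Admissible g.toThick Φ c i j PUnit.unit b x 0 :=
      ⟨hc, hx, hj, trivial, SuperWeil.isFormal_zero⟩
    obtain ⟨yq, s, hu⟩ := existsUnique_solves hgf ha
    exact ⟨⟨yq, solves_toThick_iff.1 s, fun yq' s' => hu yq' (solves_toThick_iff.2 s')⟩,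
      fun y q s => h.2 B c i j PUnit.unit b x 0 y q ha (solves_toThick_iff.2 s)⟩

theorem existsUnique_pullback (Φ : ThickMorphism P M₁ M₂) {g : EvenFunction P M₂}
    (hg : g.IsFormal) : ∃! f : EvenFunction P M₁, IsPullback Φ g f := by
  have hgf := g.isFormal_iff.1 hg
  have h := hasCompositeGen_comp (Φ₂₁ := Φ) hgf
  rw [← ThickMorphism.toThick_toFun (g.toThick.comp Φ hgf)] at h
  refine ⟨_, (isPullback_iff hg).2 h, fun f hf => ?_⟩
  have := congrArg ThickMorphism.toFun (((isPullback_iff hg).1 hf).unique hgf h)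
  exact this

theorem IsPullback.isFormal {Φ : ThickMorphism P M₁ M₂} {g : EvenFunction P M₂} (hg : g.IsFormal)
    {f : EvenFunction P M₁} (h : IsPullback Φ g f) (hΦ : Φ.IsFormal) : f.IsFormal :=
  f.isFormal_iff.2 (((isPullback_iff hg).1 h).isFormal (g.isFormal_iff.1 hg) hΦ)

/-- Contravariance of the pullback is associativity of composition with a point as the last
manifold. -/
theorem isPullback_comp {Φ₂₁ : ThickMorphism P M₁ M₂} {Φ₃₂ : ThickMorphism P M₂ M₃}
    {Φ₃₁ : ThickMorphism P M₁ M₃} {h : EvenFunction P M₃} {g : EvenFunction P M₂}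
    {f : EvenFunction P M₁} (h32 : Φ₃₂.IsFormal) (hh : h.IsFormal)
    (hΦ : HasCompositeGen Φ₃₂ Φ₂₁ Φ₃₁) (hg : IsPullback Φ₃₂ h g) :
    IsPullback Φ₃₁ h f ↔ IsPullback Φ₂₁ g f :=
  (isPullback_iff hh).trans ((hasCompositeGen_assoc h32 (h.isFormal_iff.1 hh) hΦ
    ((isPullback_iff hh).1 hg)).trans (isPullback_iff (hg.isFormal hh h32)).symm)

/-! ### Multiples of parameter-free functions -/

theorem EvenFunction.ext_values {f g : EvenFunction P M}
    (h : ∀ (B : SuperWeil) (c : P → B) (i : M.ι) (b : M.carrier) (x : Ix n m → B), B.IsFormal c →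
      M.IsPoint B i b x → evalAt (f.val i) c x 0 = evalAt (g.val i) c x 0) : f = g := by
  have : f.toThick = g.toThick :=
    ThickMorphism.ext_values rfl fun B c i j b x q hc hx _ _ => by
      rw [Subsingleton.elim q 0]
      exact h B c i b x hc hx
  exact congrArg ThickMorphism.toFun this

theorem EvenFunction.isPt (M : SuperManifold.{u} n m) {B : SuperWeil} {i : M.ι} {b : M.carrier}
    {c : P → B} {x : Ix n m → B} {q : Ix 0 0 → B} (hx : M.IsPoint B i b x) (hc : B.IsFormal c) :
    IsPt (M.chart i).target c x q :=
  hx.isPt ((M.chart i).map_source hx.1) hc fun k => isEmptyElim k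

theorem exists_multipleVal {ε : P} (hε : Parity.par ε = (0 : ZMod 2))
    (g : EvenFunction (Ix 0 0) M) (i : M.ι) :
    ∃ F : Coef n P m (Ix 0 0), IsSmoothOn (M.chart i).target F ∧ IsHomog 0 F ∧
      ∀ (B : SuperWeil) (c : P → B) (x : Ix n m → B) (q : Ix 0 0 → B),
        IsPt (M.chart i).target c x q → evalAt F c x q = c ε * evalAt (g.val i) 0 x 0 := by
  have hU := (M.chart i).open_target
  refine exists_superfunction hU (fun N => ?_) fun B c x q h => ?_
  · refine (isRepN_param N ε).mul hU ?_
    exact IsRepN.comp hU hU (g.smooth i).smoothCoef (C := fun s B _ _ _ => (0 : Ix 0 0 → B) s)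
      (X := fun k _ _ x _ => x k) (R := fun s B _ _ _ => (0 : Ix 0 0 → B) s)
      (fun s => isRepN_const_zero N s) (isRepN_coord N) (fun s => isRepN_const_zero N s)
      fun B c x q h => h.param_zero
  · have h3 : c ε ∈ B.gr 0 := hε ▸ (h.param ε).1
    exact B.mul_mem_even h3 (evalAt_mem hU (g.even i)
      (h.param_zero (P' := Ix 0 0) (Q' := Ix 0 0)))

/-- The function `ε g`. -/
def EvenFunction.multiple {ε : P} (hε : Parity.par ε = (0 : ZMod 2))
    (g : EvenFunction (Ix 0 0) M) : EvenFunction P M where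
  val i := (exists_multipleVal hε g i).choose
  smooth i := (exists_multipleVal hε g i).choose_spec.1
  even i := (exists_multipleVal hε g i).choose_spec.2.1
  compat i j b B c x hc hx hj := by
    rw [(exists_multipleVal hε g i).choose_spec.2.2 B c x 0 (EvenFunction.isPt M hx hc),
      (exists_multipleVal hε g j).choose_spec.2.2 B c _ 0 (EvenFunction.isPt M (hx.tr hj) hc),
      g.compat i j b B 0 x SuperWeil.isFormal_zero hx hj]

theorem existsUnique_multiple {ε : P} (hε : Parity.par ε = (0 : ZMod 2))
    (g : EvenFunction (Ix 0 0) M) : ∃! h : EvenFunction P M, g.IsMultiple ε h := by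
  have hm : g.IsMultiple ε (EvenFunction.multiple hε g) := fun B c i b x hc hx =>
    (exists_multipleVal hε g i).choose_spec.2.2 B c x 0 (EvenFunction.isPt M hx hc)
  refine ⟨_, hm, fun h hh => EvenFunction.ext_values fun B c i b x hc hx => ?_⟩
  rw [hh B c i b x hc hx, hm B c i b x hc hx]

theorem EvenFunction.IsMultiple.isFormal {ε : P} {g : EvenFunction (Ix 0 0) M}
    {h : EvenFunction P M} (hm : g.IsMultiple ε h) : h.IsFormal := by
  refine h.isFormal_iff.2 (ThickMorphism.isFormal_of_evalAt fun B i j b x hx _ => ?_)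
  have := hm B 0 i b x SuperWeil.isFormal_zero hx
  rw [Pi.zero_apply, zero_mul] at this
  exact this

end Functions

end

end Microformal

theorem mainTheorem2 (P : Type) [Fintype P] [LinearOrder P] [Parity P]
    {n₁ m₁ n₂ m₂ n₃ m₃ n₄ m₄ : ℕ}
    (M₁ : SuperManifold.{u} n₁ m₁) (M₂ : SuperManifold.{u} n₂ m₂)
    (M₃ : SuperManifold.{u} n₃ m₃) (M₄ : SuperManifold.{u} n₄ m₄) :
    -- composition law
    (∀ (Φ₂₁ : ThickMorphism P M₁ M₂) (Φ₃₂ : ThickMorphism P M₂ M₃), Φ₃₂.IsFormal →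
      (∀ i j l, ∃! YQ : (Ix n₂ m₂ → Coef n₁ P m₁ (Ix n₃ m₃)) × (Ix n₂ m₂ → Coef n₁ P m₁ (Ix n₃ m₃)),
        IsSeriesSolution Φ₃₂ Φ₂₁ i j l YQ.1 YQ.2) ∧
      (∀ (B : SuperWeil) (c : P → B) i j l b x r, Admissible Φ₃₂ Φ₂₁ c i j l b x r →
        ∃! yq : (Ix n₂ m₂ → B) × (Ix n₂ m₂ → B), Solves Φ₃₂ Φ₂₁ c i j l b x r yq.1 yq.2) ∧
      (∃! Φ₃₁ : ThickMorphism P M₁ M₃, HasCompositeGen Φ₃₂ Φ₂₁ Φ₃₁) ∧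
      ∀ Φ₃₁ : ThickMorphism P M₁ M₃, HasCompositeGen Φ₃₂ Φ₂₁ Φ₃₁ →
        IsRelComposite Φ₃₂ Φ₂₁ Φ₃₁ ∧ HasFirstOrderPart Φ₃₂ Φ₂₁ Φ₃₁ ∧
          (Φ₂₁.IsFormal → Φ₃₁.IsFormal)) ∧
    -- associativity
    (∀ (Φ₂₁ : ThickMorphism P M₁ M₂) (Φ₃₂ : ThickMorphism P M₂ M₃) (Φ₄₃ : ThickMorphism P M₃ M₄)
      (Φ₃₁ : ThickMorphism P M₁ M₃) (Φ₄₂ : ThickMorphism P M₂ M₄) (Φ₄₁ : ThickMorphism P M₁ M₄),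
      Φ₃₂.IsFormal → Φ₄₃.IsFormal → IsComposite Φ₃₂ Φ₂₁ Φ₃₁ → IsComposite Φ₄₃ Φ₃₂ Φ₄₂ →
      (IsComposite Φ₄₃ Φ₃₁ Φ₄₁ ↔ IsComposite Φ₄₂ Φ₂₁ Φ₄₁)) ∧
    -- identities
    (∃! I : ThickMorphism P M₁ M₁, IsIdentity I) ∧
    (∀ (I₁ : ThickMorphism P M₁ M₁) (I₂ : ThickMorphism P M₂ M₂), IsIdentity I₁ → IsIdentity I₂ →
      I₁.IsFormal ∧ ∀ Φ : ThickMorphism P M₁ M₂,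
        IsComposite I₂ Φ Φ ∧ (Φ.IsFormal → IsComposite Φ I₁ Φ)) ∧
    -- pullbacks, and their contravariance
    (∀ (Φ : ThickMorphism P M₁ M₂) (g : EvenFunction P M₂), g.IsFormal →
      (∃! f : EvenFunction P M₁, IsPullback Φ g f) ∧
      ∀ f, IsPullback Φ g f → Φ.IsFormal → f.IsFormal) ∧
    (∀ (Φ₂₁ : ThickMorphism P M₁ M₂) (Φ₃₂ : ThickMorphism P M₂ M₃) (Φ₃₁ : ThickMorphism P M₁ M₃)
      (h : EvenFunction P M₃) (g : EvenFunction P M₂) (f : EvenFunction P M₁),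
      Φ₃₂.IsFormal → h.IsFormal → IsComposite Φ₃₂ Φ₂₁ Φ₃₁ → IsPullback Φ₃₂ h g →
      (IsPullback Φ₃₁ h f ↔ IsPullback Φ₂₁ g f)) ∧
    -- every thick morphism and every even function becomes formal after scaling
    (∀ Φ : ThickMorphism (Ix 0 0) M₁ M₂, ∃! Φ' : ThickMorphism P M₁ M₂, IsConstantExtension Φ Φ') ∧
    (∀ ε : P, Parity.par ε = 0 →
      (∀ Φ : ThickMorphism P M₁ M₂,
        (∃! Φ' : ThickMorphism P M₁ M₂, IsScaling ε Φ Φ') ∧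
        ∀ Φ' : ThickMorphism P M₁ M₂, IsScaling ε Φ Φ' → Φ'.IsFormal) ∧
      ∀ g : EvenFunction (Ix 0 0) M₁,
        (∃! h : EvenFunction P M₁, g.IsMultiple ε h) ∧
        ∀ h : EvenFunction P M₁, g.IsMultiple ε h → h.IsFormal) := by
  refine ⟨fun Φ₂₁ Φ₃₂ hf => ⟨existsUnique_series hf,
      fun B c i j l b x r ha => existsUnique_solves hf ha,
      ⟨_, hasCompositeGen_comp hf, fun Φ h => h.unique hf (hasCompositeGen_comp hf)⟩,
      fun Φ₃₁ h => ⟨isRelComposite_of_gen hf h, h.firstOrderPart hf, fun h' => h.isFormal hf h'⟩⟩,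
    fun Φ₂₁ Φ₃₂ Φ₄₃ Φ₃₁ Φ₄₂ Φ₄₁ h32 h43 h31 h42 => ?_,
    ⟨_, identityMorphism_isIdentity, fun I h => h.unique identityMorphism_isIdentity⟩,
    fun I₁ I₂ h₁ h₂ => ⟨h₁.isFormal, fun Φ =>
      ⟨isComposite_identity_left h₂ Φ, isComposite_identity_right h₁⟩⟩,
    fun Φ g hg => ⟨existsUnique_pullback Φ hg, fun f hf => hf.isFormal hg⟩,
    fun Φ₂₁ Φ₃₂ Φ₃₁ h g f h32 hh hΦ hg => isPullback_comp h32 hh hΦ.2 hg,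
    existsUnique_constantExtension,
    fun ε hε => ⟨fun Φ => ⟨existsUnique_scaling hε Φ, fun Φ' h => h.isFormal⟩,
      fun g => ⟨existsUnique_multiple hε g, fun h hm => hm.isFormal⟩⟩⟩
  -- The composition of relations follows from the generating function once the outer factor is
  -- formal. For the second bracketing the outer factor is `Φ₄₂`, a composite of formal morphisms.
  exact (isComposite_iff h43).trans ((hasCompositeGen_assoc h32 h43 h31.2 h42.2).trans
    (isComposite_iff (h42.2.isFormal h43 h32)).symm)
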